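/- **Proposition (Optimistic bias for kNN).** Let $d_x\ge 1$, let $\mathcal Y$ be a measurable space, $\mathcal Z\subset\mathbb R^{d_z}$, and let $\ell:\mathbb R^{d_z}\times\mathcal Y\to\mathbb R$ be a (jointly measurable) cost. For a probability law $Q$ on $\mathcal Y$ write $v_Q(z)=\mathbb E_{Y\sim Q}[\ell(z;Y)]$. Fix $M$, and say that $Q$ satisfies (A) with optimal decision $z^*\in\mathcal Z$ if 1. $v_Q$ is twice differentiable on $\mathcal Z$; 2. $\ell(\cdot;y)$ is twice differentiable on $\mathcal Z$ for every $y$, and for $Q$-almost every $y$ and all $z,w\in\mathcal Z$: $|\ell(z;y)|\le M$, $\|\nabla_z\ell(z;y)\|\le M$ and $|\ell(z;y)-\ell(w;y)|\le M\|z-w\|$ (the last bound follows from the gradient bound if $\mathcal Z$ is convex); 3. $\mathcal Z$ is open and bounded; $z^*$ is the unique, well-separated minimizer of $v_Q$ over $\mathcal Z$ (for each $\varepsilon>0$, $\inf\{v_Q(z):z\in\mathcal Z,\|z-z^*\|\ge\varepsilon\}>v_Q(z^*)$); $\nabla v_Q(z^*)=0$ and $\nabla^2v_Q(z^*)$ is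 positive definite. Suppose that some law $Q_0$ satisfies (A) with optimal decision $z_0$, and that $\nabla_z\ell(z_0;Y)$ is not $Q_0$-almost surely zero. Let $0<\gamma_v\le 1/2$ and let $k_n\le n$ be integers with $k_n=\Theta(n^{2\gamma_v})$. A kNN learner on data $\mathcal D_n=((X_i,Y_i))_{i\le n}$ is a measurable map $\hat z(x)=\hat z(\mathcal D_n;x)$ with $$\hat z(x)\in\operatorname*{argmin}_{z\in\mathcal Z}\ \sum_{i\in N_n(x)}\ell(z;Y_i),$$ where $N_n(x)$ is a set of $k_n$ nearest neighbours of $x$ among $X_1,\dots,X_n$ (distance ties broken arbitrarily), where the choice among several minimizers depends only on the objective function, and where $\hat z(x)\in\mathcal Z$ is any point, also depending only on the objective function, if no minimizer exists. Then for each $n$ there is a distribution $P_n$ of $(X,Y)$ on $\mathbb R^{d_x}\times\mathcal Y$ of the following form. With $m_n=\max\{1,\lfloor n/(2k_n)\rfloor\}$, there are bounded measurable regions $R_1,\dots,R_{m_n}\subset\mathbb R^{d_x}$ (depending on $n$) of the same positive volume with $\operatorname{diam}(R_i)<d(R_i,R_j)$ for $i\ne j$, and laws $Q_1,Q_2,\dots$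 on $\mathcal Y$ (not depending on $n$), each satisfying (A) with the same $M$, such that $P_n$ is the equal-weight mixture over $j\le m_n$ of the laws under which $X$ is uniform on $R_j$ and $Y\mid X\sim Q_j$. For every kNN learner, with $\mathcal D_n$ an i.i.d. sample of size $n$ from $P_n$, $c(z)=\mathbb E_{P_n}[\ell(z(X);Y)]$ and $c_n(z)=\frac1n\sum_{i\le n}\ell(z(X_i);Y_i)$: * $\hat z$ has variability rate $\gamma_v$, i.e. there are constants $0<c_1\le c_2$ such that for all large $n$ and $P_n$-almost every $x$, $c_1n^{-\gamma_v}\le\mathbb E_{\mathcal D_n}\|\hat z(x)-\mathbb E_{\mathcal D_n}[\hat z(x)]\|\le c_2n^{-\gamma_v}$; * $c_n(\hat z)$ and $c(\hat z)$ are integrable for every $n$, $\mathbb E_{\mathcal D_n}[c_n(\hat z)-c(\hat z)]<0$ for all large $n$, and $$\mathbb E_{\mathcal D_n}[c_n(\hat z)-c(\hat z)]=\Theta(1/k_n)=\Theta(n^{-2\gamma_v})$$ (orders of magnitude of the absolute value). -/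

import Mathlib

open MeasureTheory Filter Asymptotics
open scoped ENNReal Topology

noncomputable section

namespace KNNBias

/-- Twice differentiability at every point of an open set. -/
def TwiceDifferentiable {dz : ℕ} (f : EuclideanSpace ℝ (Fin dz) → ℝ)
    (Z : Set (EuclideanSpace ℝ (Fin dz))) : Prop :=
  ∀ z ∈ Z, DifferentiableAt ℝ f z ∧ DifferentiableAt ℝ (fderiv ℝ f) z

/-- The expected cost `v(z) = E_{Y ∼ Q} [ℓ(z; Y)]` of a decision `z`. -/
def expectedCost {dz : ℕ} {Y : Type*} [MeasurableSpace Y]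
    (ℓ : EuclideanSpace ℝ (Fin dz) → Y → ℝ) (Q : Measure Y)
    (z : EuclideanSpace ℝ (Fin dz)) : ℝ :=
  ∫ y, ℓ z y ∂Q

/-- Smoothness of the expected cost, regularity of the cost, and optimality conditions, for one
conditional law `Q` of the outcome, with bound `M` and optimal decision `zstar`. A joint law
satisfies these assumptions when its conditional laws given `X = x` do for all `x`. -/
structure Assumptions {dz : ℕ} {Y : Type*} [MeasurableSpace Y]
    (M : ℝ) (ℓ : EuclideanSpace ℝ (Fin dz) → Y → ℝ) (Z : Set (EuclideanSpace ℝ (Fin dz)))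
    (Q : Measure Y) (zstar : EuclideanSpace ℝ (Fin dz)) : Prop where
  isProbabilityMeasure : IsProbabilityMeasure Q
  smooth_expectedCost : TwiceDifferentiable (expectedCost ℓ Q) Z
  smooth_cost : ∀ y, TwiceDifferentiable (fun z => ℓ z y) Z
  cost_bounded : ∀ᵐ y ∂Q, ∀ z ∈ Z, |ℓ z y| ≤ M
  gradient_bounded : ∀ᵐ y ∂Q, ∀ z ∈ Z, ‖fderiv ℝ (fun w => ℓ w y) z‖ ≤ M
  /-- On a convex `Z` this is the same as the bound on the gradient. -/
  cost_lipschitz : ∀ᵐ y ∂Q, ∀ z ∈ Z, ∀ w ∈ Z, |ℓ z y - ℓ w y| ≤ M * dist z w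
  isOpen : IsOpen Z
  isBounded : Bornology.IsBounded Z
  mem : zstar ∈ Z
  /-- `zstar` is the minimizer of the expected cost, unique and well separated. -/
  wellSeparated : ∀ ε > 0, ∃ η > 0, ∀ z ∈ Z, ε ≤ dist z zstar →
    expectedCost ℓ Q zstar + η ≤ expectedCost ℓ Q z
  first_order : fderiv ℝ (expectedCost ℓ Q) zstar = 0
  second_order : ∀ h : EuclideanSpace ℝ (Fin dz), h ≠ 0 →
    0 < (fderiv ℝ (fderiv ℝ (expectedCost ℓ Q)) zstar h) h

/-- `S` is a set of (indices of) `k` nearest neighbours of `x` among the covariates `X i`;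
ties in the distances may be broken in any way. -/
def IsNearestNeighborSet {dx n : ℕ} (k : ℕ) (X : Fin n → EuclideanSpace ℝ (Fin dx))
    (x : EuclideanSpace ℝ (Fin dx)) (S : Finset (Fin n)) : Prop :=
  S.card = k ∧ ∀ i ∈ S, ∀ j ∉ S, dist (X i) x ≤ dist (X j) x

/-- `argmin` is a way to pick a minimizer over `Z` of an objective that has one. -/
def IsArgminRule {dz : ℕ} (Z : Set (EuclideanSpace ℝ (Fin dz)))
    (argmin : (EuclideanSpace ℝ (Fin dz) → ℝ) → EuclideanSpace ℝ (Fin dz)) : Prop :=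
  ∀ f, argmin f ∈ Z ∧ ((∃ z ∈ Z, IsMinOn f Z z) → IsMinOn f Z (argmin f))

/-- The kNN learner on `n` data points: the decision at `x` is a minimizer over `Z` of the total
cost over `k` nearest neighbours of `x`. -/
def IsKNNLearner {dx dz : ℕ} {Y : Type*} [MeasurableSpace Y]
    (ℓ : EuclideanSpace ℝ (Fin dz) → Y → ℝ) (Z : Set (EuclideanSpace ℝ (Fin dz))) (n k : ℕ)
    (zhat : (Fin n → EuclideanSpace ℝ (Fin dx) × Y) → EuclideanSpace ℝ (Fin dx) →
      EuclideanSpace ℝ (Fin dz)) : Prop :=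
  Measurable (Function.uncurry zhat) ∧
  ∃ argmin, IsArgminRule Z argmin ∧
    ∀ D x, ∃ S : Finset (Fin n), IsNearestNeighborSet k (fun i => (D i).1) x S ∧
      zhat D x = argmin (fun z => ∑ i ∈ S, ℓ z (D i).2)

/-- The law of `n` i.i.d. data points from `P`. -/
def datasetLaw {dx : ℕ} {Y : Type*} [MeasurableSpace Y]
    (P : Measure (EuclideanSpace ℝ (Fin dx) × Y)) (n : ℕ) :
    Measure (Fin n → EuclideanSpace ℝ (Fin dx) × Y) :=
  Measure.pi fun _ => P

/-- The out-of-sample performance `c(z) = E_P [ℓ(z(X); Y)]` of a decision mapping. -/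
def trueCost {dx dz : ℕ} {Y : Type*} [MeasurableSpace Y]
    (ℓ : EuclideanSpace ℝ (Fin dz) → Y → ℝ) (P : Measure (EuclideanSpace ℝ (Fin dx) × Y))
    (z : EuclideanSpace ℝ (Fin dx) → EuclideanSpace ℝ (Fin dz)) : ℝ :=
  ∫ p, ℓ (z p.1) p.2 ∂P

/-- The plug-in evaluation `c_n(z) = (1/n) ∑ ℓ(z(X_i); Y_i)` of a decision mapping. -/
def plugInCost {dx dz : ℕ} {Y : Type*}
    (ℓ : EuclideanSpace ℝ (Fin dz) → Y → ℝ) {n : ℕ}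
    (D : Fin n → EuclideanSpace ℝ (Fin dx) × Y)
    (z : EuclideanSpace ℝ (Fin dx) → EuclideanSpace ℝ (Fin dz)) : ℝ :=
  (∑ i, ℓ (z (D i).1) (D i).2) / n

/-- The bias `E[c_n(ẑ) - c(ẑ)]` of the plug-in evaluation of a learner. -/
def plugInBias {dx dz : ℕ} {Y : Type*} [MeasurableSpace Y]
    (ℓ : EuclideanSpace ℝ (Fin dz) → Y → ℝ) (P : Measure (EuclideanSpace ℝ (Fin dx) × Y))
    (n : ℕ) (zhat : (Fin n → EuclideanSpace ℝ (Fin dx) × Y) → EuclideanSpace ℝ (Fin dx) →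
      EuclideanSpace ℝ (Fin dz)) : ℝ :=
  ∫ D, (plugInCost ℓ D (zhat D) - trueCost ℓ P (zhat D)) ∂(datasetLaw P n)

/-- `E ‖ẑ(x) - E[ẑ(x)]‖`, with expectations over the data. -/
def variability {dx dz : ℕ} {Y : Type*} [MeasurableSpace Y]
    (P : Measure (EuclideanSpace ℝ (Fin dx) × Y))
    (n : ℕ) (zhat : (Fin n → EuclideanSpace ℝ (Fin dx) × Y) → EuclideanSpace ℝ (Fin dx) →
      EuclideanSpace ℝ (Fin dz)) (x : EuclideanSpace ℝ (Fin dx)) : ℝ :=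
  ∫ D, ‖zhat D x - ∫ D', zhat D' x ∂(datasetLaw P n)‖ ∂(datasetLaw P n)

/-- Variability convergence rate `γ`: `E ‖ẑ(x) - E[ẑ(x)]‖ = Θ(n ^ (-γ))` for almost every `x`.
As the law depends on `n`, the constants do not depend on `x`. -/
def HasVariabilityRate {dx dz : ℕ} {Y : Type*} [MeasurableSpace Y]
    (P : ℕ → Measure (EuclideanSpace ℝ (Fin dx) × Y))
    (zhat : ∀ n, (Fin n → EuclideanSpace ℝ (Fin dx) × Y) → EuclideanSpace ℝ (Fin dx) →
      EuclideanSpace ℝ (Fin dz)) (γ : ℝ) : Prop :=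
  ∃ c₁ > 0, ∃ c₂ > 0, ∀ᶠ n : ℕ in atTop, ∀ᵐ x ∂((P n).map Prod.fst),
    c₁ * (n : ℝ) ^ (-γ) ≤ variability (P n) n (zhat n) x ∧
      variability (P n) n (zhat n) x ≤ c₂ * (n : ℝ) ^ (-γ)

/-- Regions of the same positive finite volume, each of diameter less than its distance to every
other region. -/
structure SeparatedRegions {dx m : ℕ} (R : Fin m → Set (EuclideanSpace ℝ (Fin dx))) : Prop where
  measurableSet : ∀ i, MeasurableSet (R i)
  isBounded : ∀ i, Bornology.IsBounded (R i)
  volume_pos : ∀ i, 0 < volume (R i)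
  volume_eq : ∀ i j, volume (R i) = volume (R j)
  separated : ∀ i j, i ≠ j → ∃ s, Metric.diam (R i) < s ∧ ∀ x ∈ R i, ∀ y ∈ R j, s ≤ dist x y

/-- The mixture, with equal weights, of the laws under which `X` is uniform on the region `R i`
and `Y` has law `Q i` given `X`. -/
def clusterMixture {dx m : ℕ} {Y : Type*} [MeasurableSpace Y]
    (R : Fin m → Set (EuclideanSpace ℝ (Fin dx))) (Q : Fin m → Measure Y) :
    Measure (EuclideanSpace ℝ (Fin dx) × Y) :=
  (m : ℝ≥0∞)⁻¹ • ∑ i, (ProbabilityTheory.cond volume (R i)).prod (Q i)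

end KNNBias

end

/-!
Let the law of the outcome be the same `Q` in all regions. Given the covariates, which almost surely
have no ties in their distances, the decision at a point is then a minimizer `ẑ` of the total cost
`T` over `k` i.i.d. outcomes. Write `v` for the expected cost and `z₀` for the optimal decision.

At a data point, which is its own neighbour, the in-sample cost has mean `E [T(ẑ)] / k` by
exchangeability of the neighbours, while `E [T(z₀)] / k = v(z₀) ≤ E [v(ẑ)]`. So the bias is
`-E [T(z₀) - T(ẑ)] / k - E [v(ẑ) - v(z₀)]`, and it remains to see that `E [T(z₀) - T(ẑ)]` is of
order `1` and `E [v(ẑ) - v(z₀)]` at most of order `1 / k`.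

The upper bounds hold since `T - k v` varies by at most about `r` between points at distance
`r / √k`, by a chaining argument, while `k (v - v(z₀))` grows quadratically in `r`. For the lower
bound, consider a step of length of order `1 / √k` in a direction in which the gradient of the cost
at `z₀` is not degenerate: one of the step and its opposite decreases `T` by an amount of order `1`
in expectation. If `ẑ` concentrated around a point at a rate faster than `1 / √k`, then the same
moduli of continuity would make `E [T(z₀) - T(ẑ)]` small; hence the lower bound on the variability.
-/

noncomputable section

namespace KNNBias

/-! ### Chaining on dyadic grids -/

section Chaining

variable {d p : ℕ} {Ω : Type*} [MeasurableSpace Ω]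

/-- The point `s • a` of the grid of mesh `s`. -/
def gridPoint (s : ℝ) (a : Fin d → ℤ) : EuclideanSpace ℝ (Fin d) :=
  WithLp.toLp 2 fun l => s * a l

/-- The integer points of the cube `[-m, m] ^ d`. -/
def gridBox (d m : ℕ) : Finset (Fin d → ℤ) :=
  Fintype.piFinset fun _ => Finset.Icc (-(m : ℤ)) m

/-- The increment of `g` from the point `a` of the grid of mesh `s` to the point with offset `e`
from it in the grid of mesh `s / 2`. -/
def gridIncrement (g : EuclideanSpace ℝ (Fin d) → ℝ) (s : ℝ) (a e : Fin d → ℤ) : ℝ :=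
  g (gridPoint s a) - g (gridPoint (s / 2) (2 • a + e))

lemma mem_gridBox {m : ℕ} {a : Fin d → ℤ} : a ∈ gridBox d m ↔ ∀ l, |a l| ≤ m := by
  simp [gridBox, abs_le]

lemma card_gridBox (d m : ℕ) : (gridBox d m).card = (2 * m + 1) ^ d := by
  have h : ((m : ℤ) + 1 + m).toNat = 2 * m + 1 := by omega
  simp [gridBox, h]

lemma norm_gridPoint_sub_le {s : ℝ} (hs : 0 ≤ s) (a : Fin d → ℤ) {e : Fin d → ℤ}
    (he : e ∈ gridBox d 1) :
    ‖gridPoint s a - gridPoint (s / 2) (2 • a + e)‖ ≤ d * s := by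
  rw [EuclideanSpace.norm_eq]
  apply Real.sqrt_le_iff.2 ⟨by positivity, ?_⟩
  have coord_le : ∀ l, ‖(gridPoint s a - gridPoint (s / 2) (2 • a + e)).ofLp l‖ ^ 2 ≤ s ^ 2 := by
    intro l
    have coord_eq : (gridPoint s a - gridPoint (s / 2) (2 • a + e)).ofLp l = -(s / 2 * e l) := by
      simp [gridPoint]; ring
    have abs_e : |(e l : ℝ)| ≤ 1 := by exact_mod_cast mem_gridBox.1 he l
    rw [coord_eq, norm_neg, Real.norm_eq_abs, abs_mul, abs_of_nonneg (by positivity : 0 ≤ s / 2)]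
    gcongr
    nlinarith [abs_nonneg (e l : ℝ)]
  calc _ ≤ ∑ _l : Fin d, s ^ 2 := Finset.sum_le_sum fun l _ => coord_le l
    _ = d * s ^ 2 := by simp
    _ ≤ (d * s) ^ 2 := by
      rw [mul_pow]
      gcongr
      exact_mod_cast Nat.le_self_pow two_ne_zero d

/-- The index of the point nearest to `x` in the grid of mesh `R / 2 ^ j`. -/
def dyadicIndex (R : ℝ) (x : EuclideanSpace ℝ (Fin d)) (j : ℕ) : Fin d → ℤ :=
  fun l => round (x l * 2 ^ j / R)

section DyadicIndex

variable {R : ℝ} {x : EuclideanSpace ℝ (Fin d)}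

lemma dyadicIndex_zero (hR : 0 < R) (hx : ∀ l, |x l| < R / 2) : dyadicIndex R x 0 = 0 := by
  funext l
  have := abs_lt.1 (hx l)
  simp only [dyadicIndex, pow_zero, mul_one, Pi.zero_apply, round_eq_zero_iff]
  constructor
  · rw [le_div_iff₀ hR]; linarith
  · rw [div_lt_iff₀ hR]; linarith

lemma dyadicIndex_mem_gridBox (hR : 0 < R) (hx : ∀ l, |x l| < R / 2) (j : ℕ) :
    dyadicIndex R x j ∈ gridBox d (2 ^ j) := by
  refine mem_gridBox.2 fun l => ?_
  have two_pow : (1 : ℝ) ≤ 2 ^ j := one_le_pow₀ one_le_two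
  have scaled : |x l * 2 ^ j / R| ≤ 2 ^ j / 2 := by
    rw [abs_div, abs_mul, abs_of_pos hR, abs_of_pos (by positivity : (0 : ℝ) < 2 ^ j),
      div_le_iff₀ hR]
    nlinarith [(hx l).le]
  have rounding := abs_sub_round (x l * 2 ^ j / R)
  have : |(dyadicIndex R x j l : ℝ)| ≤ 2 ^ j := by
    have := abs_sub (x l * 2 ^ j / R) (x l * 2 ^ j / R - round (x l * 2 ^ j / R))
    rw [sub_sub_cancel] at this
    exact this.trans (by linarith)
  exact_mod_cast this

lemma dyadicIndex_succ_sub_mem_gridBox (R : ℝ) (x : EuclideanSpace ℝ (Fin d)) (j : ℕ) :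
    dyadicIndex R x (j + 1) - 2 • dyadicIndex R x j ∈ gridBox d 1 := by
  refine mem_gridBox.2 fun l => ?_
  have coarse := abs_le.1 (abs_sub_round (x l * 2 ^ j / R))
  have fine := abs_le.1 (abs_sub_round (x l * 2 ^ (j + 1) / R))
  have double : x l * 2 ^ (j + 1) / R = 2 * (x l * 2 ^ j / R) := by ring
  have lt_two : |((dyadicIndex R x (j + 1) l - 2 * dyadicIndex R x j l : ℤ) : ℝ)| < 2 := by
    push_cast
    rw [abs_lt]
    simp only [dyadicIndex]
    rw [double] at fine ⊢
    constructor <;> linarith [coarse.1, coarse.2, fine.1, fine.2]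
  have lt_two' : |dyadicIndex R x (j + 1) l - 2 * dyadicIndex R x j l| < 2 := by
    exact_mod_cast lt_two
  simp only [Pi.sub_apply, nsmul_eq_mul, Nat.cast_one]
  exact Int.lt_add_one_iff.1 lt_two'

lemma tendsto_gridPoint_dyadicIndex (hR : 0 < R) (x : EuclideanSpace ℝ (Fin d)) :
    Tendsto (fun j => gridPoint (R / 2 ^ j) (dyadicIndex R x j)) atTop (𝓝 x) := by
  suffices h : Tendsto (fun j l => R / 2 ^ j * (dyadicIndex R x j l : ℝ)) atTop (𝓝 x.ofLp) from
    ((PiLp.continuous_toLp 2 _).tendsto _).comp h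
  refine tendsto_pi_nhds.2 fun l => tendsto_iff_dist_tendsto_zero.2 ?_
  refine squeeze_zero (g := fun j : ℕ => R / 2 * (1 / 2) ^ j) (fun _ => dist_nonneg) (fun j => ?_)
    (by simpa using (tendsto_pow_atTop_nhds_zero_of_lt_one (r := (1 / 2 : ℝ)) (by norm_num)
      (by norm_num)).const_mul (R / 2))
  have rescale : x l - R / 2 ^ j * (dyadicIndex R x j l : ℝ)
      = R / 2 ^ j * (x l * 2 ^ j / R - dyadicIndex R x j l) := by field_simp
  rw [dist_comm, Real.dist_eq, rescale, abs_mul, abs_of_pos (by positivity)]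
  calc _ ≤ R / 2 ^ j * (1 / 2) := by gcongr; exact abs_sub_round _
    _ = _ := by rw [one_div_pow]; ring

end DyadicIndex

lemma abs_le_of_gridIncrement_le {g : EuclideanSpace ℝ (Fin d) → ℝ} (hg : Continuous g)
    (hg0 : g 0 = 0) {R T : ℝ} (hR : 0 < R)
    (hT : ∀ j : ℕ, ∀ a ∈ gridBox d (2 ^ j), ∀ e ∈ gridBox d 1,
      |gridIncrement g (R / 2 ^ j) a e| ≤ T * (3 / 4) ^ j)
    {x : EuclideanSpace ℝ (Fin d)} (hx : ∀ l, |x l| < R / 2) : |g x| ≤ 4 * T := by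
  have geometric := dist_le_of_le_geometric_of_tendsto₀ (3 / 4) T
    (f := fun j => g (gridPoint (R / 2 ^ j) (dyadicIndex R x j))) (by norm_num)
    (fun j => by
      have h := hT j _ (dyadicIndex_mem_gridBox hR hx j) _ (dyadicIndex_succ_sub_mem_gridBox R x j)
      rwa [gridIncrement, add_sub_cancel, div_div, ← pow_succ] at h)
    ((hg.tendsto x).comp (tendsto_gridPoint_dyadicIndex hR x))
  have origin : gridPoint (R / 2 ^ 0) (0 : Fin d → ℤ) = 0 := by ext l; simp [gridPoint]
  rw [dyadicIndex_zero hR hx, origin, hg0, Real.dist_eq, zero_sub, abs_neg] at geometric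
  exact geometric.trans_eq (by ring)

/-- The weight of the increments of mesh `2 ^ i / 2 ^ j` in `chainEnergy`. It is small enough in `i`
and `j` for the expected energy to be finite, and large enough for a bound on the energy to make
the increments decay like `(3 / 4) ^ j`. -/
def chainWeight (p i j : ℕ) : ℝ :=
  (1 / 2) ^ i * ((1 / 2) ^ i * (4 / 3) ^ j) ^ p

/-- A weighted sum of the `p`-th powers of the increments of `g` along dyadic grids of the cubes
of side `2 ^ i`, which controls the growth of `g`. -/
def chainEnergy (p : ℕ) (g : EuclideanSpace ℝ (Fin d) → ℝ) : ℝ≥0∞ :=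
  ∑' i : ℕ, ∑' j : ℕ, ∑ a ∈ gridBox d (2 ^ j), ∑ e ∈ gridBox d 1,
    ENNReal.ofReal (chainWeight p i j * |gridIncrement g (2 ^ i / 2 ^ j) a e| ^ p)

lemma chainWeight_pos (p i j : ℕ) : 0 < chainWeight p i j := by
  unfold chainWeight; positivity

lemma chainWeight_eq_inv (p i j : ℕ) :
    chainWeight p i j = ((2 ^ i) ^ (p + 1) * ((3 / 4) ^ j) ^ p)⁻¹ := by
  rw [chainWeight, mul_inv, ← inv_pow, ← inv_pow, ← inv_pow, ← inv_pow]
  norm_num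
  ring

lemma chainWeight_mul_le_chainEnergy {g : EuclideanSpace ℝ (Fin d) → ℝ}
    (hfin : chainEnergy p g ≠ ⊤) (i : ℕ) {j : ℕ} {a e : Fin d → ℤ} (ha : a ∈ gridBox d (2 ^ j))
    (he : e ∈ gridBox d 1) :
    chainWeight p i j * |gridIncrement g (2 ^ i / 2 ^ j) a e| ^ p
      ≤ (chainEnergy p g).toReal := by
  rw [← ENNReal.ofReal_le_iff_le_toReal hfin]
  refine le_trans ?_ (ENNReal.le_tsum i)
  refine le_trans ?_ (ENNReal.le_tsum j)
  refine le_trans ?_ (Finset.single_le_sum (fun _ _ => zero_le) ha)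
  exact Finset.single_le_sum (f := fun e => ENNReal.ofReal
    (chainWeight p i j * |gridIncrement g (2 ^ i / 2 ^ j) a e| ^ p)) (fun _ _ => zero_le) he

lemma abs_pow_le_chainEnergy (hp : p ≠ 0) {g : EuclideanSpace ℝ (Fin d) → ℝ}
    (hg : Continuous g) (hg0 : g 0 = 0) (hfin : chainEnergy p g ≠ ⊤)
    (x : EuclideanSpace ℝ (Fin d)) :
    |g x| ^ p ≤ 4 ^ p * (chainEnergy p g).toReal * (4 * (1 + ‖x‖)) ^ (p + 1) := by
  obtain ⟨m, hm, hm'⟩ := exists_nat_pow_near (x := 2 * (1 + ‖x‖)) (y := 2)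
    (by linarith [norm_nonneg x]) (by norm_num)
  set i := m + 1
  set B := (chainEnergy p g).toReal
  have : 0 ≤ B := ENNReal.toReal_nonneg
  have side_le : (2 : ℝ) ^ i ≤ 4 * (1 + ‖x‖) := by rw [pow_succ]; linarith
  set T : ℝ := 2 ^ i * (2 ^ i * B) ^ (1 / p : ℝ)
  have : 0 ≤ T := by positivity
  have hTp : T ^ p = (2 ^ i) ^ (p + 1) * B := by
    rw [mul_pow, one_div, Real.rpow_inv_natCast_pow (by positivity) hp]
    ring
  have increment_le : ∀ j : ℕ, ∀ a ∈ gridBox d (2 ^ j), ∀ e ∈ gridBox d 1,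
      |gridIncrement g (2 ^ i / 2 ^ j) a e| ≤ T * (3 / 4) ^ j := by
    intro j a ha e he
    have h := chainWeight_mul_le_chainEnergy hfin i ha he
    rw [chainWeight_eq_inv, inv_mul_le_iff₀ (by positivity)] at h
    rw [← pow_le_pow_iff_left₀ (abs_nonneg _) (by positivity) hp, mul_pow, hTp]
    linarith
  have coord_lt : ∀ l, |x l| < 2 ^ i / 2 := fun l => by
    have := PiLp.norm_apply_le x l
    rw [Real.norm_eq_abs] at this
    linarith
  calc |g x| ^ p ≤ (4 * T) ^ p := by
        gcongr
        exact abs_le_of_gridIncrement_le hg hg0 (by positivity) increment_le coord_lt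
    _ = 4 ^ p * B * (2 ^ i) ^ (p + 1) := by rw [mul_pow, hTp]; ring
    _ ≤ _ := by gcongr

/-- The bound on the expected chain energy of a process whose increments satisfy
`E |g x - g y| ^ p ≤ c * ‖x - y‖ ^ p`. -/
def chainBound (d p : ℕ) (c : ℝ) : ℝ≥0∞ :=
  ∑' i : ℕ, ∑' j : ℕ, ENNReal.ofReal (9 ^ d * c * d ^ p) * ENNReal.ofReal (1 / 2) ^ i *
    ENNReal.ofReal (2 ^ d * (2 / 3) ^ p) ^ j

lemma chainBound_ne_top (hp : (2 : ℝ) ^ d * (2 / 3) ^ p < 1) (c : ℝ) :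
    chainBound d p c ≠ ⊤ := by
  have inv_ne_top : ∀ r : ℝ, r < 1 → (1 - ENNReal.ofReal r)⁻¹ ≠ ⊤ := fun r hr => by
    rw [Ne, ENNReal.inv_eq_top, tsub_eq_zero_iff_le, not_le]
    exact ENNReal.ofReal_lt_one.2 hr
  simp only [chainBound, ENNReal.tsum_mul_left, ENNReal.tsum_mul_right, ENNReal.tsum_geometric]
  exact ENNReal.mul_ne_top (ENNReal.mul_ne_top ENNReal.ofReal_ne_top
    (inv_ne_top _ (by norm_num))) (inv_ne_top _ hp)

/-- The weights are chosen so that the powers of `2 ^ i` cancel up to a factor `(1 / 2) ^ i`, while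
the `O((2 ^ j) ^ d)` increments at level `j` are each of order `(2 / 3) ^ (p * j)`. -/
lemma card_mul_chainWeight_le (d p i j : ℕ) {c : ℝ} (hc : 0 ≤ c) :
    ((gridBox d (2 ^ j)).card : ℝ) * ((gridBox d 1).card *
      (chainWeight p i j * (c * (d * (2 ^ i / 2 ^ j)) ^ p)))
      ≤ 9 ^ d * c * d ^ p * (1 / 2) ^ i * (2 ^ d * (2 / 3) ^ p) ^ j := by
  have side_le : (2 * 2 ^ j + 1 : ℝ) ≤ 3 * 2 ^ j := by
    linarith [one_le_pow₀ (M₀ := ℝ) (a := 2) (n := j) one_le_two]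
  have ratio : ((1 / 2) ^ i * (4 / 3) ^ j * (2 ^ i / 2 ^ j) : ℝ) = (2 / 3) ^ j := by
    rw [show (2 / 3 : ℝ) = 4 / 3 / 2 by norm_num, div_pow (4 / 3 : ℝ) 2, one_div_pow]
    field_simp
  rw [card_gridBox, card_gridBox, chainWeight]
  push_cast
  norm_num only [mul_one]
  calc (2 * 2 ^ j + 1 : ℝ) ^ d * (3 ^ d * ((1 / 2) ^ i * ((1 / 2) ^ i * (4 / 3) ^ j) ^ p *
        (c * (d * (2 ^ i / 2 ^ j)) ^ p)))
      ≤ (3 * 2 ^ j) ^ d * (3 ^ d * ((1 / 2) ^ i * ((1 / 2) ^ i * (4 / 3) ^ j) ^ p *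
        (c * (d * (2 ^ i / 2 ^ j)) ^ p))) := by
        gcongr
    _ = (3 ^ d * 3 ^ d) * c * d ^ p * (1 / 2) ^ i * ((2 ^ j) ^ d *
        ((1 / 2) ^ i * (4 / 3) ^ j * (2 ^ i / 2 ^ j)) ^ p) := by
        simp only [mul_pow]; ring
    _ = _ := by
        rw [ratio, ← mul_pow, mul_pow (2 ^ d : ℝ) _ j, pow_right_comm 2 j d,
          pow_right_comm (2 / 3 : ℝ) j p]
        norm_num

lemma measurable_gridIncrement {g : EuclideanSpace ℝ (Fin d) → Ω → ℝ}
    (hg : ∀ x, Measurable (g x)) (s : ℝ) (a e : Fin d → ℤ) :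
    Measurable fun ω => gridIncrement (fun x => g x ω) s a e :=
  (hg _).sub (hg _)

lemma measurable_chainEnergy {g : EuclideanSpace ℝ (Fin d) → Ω → ℝ} (hg : ∀ x, Measurable (g x)) :
    Measurable fun ω => chainEnergy p fun x => g x ω :=
  Measurable.tsum fun _ => Measurable.tsum fun _ => Finset.measurable_sum _ fun _ _ =>
    Finset.measurable_sum _ fun _ _ =>
      (((measurable_gridIncrement hg _ _ _).abs.pow_const p).const_mul _).ennreal_ofReal

lemma lintegral_chainEnergy_le {P : Measure Ω} {c : ℝ} (hc : 0 ≤ c)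
    {g : EuclideanSpace ℝ (Fin d) → Ω → ℝ} (hg : ∀ x, Measurable (g x))
    (hinc : ∀ x y, ∫⁻ ω, ENNReal.ofReal (|g x ω - g y ω| ^ p) ∂P
      ≤ ENNReal.ofReal (c * ‖x - y‖ ^ p)) :
    ∫⁻ ω, chainEnergy p (fun x => g x ω) ∂P ≤ chainBound d p c := by
  have hmeas : ∀ (w s : ℝ) (a e : Fin d → ℤ),
      Measurable fun ω => ENNReal.ofReal (w * |gridIncrement (fun x => g x ω) s a e| ^ p) :=
    fun w s a e =>
      (((measurable_gridIncrement hg s a e).abs.pow_const p).const_mul w).ennreal_ofReal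
  have summand_le : ∀ i j : ℕ, ∀ a, ∀ e ∈ gridBox d 1,
      ∫⁻ ω, ENNReal.ofReal (chainWeight p i j *
        |gridIncrement (fun x => g x ω) (2 ^ i / 2 ^ j) a e| ^ p) ∂P
      ≤ ENNReal.ofReal (chainWeight p i j * (c * (d * (2 ^ i / 2 ^ j)) ^ p)) := by
    intro i j a e he
    simp_rw [ENNReal.ofReal_mul (chainWeight_pos p i j).le]
    rw [lintegral_const_mul' _ _ ENNReal.ofReal_ne_top]
    gcongr
    refine (hinc _ _).trans (ENNReal.ofReal_le_ofReal ?_)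
    gcongr
    exact norm_gridPoint_sub_le (by positivity) a he
  unfold chainEnergy chainBound
  rw [lintegral_tsum fun i => (Measurable.tsum fun j => Finset.measurable_sum _ fun a _ =>
    Finset.measurable_sum _ fun e _ => hmeas _ _ _ _).aemeasurable]
  refine ENNReal.tsum_le_tsum fun i => ?_
  rw [lintegral_tsum fun j => (Finset.measurable_sum _ fun a _ =>
    Finset.measurable_sum _ fun e _ => hmeas _ _ _ _).aemeasurable]
  refine ENNReal.tsum_le_tsum fun j => ?_
  rw [lintegral_finsetSum _ fun a _ => Finset.measurable_sum _ fun e _ => hmeas _ _ _ _]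
  simp_rw [lintegral_finsetSum _ fun e _ => hmeas _ _ _ e]
  refine (Finset.sum_le_sum fun a _ => Finset.sum_le_sum (summand_le i j a)).trans ?_
  have := chainWeight_pos p i j
  rw [Finset.sum_const, Finset.sum_const, nsmul_eq_mul, nsmul_eq_mul, ← ENNReal.ofReal_natCast,
    ← ENNReal.ofReal_natCast, ← ENNReal.ofReal_pow (by norm_num),
    ← ENNReal.ofReal_pow (by positivity), ← ENNReal.ofReal_mul (by positivity),
    ← ENNReal.ofReal_mul (by positivity), ← ENNReal.ofReal_mul (by positivity),
    ← ENNReal.ofReal_mul (by positivity)]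
  exact ENNReal.ofReal_le_ofReal (card_mul_chainWeight_le d p i j hc)

/-- The growth bound for a process started at the origin, by chaining its increments. -/
theorem exists_abs_pow_le (hp : p ≠ 0) (hdp : (2 : ℝ) ^ d * (2 / 3) ^ p < 1) {c : ℝ}
    (hc : 0 ≤ c) {P : Measure Ω} {g : EuclideanSpace ℝ (Fin d) → Ω → ℝ}
    (hg : ∀ x, Measurable (g x))
    (hinc : ∀ x y, ∫⁻ ω, ENNReal.ofReal (|g x ω - g y ω| ^ p) ∂P
      ≤ ENNReal.ofReal (c * ‖x - y‖ ^ p))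
    (hcont : ∀ᵐ ω ∂P, Continuous (fun x => g x ω) ∧ g 0 ω = 0) :
    ∃ V : Ω → ℝ, Measurable V ∧ (∀ ω, 0 ≤ V ω) ∧ Integrable V P ∧
      ∫ ω, V ω ∂P ≤ 4 ^ p * 4 ^ (p + 1) * (chainBound d p c).toReal ∧
      ∀ᵐ ω ∂P, ∀ x, |g x ω| ^ p ≤ V ω * (1 + ‖x‖) ^ (p + 1) := by
  have hmeas : Measurable fun ω => chainEnergy p fun x => g x ω := measurable_chainEnergy hg
  have hle := lintegral_chainEnergy_le hc hg hinc
  have hne : ∫⁻ ω, chainEnergy p (fun x => g x ω) ∂P ≠ ⊤ :=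
    ne_top_of_le_ne_top (chainBound_ne_top hdp c) hle
  refine ⟨fun ω => 4 ^ p * 4 ^ (p + 1) * (chainEnergy p fun x => g x ω).toReal,
    hmeas.ennreal_toReal.const_mul _, fun ω => by positivity,
    (integrable_toReal_of_lintegral_ne_top hmeas.aemeasurable hne).const_mul _, ?_, ?_⟩
  · rw [integral_const_mul, integral_toReal hmeas.aemeasurable (ae_lt_top hmeas hne)]
    gcongr
    exact chainBound_ne_top hdp c
  · filter_upwards [hcont, ae_lt_top hmeas hne] with ω hω hfin x
    refine (abs_pow_le_chainEnergy hp hω.1 hω.2 hfin.ne x).trans_eq ?_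
    rw [mul_pow]
    ring

/-- A process with increments controlled in `L ^ (2 q)` for large `q` has a modulus of continuity
at the origin with bounded fourth moment. -/
theorem exists_modulus (d : ℕ) {q : ℕ} (hq : 4 ≤ q)
    (hdq : (2 : ℝ) ^ d * (2 / 3) ^ (2 * q) < 1) {c : ℝ} (hc : 0 ≤ c) :
    ∃ C : ℝ, ∀ {Ω : Type*} [MeasurableSpace Ω] (P : Measure Ω) [IsProbabilityMeasure P]
      (g : EuclideanSpace ℝ (Fin d) → Ω → ℝ), (∀ x, Measurable (g x)) →
      (∀ x y, ∫⁻ ω, ENNReal.ofReal (|g x ω - g y ω| ^ (2 * q)) ∂P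
        ≤ ENNReal.ofReal (c * ‖x - y‖ ^ (2 * q))) →
      (∀ᵐ ω ∂P, Continuous (fun x => g x ω) ∧ g 0 ω = 0) →
      ∃ A : Ω → ℝ, Measurable A ∧ (∀ ω, 0 ≤ A ω) ∧ Integrable (fun ω => A ω ^ 4) P ∧
        ∫ ω, A ω ^ 4 ∂P ≤ C ∧ ∀ᵐ ω ∂P, ∀ x, g x ω ^ 2 ≤ A ω * (1 + ‖x‖) ^ 3 := by
  refine ⟨1 + 4 ^ (2 * q) * 4 ^ (2 * q + 1) * (chainBound d (2 * q) c).toReal, ?_⟩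
  intro Ω _ P _ g hg hinc hcont
  obtain ⟨V, hVm, hV0, hVint, hVle, hgV⟩ := exists_abs_pow_le (by omega) hdq hc hg hinc hcont
  set A : Ω → ℝ := fun ω => V ω ^ (1 / q : ℝ) with hA
  have hAm : Measurable A := hVm.pow_const _
  have hA0 : ∀ ω, 0 ≤ A ω := fun ω => Real.rpow_nonneg (hV0 ω) _
  have hAq : ∀ ω, A ω ^ q = V ω := fun ω => by
    rw [hA, one_div, Real.rpow_inv_natCast_pow (hV0 ω) (by omega)]
  have hA4 : ∀ ω, A ω ^ 4 ≤ 1 + V ω := by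
    intro ω
    rw [← hAq]
    rcases le_total (A ω) 1 with h | h
    · linarith [pow_le_one₀ (n := 4) (hA0 ω) h, pow_nonneg (hA0 ω) q]
    · linarith [pow_le_pow_right₀ h hq]
  have hdom : Integrable (fun ω => 1 + V ω) P := (integrable_const _).add hVint
  have hint : Integrable (fun ω => A ω ^ 4) P :=
    hdom.mono' (hAm.pow_const 4).aestronglyMeasurable (ae_of_all _ fun ω => by
      rw [Real.norm_eq_abs, abs_of_nonneg (pow_nonneg (hA0 ω) 4)]
      exact hA4 ω)
  refine ⟨A, hAm, hA0, hint, ?_, ?_⟩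
  · calc ∫ ω, A ω ^ 4 ∂P ≤ ∫ ω, (1 + V ω) ∂P := integral_mono hint hdom hA4
      _ = 1 + ∫ ω, V ω ∂P := by rw [integral_add (integrable_const _) hVint]; simp
      _ ≤ _ := by gcongr
  · filter_upwards [hgV] with ω hω x
    rw [← pow_le_pow_iff_left₀ (sq_nonneg _) (by have := hA0 ω; positivity) (n := q) (by omega),
      mul_pow, hAq, ← pow_mul, ← pow_mul, ← Even.pow_abs (even_two_mul q)]
    refine (hω x).trans (mul_le_mul_of_nonneg_left ?_ (hV0 ω))
    exact pow_le_pow_right₀ (by linarith [norm_nonneg x]) (by omega)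

lemma two_pow_mul_two_thirds_pow_lt_one (d : ℕ) :
    (2 : ℝ) ^ d * (2 / 3) ^ (2 * (d + 4)) < 1 := by
  have split : (2 : ℝ) ^ d * (2 / 3) ^ (2 * (d + 4)) = (8 / 9) ^ d * (4 / 9) ^ 4 := by
    rw [pow_mul, pow_add, ← mul_assoc, ← mul_pow]; norm_num
  rw [split]
  exact mul_lt_one_of_nonneg_of_lt_one_right (pow_le_one₀ (by norm_num) (by norm_num))
    (by norm_num) (by norm_num)

end Chaining

/-! ### Moments of sums of independent variables -/

section Moments

open ProbabilityTheory

lemma abs_pow_le_factorial_mul_exp_add_exp (x : ℝ) (p : ℕ) :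
    |x| ^ p ≤ p.factorial * (Real.exp x + Real.exp (-x)) := by
  have series := Real.pow_div_factorial_le_exp |x| (abs_nonneg x) p
  have exp_abs_le : Real.exp |x| ≤ Real.exp x + Real.exp (-x) := by
    rcases abs_choice x with h | h <;> rw [h] <;> linarith [Real.exp_pos x, Real.exp_pos (-x)]
  rw [div_le_iff₀' (by positivity)] at series
  exact series.trans (by gcongr)

lemma integral_abs_pow_le_of_hasSubgaussianMGF {Ω : Type*} [MeasurableSpace Ω] {P : Measure Ω}
    [IsProbabilityMeasure P] {X : Ω → ℝ} {c : NNReal} (hX : HasSubgaussianMGF X c P) (p : ℕ) :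
    ∫ ω, |X ω| ^ p ∂P ≤ 4 * p.factorial * √c ^ p := by
  have one_le_factorial : (1 : ℝ) ≤ p.factorial := by exact_mod_cast p.factorial_pos
  rcases eq_or_ne c 0 with rfl | hc
  · have ae_zero : (fun ω => |X ω| ^ p) =ᵐ[P] fun _ => 0 ^ p := by
      filter_upwards [hX.ae_eq_zero_of_hasSubgaussianMGF_zero] with ω hω
      rw [hω, Pi.zero_apply, abs_zero]
    rw [integral_congr_ae ae_zero, integral_const, probReal_univ, one_smul, NNReal.coe_zero,
      Real.sqrt_zero]
    exact le_mul_of_one_le_left (by positivity) (by linarith)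
  set b := √(c : ℝ)
  have hb : 0 < b := Real.sqrt_pos.2 (by positivity)
  have mgf_le : ∀ t : ℝ, t ^ 2 = (b ^ 2)⁻¹ → ∫ ω, Real.exp (t * X ω) ∂P ≤ 2 := by
    intro t ht
    have h := hX.mgf_le t
    rw [ht, ← Real.sq_sqrt c.coe_nonneg, mul_inv_cancel₀ (by positivity)] at h
    refine h.trans ?_
    have : Real.exp (1 / 2) * Real.exp (1 / 2) = Real.exp 1 := by rw [← Real.exp_add]; norm_num
    nlinarith [Real.exp_one_lt_d9, Real.exp_pos (1 / 2)]
  have hexp : ∀ t : ℝ, Integrable (fun ω => Real.exp (t * X ω)) P := hX.integrable_exp_mul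
  calc ∫ ω, |X ω| ^ p ∂P
      ≤ ∫ ω, b ^ p * (p.factorial * (Real.exp (b⁻¹ * X ω) + Real.exp (-b⁻¹ * X ω))) ∂P := by
        refine integral_mono_of_nonneg (ae_of_all _ fun ω => by positivity)
          ((((hexp _).add (hexp _)).const_mul _).const_mul _) (ae_of_all _ fun ω => ?_)
        have h := abs_pow_le_factorial_mul_exp_add_exp (b⁻¹ * X ω) p
        rw [← neg_mul] at h
        calc |X ω| ^ p = b ^ p * |b⁻¹ * X ω| ^ p := by
              rw [abs_mul, abs_of_pos (inv_pos.2 hb), ← mul_pow b, mul_inv_cancel_left₀ hb.ne']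
          _ ≤ _ := mul_le_mul_of_nonneg_left h (by positivity)
    _ = b ^ p * (p.factorial *
          (∫ ω, Real.exp (b⁻¹ * X ω) ∂P + ∫ ω, Real.exp (-b⁻¹ * X ω) ∂P)) := by
        rw [integral_const_mul, integral_const_mul, integral_add (hexp _) (hexp _)]
    _ ≤ b ^ p * (p.factorial * (2 + 2)) := by
        gcongr
        exacts [mgf_le _ (inv_pow _ _), mgf_le _ (by rw [neg_sq, inv_pow])]
    _ = _ := by ring

lemma sq_le_mul_abs_add_pow_four_div {a : ℝ} (ha : 0 < a) (w : ℝ) :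
    w ^ 2 ≤ a * |w| + |w| ^ 4 / a ^ 2 := by
  rw [← sq_abs]
  rcases le_total |w| a with h | h
  · have : 0 ≤ |w| ^ 4 / a ^ 2 := by positivity
    nlinarith [abs_nonneg w]
  · have : |w| ^ 2 ≤ |w| ^ 4 / a ^ 2 := by
      rw [le_div_iff₀ (by positivity)]
      calc |w| ^ 2 * a ^ 2 ≤ |w| ^ 2 * |w| ^ 2 := by gcongr
        _ = |w| ^ 4 := by ring
    have : 0 ≤ a * |w| := by positivity
    linarith

variable {ι Y : Type*} [Fintype ι] [MeasurableSpace Y] {Q : Measure Y} [IsProbabilityMeasure Q]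

lemma ae_pi_of_ae {p : Y → Prop} (h : ∀ᵐ y ∂Q, p y) :
    ∀ᵐ ω ∂(Measure.pi fun _ : ι => Q), ∀ i, p (ω i) :=
  ae_all_iff.2 fun i => (measurePreserving_eval (fun _ : ι => Q) i).quasiMeasurePreserving.ae h

lemma memLp_sum_pi {f : Y → ℝ} {p : ℝ≥0∞} (hf : MemLp f p Q) (S : Finset ι) :
    MemLp (fun ω : ι → Y => ∑ i ∈ S, f (ω i)) p (Measure.pi fun _ : ι => Q) :=
  memLp_finsetSum _ fun i _ =>
    hf.comp_measurePreserving (measurePreserving_eval (fun _ : ι => Q) i)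

variable {ξ : Y → ℝ}

lemma hasSubgaussianMGF_sum_pi (hξ : AEMeasurable ξ Q) (hξ0 : ∫ y, ξ y ∂Q = 0) {B : NNReal}
    (hξB : ∀ᵐ y ∂Q, |ξ y| ≤ B) (S : Finset ι) :
    HasSubgaussianMGF (fun ω => ∑ i ∈ S, ξ (ω i)) (S.card * B ^ 2)
      (Measure.pi fun _ : ι => Q) := by
  have hoeffding : HasSubgaussianMGF ξ (B ^ 2) Q := by
    have h := hasSubgaussianMGF_of_mem_Icc_of_integral_eq_zero hξ
      (hξB.mono fun y hy => abs_le.1 hy) hξ0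
    have width : ‖(B : ℝ) - -B‖₊ / 2 = B := by
      ext
      rw [NNReal.coe_div, coe_nnnorm, NNReal.coe_ofNat,
        Real.norm_of_nonneg (by linarith [B.coe_nonneg])]
      ring
    rwa [width] at h
  have eval : ∀ i : ι, HasSubgaussianMGF (fun ω : ι → Y => ξ (ω i)) (B ^ 2)
      (Measure.pi fun _ : ι => Q) := fun i =>
    HasSubgaussianMGF.of_map (Y := fun ω : ι → Y => ω i) (measurable_pi_apply i).aemeasurable
      (by rwa [(measurePreserving_eval (fun _ : ι => Q) i).map_eq])
  simpa only [Finset.sum_const, nsmul_eq_mul] using HasSubgaussianMGF.sum_of_iIndepFun (s := S)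
    (iIndepFun_pi (μ := fun _ : ι => Q) (X := fun _ => ξ) fun _ => hξ) fun i _ => eval i

lemma integral_abs_sum_pow_le (hξ : AEMeasurable ξ Q) (hξ0 : ∫ y, ξ y ∂Q = 0) {B : ℝ}
    (hξB : ∀ᵐ y ∂Q, |ξ y| ≤ B) (S : Finset ι) (p : ℕ) :
    Integrable (fun ω : ι → Y => |∑ i ∈ S, ξ (ω i)| ^ p) (Measure.pi fun _ : ι => Q) ∧
    ∫ ω, |∑ i ∈ S, ξ (ω i)| ^ p ∂(Measure.pi fun _ : ι => Q)
      ≤ 4 * p.factorial * (√S.card * B) ^ p := by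
  obtain ⟨y, hy⟩ := hξB.exists
  lift B to NNReal using (abs_nonneg _).trans hy
  have hsum := hasSubgaussianMGF_sum_pi hξ hξ0 hξB S
  refine ⟨(hsum.memLp p).integrable_norm_pow', ?_⟩
  have scale : √((S.card * B ^ 2 : NNReal) : ℝ) = √S.card * B := by
    rw [NNReal.coe_mul, NNReal.coe_natCast, NNReal.coe_pow, Real.sqrt_mul (by positivity),
      Real.sqrt_sq B.coe_nonneg]
  exact scale ▸ integral_abs_pow_le_of_hasSubgaussianMGF hsum p

lemma integral_sq_sum_eq (hξ : MemLp ξ 2 Q) (hξ0 : ∫ y, ξ y ∂Q = 0) (S : Finset ι) :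
    ∫ ω, (∑ i ∈ S, ξ (ω i)) ^ 2 ∂(Measure.pi fun _ : ι => Q) = S.card * ∫ y, ξ y ^ 2 ∂Q := by
  have hL : ∀ i : ι, MemLp (fun ω : ι → Y => ξ (ω i)) 2 (Measure.pi fun _ : ι => Q) := fun i =>
    hξ.comp_measurePreserving (measurePreserving_eval (fun _ : ι => Q) i)
  have centered : ∀ i : ι, ∫ ω, ξ (ω i) ∂(Measure.pi fun _ : ι => Q) = 0 := fun i =>
    (integral_comp_eval hξ.1).trans hξ0
  have hvar := IndepFun.variance_sum (s := S) (X := fun (i : ι) (ω : ι → Y) => ξ (ω i))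
    (fun i _ => hL i) (fun i _ j _ hij =>
      (iIndepFun_pi (μ := fun _ : ι => Q) (X := fun _ => ξ) fun _ => hξ.1.aemeasurable).indepFun
        hij)
  have sum_centered :
      ∫ ω, (∑ i ∈ S, fun ω : ι → Y => ξ (ω i)) ω ∂(Measure.pi fun _ : ι => Q) = 0 := by
    simp only [Finset.sum_apply]
    rw [integral_finsetSum _ fun i _ => (hL i).integrable (by norm_num)]
    exact Finset.sum_eq_zero fun i _ => centered i
  rw [variance_of_integral_eq_zero (memLp_finsetSum' _ fun i _ => hL i).1.aemeasurable
    sum_centered] at hvar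
  simp only [Finset.sum_apply] at hvar
  rw [hvar, Finset.sum_congr rfl fun i _ => by
    rw [variance_of_integral_eq_zero (hL i).1.aemeasurable (centered i),
      integral_comp_eval (μ := fun _ : ι => Q) (f := fun y => ξ y ^ 2) (hξ.1.pow 2)],
    Finset.sum_const, nsmul_eq_mul]

lemma integral_abs_sum_le_sqrt (hξ : MemLp ξ 2 Q) (hξ0 : ∫ y, ξ y ∂Q = 0) (S : Finset ι) :
    ∫ ω, |∑ i ∈ S, ξ (ω i)| ∂(Measure.pi fun _ : ι => Q) ≤ √(S.card * ∫ y, ξ y ^ 2 ∂Q) := by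
  have memLp_abs : MemLp (fun ω : ι → Y => |∑ i ∈ S, ξ (ω i)|) 2 (Measure.pi fun _ => Q) :=
    (memLp_sum_pi hξ S).abs
  have jensen := variance_nonneg (fun ω : ι → Y => |∑ i ∈ S, ξ (ω i)|) (Measure.pi fun _ => Q)
  rw [variance_eq_sub memLp_abs] at jensen
  simp only [Pi.pow_apply, sq_abs, integral_sq_sum_eq hξ hξ0] at jensen
  exact Real.le_sqrt_of_sq_le (sub_nonneg.1 jensen)

/-- The second moment is at most the first one times `a` plus the fourth one divided by `a ^ 2`,
for `a = N * √S.card` with `N` so large that the last term is at most half the second moment. -/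
lemma exists_le_integral_abs_sum (hξ : AEMeasurable ξ Q) (hξ0 : ∫ y, ξ y ∂Q = 0) {B : ℝ}
    (hξB : ∀ᵐ y ∂Q, |ξ y| ≤ B) (hpos : 0 < ∫ y, ξ y ^ 2 ∂Q) :
    ∃ c > 0, ∀ {ι : Type*} [Fintype ι] (S : Finset ι),
      c * √S.card ≤ ∫ ω, |∑ i ∈ S, ξ (ω i)| ∂(Measure.pi fun _ : ι => Q) := by
  set σ := ∫ y, ξ y ^ 2 ∂Q
  set N : ℝ := 1 + 192 * B ^ 4 / σ with hN
  have one_le_N : 1 ≤ N := le_add_of_nonneg_right (by positivity)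
  refine ⟨σ / (2 * N), by positivity, fun {ι} _ S => ?_⟩
  set P := Measure.pi fun _ : ι => Q
  have second := integral_sq_sum_eq (ι := ι) (MemLp.of_bound hξ.aestronglyMeasurable B hξB) hξ0 S
  obtain ⟨int_one, -⟩ := integral_abs_sum_pow_le hξ hξ0 hξB S 1
  obtain ⟨int_two, -⟩ := integral_abs_sum_pow_le hξ hξ0 hξB S 2
  obtain ⟨int_four, fourth⟩ := integral_abs_sum_pow_le hξ hξ0 hξB S 4
  simp only [sq_abs, pow_one] at int_one int_two
  rcases S.card.eq_zero_or_pos with hS | hS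
  · simp only [hS, Nat.cast_zero, Real.sqrt_zero, mul_zero]
    exact integral_nonneg fun ω => abs_nonneg _
  set r := √(S.card : ℝ)
  have hr : 0 < r := Real.sqrt_pos.2 (by exact_mod_cast hS)
  have hr2 : r ^ 2 = S.card := Real.sq_sqrt (by positivity)
  have interpolation : r ^ 2 * σ ≤ N * r * (∫ ω, |∑ i ∈ S, ξ (ω i)| ∂P) +
      (∫ ω, |∑ i ∈ S, ξ (ω i)| ^ 4 ∂P) / (N * r) ^ 2 := by
    rw [hr2, ← second, ← integral_const_mul, ← integral_div,
      ← integral_add (int_one.const_mul _) (int_four.div_const _)]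
    exact integral_mono int_two ((int_one.const_mul _).add (int_four.div_const _)) fun ω =>
      sq_le_mul_abs_add_pow_four_div (by positivity) _
  have fourth_small : (∫ ω, |∑ i ∈ S, ξ (ω i)| ^ 4 ∂P) / (N * r) ^ 2 ≤ r ^ 2 * σ / 2 := by
    have hNσ : 192 * B ^ 4 ≤ N ^ 2 * σ := by
      have : N * σ = σ + 192 * B ^ 4 := by rw [hN]; field_simp
      nlinarith [mul_le_mul_of_nonneg_right (le_self_pow₀ one_le_N two_ne_zero) hpos.le]
    rw [div_le_iff₀ (by positivity)]
    calc _ ≤ 4 * (Nat.factorial 4) * (r * B) ^ 4 := fourth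
      _ = r ^ 4 / 2 * (192 * B ^ 4) := by norm_num [Nat.factorial]; ring
      _ ≤ r ^ 4 / 2 * (N ^ 2 * σ) := by gcongr
      _ = _ := by ring
  rw [div_mul_eq_mul_div, div_le_iff₀ (by positivity)]
  nlinarith

end Moments

/-! ### Second-order expansions -/

section Calculus

variable {E : Type*} [NormedAddCommGroup E] [NormedSpace ℝ E] {f : E → ℝ} {z₀ : E}

lemma exists_norm_fderiv_sub_le (hf' : DifferentiableAt ℝ (fderiv ℝ f) z₀)
    (hf0 : fderiv ℝ f z₀ = 0) {κ : ℝ} (hκ : 0 < κ) :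
    ∃ ε > 0, ∀ h : E, ‖h‖ < ε →
      ‖fderiv ℝ f (z₀ + h) - fderiv ℝ (fderiv ℝ f) z₀ h‖ ≤ κ * ‖h‖ := by
  obtain ⟨ε, hε, near⟩ := Metric.eventually_nhds_iff.1 (hf'.hasFDerivAt.isLittleO.def hκ)
  refine ⟨ε, hε, fun h hh => ?_⟩
  simpa [hf0] using @near (z₀ + h) (by simpa using hh)

lemma exists_abs_taylor_two_le (hf : ∀ᶠ z in 𝓝 z₀, DifferentiableAt ℝ f z)
    (hf' : DifferentiableAt ℝ (fderiv ℝ f) z₀) (hf0 : fderiv ℝ f z₀ = 0) {κ : ℝ} (hκ : 0 < κ) :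
    ∃ ε > 0, ∀ h : E, ‖h‖ < ε →
      |f (z₀ + h) - f z₀ - fderiv ℝ (fderiv ℝ f) z₀ h h / 2| ≤ κ * ‖h‖ ^ 2 := by
  obtain ⟨ε₁, hε₁, gradient_le⟩ := exists_norm_fderiv_sub_le hf' hf0 hκ
  obtain ⟨ε₂, hε₂, differentiable⟩ := Metric.eventually_nhds_iff.1 hf
  refine ⟨min ε₁ ε₂, lt_min hε₁ hε₂, fun h hh => ?_⟩
  set D := fderiv ℝ (fderiv ℝ f) z₀
  have norm_le : ∀ t ∈ Set.Icc (0 : ℝ) 1, ‖t • h‖ ≤ ‖h‖ := fun t ht => by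
    rw [norm_smul, Real.norm_of_nonneg ht.1]
    exact mul_le_of_le_one_left (norm_nonneg _) ht.2
  have remainder_deriv : ∀ t ∈ Set.Icc (0 : ℝ) 1,
      HasDerivAt (fun t : ℝ => f (z₀ + t • h) - D h h / 2 * t ^ 2)
        (fderiv ℝ f (z₀ + t • h) h - D (t • h) h) t := by
    intro t ht
    have segment : HasDerivAt (fun t : ℝ => z₀ + t • h) h t := by
      simpa using ((hasDerivAt_id t).smul_const h).const_add z₀
    have f_diff : DifferentiableAt ℝ f (z₀ + t • h) :=
      differentiable (by simpa using (norm_le t ht).trans_lt (hh.trans_le (min_le_right _ _)))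
    refine ((f_diff.hasFDerivAt.comp_hasDerivAt t segment).sub
      (((hasDerivAt_id t).pow 2).const_mul (D h h / 2))).congr_deriv ?_
    simp
    ring
  have mean_value := norm_image_sub_le_of_norm_deriv_le_segment_01'
    (f := fun t : ℝ => f (z₀ + t • h) - D h h / 2 * t ^ 2) (C := κ * ‖h‖ ^ 2)
    (fun t ht => (remainder_deriv t ht).hasDerivWithinAt) (fun t ht => by
      have ht' : t ∈ Set.Icc (0 : ℝ) 1 := ⟨ht.1, ht.2.le⟩
      rw [← _root_.sub_apply]
      calc _ ≤ ‖fderiv ℝ f (z₀ + t • h) - D (t • h)‖ * ‖h‖ := ContinuousLinearMap.le_opNorm _ _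
        _ ≤ κ * ‖h‖ * ‖h‖ := by
            gcongr
            exact (gradient_le _ ((norm_le t ht').trans_lt (hh.trans_le (min_le_left _ _)))).trans
              (by gcongr; exact norm_le t ht')
        _ = _ := by ring)
  simp only [one_smul, one_pow, mul_one, zero_smul, add_zero, ne_eq, OfNat.ofNat_ne_zero,
    not_false_eq_true, zero_pow, mul_zero, sub_zero, Real.norm_eq_abs] at mean_value
  rwa [sub_right_comm] at mean_value

lemma exists_le_of_posDef [FiniteDimensional ℝ E] (D : E →L[ℝ] E →L[ℝ] ℝ)
    (hD : ∀ h, h ≠ 0 → 0 < D h h) : ∃ c > 0, ∀ h, c * ‖h‖ ^ 2 ≤ D h h := by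
  rcases subsingleton_or_nontrivial E with hE | hE
  · exact ⟨1, one_pos, fun h => by simp [Subsingleton.elim h 0]⟩
  have hcont : Continuous fun h : E => D h h := by fun_prop
  obtain ⟨h₀, hh₀, hmin⟩ := (isCompact_sphere (0 : E) 1).exists_isMinOn
    (NormedSpace.sphere_nonempty.2 zero_le_one) hcont.continuousOn
  rw [mem_sphere_zero_iff_norm] at hh₀
  refine ⟨D h₀ h₀, hD h₀ (by rintro rfl; simp at hh₀), fun h => ?_⟩
  rcases eq_or_ne h 0 with rfl | hne
  · simp
  have hn : 0 < ‖h‖ := norm_pos_iff.2 hne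
  have on_sphere : D h₀ h₀ ≤ D (‖h‖⁻¹ • h) (‖h‖⁻¹ • h) :=
    hmin (by simp [norm_smul, hn.ne'])
  simp only [map_smul, _root_.smul_apply, smul_eq_mul] at on_sphere
  calc D h₀ h₀ * ‖h‖ ^ 2 ≤ ‖h‖⁻¹ * (‖h‖⁻¹ * D h h) * ‖h‖ ^ 2 := by gcongr
    _ = D h h := by field_simp

lemma exists_lipschitz_retraction [FiniteDimensional ℝ E] {U : Set E} (hU : U ∈ 𝓝 z₀) :
    ∃ (r : E → E) (L : NNReal), LipschitzWith L r ∧ (∀ z, r z ∈ U) ∧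
      ∃ ε > 0, ∀ z, ‖z - z₀‖ ≤ ε → r z = z := by
  obtain ⟨R, hR, hRU⟩ := Metric.nhds_basis_closedBall.mem_iff.1 hU
  let bump : ContDiffBump z₀ := ⟨R / 2, R, half_pos hR, half_lt_self hR⟩
  obtain ⟨L, hL⟩ := ContDiff.lipschitzWith_of_hasCompactSupport
    (f := fun z => bump z • (z - z₀)) bump.hasCompactSupport.smul_right
    (bump.contDiff.smul (contDiff_id.sub contDiff_const)) one_ne_zero
  refine ⟨fun z => z₀ + bump z • (z - z₀), L, ?_, fun z => hRU ?_, R / 2, half_pos hR,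
    fun z hz => ?_⟩
  · simpa only [zero_add] using (LipschitzWith.const z₀).add hL
  · rw [mem_closedBall_iff_norm, add_sub_cancel_left, norm_smul, Real.norm_of_nonneg bump.nonneg]
    rcases lt_or_ge (dist z z₀) R with hlt | hge
    · calc bump z * ‖z - z₀‖ ≤ 1 * R := by
            gcongr
            exacts [bump.le_one, by rw [← dist_eq_norm]; exact hlt.le]
        _ = R := one_mul R
    · rw [bump.zero_of_le_dist hge, zero_mul]
      exact hR.le
  · simp only [bump.one_of_mem_closedBall (mem_closedBall_iff_norm.2 hz), one_smul,
      add_sub_cancel]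

end Calculus

/-! ### Consequences of the assumptions -/

namespace Assumptions

variable {dz : ℕ} {Y : Type*} [MeasurableSpace Y] {M : ℝ} {ℓ : EuclideanSpace ℝ (Fin dz) → Y → ℝ}
  {Z : Set (EuclideanSpace ℝ (Fin dz))} {Q : Measure Y} {z₀ : EuclideanSpace ℝ (Fin dz)}

lemma bound_nonneg (hA : Assumptions M ℓ Z Q z₀) : 0 ≤ M := by
  have := hA.isProbabilityMeasure
  obtain ⟨y, hy⟩ := hA.cost_bounded.exists
  exact (abs_nonneg _).trans (hy z₀ hA.mem)

lemma integrable_cost (hA : Assumptions M ℓ Z Q z₀) (hℓ : Measurable (Function.uncurry ℓ))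
    {z : EuclideanSpace ℝ (Fin dz)} (hz : z ∈ Z) : Integrable (ℓ z) Q := by
  have := hA.isProbabilityMeasure
  exact Integrable.of_bound hℓ.of_uncurry_left.aestronglyMeasurable M
    (hA.cost_bounded.mono fun y hy => hy z hz)

lemma abs_expectedCost_le (hA : Assumptions M ℓ Z Q z₀) {z : EuclideanSpace ℝ (Fin dz)}
    (hz : z ∈ Z) : |expectedCost ℓ Q z| ≤ M := by
  have := hA.isProbabilityMeasure
  have h := norm_integral_le_of_norm_le_const (μ := Q) (f := ℓ z)
    (hA.cost_bounded.mono fun y hy => hy z hz)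
  simpa [expectedCost] using h

lemma abs_expectedCost_sub_le (hA : Assumptions M ℓ Z Q z₀) (hℓ : Measurable (Function.uncurry ℓ))
    {z w : EuclideanSpace ℝ (Fin dz)} (hz : z ∈ Z) (hw : w ∈ Z) :
    |expectedCost ℓ Q z - expectedCost ℓ Q w| ≤ M * dist z w := by
  have := hA.isProbabilityMeasure
  have h := norm_integral_le_of_norm_le_const (μ := Q) (f := fun y => ℓ z y - ℓ w y)
    (hA.cost_lipschitz.mono fun y hy => hy z hz w hw)
  rw [integral_sub (hA.integrable_cost hℓ hz) (hA.integrable_cost hℓ hw)] at h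
  simpa [expectedCost] using h

lemma expectedCost_le (hA : Assumptions M ℓ Z Q z₀) {z : EuclideanSpace ℝ (Fin dz)} (hz : z ∈ Z) :
    expectedCost ℓ Q z₀ ≤ expectedCost ℓ Q z := by
  rcases eq_or_ne z z₀ with rfl | hne
  · rfl
  obtain ⟨η, hη, h⟩ := hA.wellSeparated (dist z z₀) (dist_pos.2 hne)
  linarith [h z hz le_rfl]

lemma mem_nhds (hA : Assumptions M ℓ Z Q z₀) : Z ∈ 𝓝 z₀ := hA.isOpen.mem_nhds hA.mem

lemma exists_abs_expectedCost_taylor_two_le (hA : Assumptions M ℓ Z Q z₀) {κ : ℝ} (hκ : 0 < κ) :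
    ∃ ε > 0, ∀ z, ‖z - z₀‖ < ε →
      |expectedCost ℓ Q z - expectedCost ℓ Q z₀ -
        fderiv ℝ (fderiv ℝ (expectedCost ℓ Q)) z₀ (z - z₀) (z - z₀) / 2| ≤ κ * ‖z - z₀‖ ^ 2 := by
  obtain ⟨ε, hε, taylor⟩ := exists_abs_taylor_two_le
    (Filter.mem_of_superset hA.mem_nhds fun z hz => (hA.smooth_expectedCost z hz).1)
    (hA.smooth_expectedCost z₀ hA.mem).2 hA.first_order hκ
  exact ⟨ε, hε, fun z hz => by simpa only [add_sub_cancel] using taylor (z - z₀) hz⟩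

lemma exists_quadratic_growth (hA : Assumptions M ℓ Z Q z₀) :
    ∃ c > 0, ∃ ε > 0, ∀ z, ‖z - z₀‖ < ε →
      c * ‖z - z₀‖ ^ 2 ≤ expectedCost ℓ Q z - expectedCost ℓ Q z₀ := by
  obtain ⟨c, hc, posDef⟩ := exists_le_of_posDef _ hA.second_order
  obtain ⟨ε, hε, taylor⟩ := hA.exists_abs_expectedCost_taylor_two_le (κ := c / 4) (by positivity)
  refine ⟨c / 4, by positivity, ε, hε, fun z hz => ?_⟩
  linarith [posDef (z - z₀), (abs_le.1 (taylor z hz)).1]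

lemma exists_excess_le (hA : Assumptions M ℓ Z Q z₀) :
    ∃ C > 0, ∀ z ∈ Z, expectedCost ℓ Q z - expectedCost ℓ Q z₀ ≤ C * ‖z - z₀‖ ^ 2 := by
  obtain ⟨ε, hε, taylor⟩ := hA.exists_abs_expectedCost_taylor_two_le one_pos
  set D := fderiv ℝ (fderiv ℝ (expectedCost ℓ Q)) z₀
  have hM := hA.bound_nonneg
  refine ⟨‖D‖ / 2 + 1 + 2 * M / ε ^ 2, by positivity, fun z hz => ?_⟩
  rcases lt_or_ge ‖z - z₀‖ ε with hlt | hge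
  · have form_le : D (z - z₀) (z - z₀) ≤ ‖D‖ * ‖z - z₀‖ * ‖z - z₀‖ :=
      (le_abs_self _).trans (D.le_opNorm₂ _ _)
    have : 0 ≤ 2 * M / ε ^ 2 * ‖z - z₀‖ ^ 2 := by positivity
    nlinarith [(abs_le.1 (taylor z hlt)).2]
  · have far_le : 2 * M ≤ 2 * M / ε ^ 2 * ‖z - z₀‖ ^ 2 := by
      rw [div_mul_eq_mul_div, le_div_iff₀ (by positivity)]
      gcongr
    have : 0 ≤ (‖D‖ / 2 + 1) * ‖z - z₀‖ ^ 2 := by positivity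
    linarith [(abs_le.1 (hA.abs_expectedCost_le hz)).2,
      (abs_le.1 (hA.abs_expectedCost_le hA.mem)).1]

lemma differentiableAt_cost (hA : Assumptions M ℓ Z Q z₀) (y : Y) :
    DifferentiableAt ℝ (fun z => ℓ z y) z₀ := (hA.smooth_cost y z₀ hA.mem).1

lemma measurable_fderiv (hA : Assumptions M ℓ Z Q z₀) (hℓ : Measurable (Function.uncurry ℓ))
    (u : EuclideanSpace ℝ (Fin dz)) : Measurable fun y => fderiv ℝ (fun z => ℓ z y) z₀ u := by
  have tendsto_slope : ∀ y, Tendsto (fun n : ℕ => (n : ℝ) * (ℓ (z₀ + (n : ℝ)⁻¹ • u) y - ℓ z₀ y))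
      atTop (𝓝 (fderiv ℝ (fun z => ℓ z y) z₀ u)) := fun y =>
    ((hA.differentiableAt_cost y).hasFDerivAt.lim_real u).comp tendsto_natCast_atTop_atTop
  exact measurable_of_tendsto_metrizable
    (fun _ => (hℓ.of_uncurry_left.sub hℓ.of_uncurry_left).const_mul _)
    (tendsto_pi_nhds.2 tendsto_slope)

lemma ae_abs_fderiv_le (hA : Assumptions M ℓ Z Q z₀) (u : EuclideanSpace ℝ (Fin dz)) :
    ∀ᵐ y ∂Q, |fderiv ℝ (fun z => ℓ z y) z₀ u| ≤ M * ‖u‖ :=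
  hA.gradient_bounded.mono fun _ hy => (ContinuousLinearMap.le_opNorm _ u).trans
    (mul_le_mul_of_nonneg_right (hy z₀ hA.mem) (norm_nonneg u))

lemma integral_fderiv_eq_zero (hA : Assumptions M ℓ Z Q z₀) (hℓ : Measurable (Function.uncurry ℓ))
    (u : EuclideanSpace ℝ (Fin dz)) : ∫ y, fderiv ℝ (fun z => ℓ z y) z₀ u ∂Q = 0 := by
  have := hA.isProbabilityMeasure
  have line : HasDerivAt (fun t : ℝ => z₀ + t • u) u 0 := by
    simpa using ((hasDerivAt_id (0 : ℝ)).smul_const u).const_add z₀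
  have at_zero : z₀ + (0 : ℝ) • u = z₀ := by rw [zero_smul, add_zero]
  have hU : {t : ℝ | z₀ + t • u ∈ Z} ∈ 𝓝 0 :=
    line.continuousAt.preimage_mem_nhds (by rw [at_zero]; exact hA.mem_nhds)
  have cost_lipschitz : ∀ᵐ y ∂Q, LipschitzOnWith (Real.nnabs (M * ‖u‖))
      (fun t : ℝ => ℓ (z₀ + t • u) y) {t : ℝ | z₀ + t • u ∈ Z} := by
    filter_upwards [hA.cost_lipschitz] with y hy
    refine LipschitzOnWith.of_dist_le_mul fun s hs t ht => ?_
    have h := hy _ hs _ ht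
    rw [dist_add_left, dist_eq_norm, ← sub_smul, norm_smul] at h
    rw [Real.coe_nnabs, abs_of_nonneg (mul_nonneg hA.bound_nonneg (norm_nonneg u)), Real.dist_eq,
      Real.dist_eq]
    exact h.trans_eq (by rw [Real.norm_eq_abs]; ring)
  have derivative_under_integral := (hasDerivAt_integral_of_dominated_loc_of_lip hU
    (Eventually.of_forall fun _ => hℓ.of_uncurry_left.aestronglyMeasurable)
    (by rw [at_zero]; exact hA.integrable_cost hℓ hA.mem)
    (hA.measurable_fderiv hℓ u).aestronglyMeasurable cost_lipschitz
    (integrable_const _) (ae_of_all _ fun y =>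
      (hA.differentiableAt_cost y).hasFDerivAt.comp_hasDerivAt_of_eq 0 line at_zero.symm)).2
  have derivative_expectedCost : HasDerivAt (fun t : ℝ => expectedCost ℓ Q (z₀ + t • u)) 0 0 := by
    have h := (hA.smooth_expectedCost z₀ hA.mem).1.hasFDerivAt
    rw [hA.first_order] at h
    exact h.comp_hasDerivAt_of_eq 0 line at_zero.symm
  exact derivative_under_integral.unique derivative_expectedCost

lemma exists_integral_fderiv_sq_pos (hA : Assumptions M ℓ Z Q z₀)
    (hℓ : Measurable (Function.uncurry ℓ))
    (hnondeg : ¬ ∀ᵐ y ∂Q, fderiv ℝ (fun z => ℓ z y) z₀ = 0) :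
    ∃ u, 0 < ∫ y, (fderiv ℝ (fun z => ℓ z y) z₀ u) ^ 2 ∂Q := by
  have := hA.isProbabilityMeasure
  by_contra! hcon
  refine hnondeg ?_
  have basis_vanish : ∀ l, ∀ᵐ y ∂Q,
      fderiv ℝ (fun z => ℓ z y) z₀ (EuclideanSpace.basisFun _ ℝ l) = 0 := by
    intro l
    set u := EuclideanSpace.basisFun (Fin dz) ℝ l
    have hint : Integrable (fun y => (fderiv ℝ (fun z => ℓ z y) z₀ u) ^ 2) Q :=
      (MemLp.of_bound (hA.measurable_fderiv hℓ u).aestronglyMeasurable _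
        (hA.ae_abs_fderiv_le u)).integrable_sq
    have sq_vanish := (integral_eq_zero_iff_of_nonneg (fun y => sq_nonneg _) hint).1
      (le_antisymm (hcon u) (integral_nonneg fun y => sq_nonneg _))
    filter_upwards [sq_vanish] with y hy
    exact pow_eq_zero_iff two_ne_zero |>.1 hy
  filter_upwards [ae_all_iff.2 basis_vanish] with y hy
  refine ContinuousLinearMap.coe_injective
    ((EuclideanSpace.basisFun (Fin dz) ℝ).toBasis.ext fun l => ?_)
  simpa using hy l

/-- Differentiability of the cost in mean square at the optimal decision, by dominated
convergence. -/
lemma exists_integral_sq_remainder_le (hA : Assumptions M ℓ Z Q z₀)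
    (hℓ : Measurable (Function.uncurry ℓ)) {κ : ℝ} (hκ : 0 < κ) :
    ∃ ε > 0, ∀ h : EuclideanSpace ℝ (Fin dz), ‖h‖ < ε →
      ∫ y, (ℓ (z₀ + h) y - ℓ z₀ y - fderiv ℝ (fun z => ℓ z y) z₀ h) ^ 2 ∂Q ≤ κ * ‖h‖ ^ 2 := by
  have := hA.isProbabilityMeasure
  have hM := hA.bound_nonneg
  have add_mem : ∀ᶠ h : EuclideanSpace ℝ (Fin dz) in 𝓝 0, z₀ + h ∈ Z :=
    (continuous_const_add z₀).continuousAt.preimage_mem_nhds (by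
      rw [add_zero]; exact hA.mem_nhds)
  have limit : Tendsto (fun h : EuclideanSpace ℝ (Fin dz) => ∫ y,
      ((ℓ (z₀ + h) y - ℓ z₀ y - fderiv ℝ (fun z => ℓ z y) z₀ h) / ‖h‖) ^ 2 ∂Q) (𝓝 0)
      (𝓝 (∫ _, 0 ∂Q)) := by
    refine tendsto_integral_filter_of_dominated_convergence (fun _ => (2 * M) ^ 2)
      (Eventually.of_forall fun h => ((((hℓ.of_uncurry_left.sub hℓ.of_uncurry_left).sub
        (hA.measurable_fderiv hℓ h)).div_const _).pow_const 2).aestronglyMeasurable) ?_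
      (integrable_const _) (ae_of_all _ fun y => ?_)
    · filter_upwards [add_mem] with h hh
      filter_upwards [hA.cost_lipschitz, hA.ae_abs_fderiv_le h] with y lipschitz gradient_le
      have increment_le := lipschitz _ hh _ hA.mem
      rw [dist_self_add_left] at increment_le
      rw [norm_pow, norm_div, norm_norm, Real.norm_eq_abs]
      refine pow_le_pow_left₀ (by positivity)
        (div_le_of_le_mul₀ (norm_nonneg _) (by positivity) ((abs_sub _ _).trans ?_)) 2
      linarith
    · have differentiable := (hA.differentiableAt_cost y).hasFDerivAt
      rw [hasFDerivAt_iff_isLittleO_nhds_zero] at differentiable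
      simpa using (differentiable.norm_right.tendsto_div_nhds_zero).pow 2
  rw [integral_zero] at limit
  obtain ⟨ε, hε, near⟩ := Metric.eventually_nhds_iff.1 (limit.eventually (gt_mem_nhds hκ))
  refine ⟨ε, hε, fun h hh => ?_⟩
  have ratio_lt := @near h (by simpa using hh)
  simp_rw [div_pow] at ratio_lt
  rw [integral_div] at ratio_lt
  rcases eq_or_ne h 0 with rfl | hne
  · simp
  · rw [div_lt_iff₀ (by have := norm_pos_iff.2 hne; positivity)] at ratio_lt
    exact ratio_lt.le

end Assumptions

/-! ### The empirical process of one sample -/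

section EmpiricalProcess

variable {dz : ℕ} {ι Y : Type*} [MeasurableSpace Y] {M : ℝ} {ℓ : EuclideanSpace ℝ (Fin dz) → Y → ℝ}
  {Z : Set (EuclideanSpace ℝ (Fin dz))} {Q : Measure Y} {z₀ : EuclideanSpace ℝ (Fin dz)}

/-- The total cost of a decision over the outcomes with index in `S`: the objective of the
learner. -/
def totalCost (ℓ : EuclideanSpace ℝ (Fin dz) → Y → ℝ) (S : Finset ι) (ω : ι → Y)
    (z : EuclideanSpace ℝ (Fin dz)) : ℝ :=
  ∑ i ∈ S, ℓ z (ω i)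

/-- The deviation of the total cost over `S` from its expectation, that is the (unnormalized)
empirical process of the costs. -/
def deviation (ℓ : EuclideanSpace ℝ (Fin dz) → Y → ℝ) (Q : Measure Y) (S : Finset ι) (ω : ι → Y)
    (z : EuclideanSpace ℝ (Fin dz)) : ℝ :=
  ∑ i ∈ S, (ℓ z (ω i) - expectedCost ℓ Q z)

lemma totalCost_eq_deviation_add (ℓ : EuclideanSpace ℝ (Fin dz) → Y → ℝ) (Q : Measure Y)
    (S : Finset ι) (ω : ι → Y) (z : EuclideanSpace ℝ (Fin dz)) :
    totalCost ℓ S ω z = deviation ℓ Q S ω z + S.card * expectedCost ℓ Q z := by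
  simp [totalCost, deviation, Finset.sum_sub_distrib]

lemma deviation_sub_deviation (S : Finset ι) (ω : ι → Y) (z w : EuclideanSpace ℝ (Fin dz)) :
    deviation ℓ Q S ω z - deviation ℓ Q S ω w =
      ∑ i ∈ S, (ℓ z (ω i) - ℓ w (ω i) - (expectedCost ℓ Q z - expectedCost ℓ Q w)) := by
  simp only [deviation, ← Finset.sum_sub_distrib, sub_sub_sub_comm]

lemma measurable_deviation (hℓ : Measurable (Function.uncurry ℓ)) (S : Finset ι)
    (z : EuclideanSpace ℝ (Fin dz)) : Measurable fun ω => deviation ℓ Q S ω z :=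
  Finset.measurable_sum _ fun i _ =>
    (hℓ.of_uncurry_left.comp (measurable_pi_apply i)).sub measurable_const

namespace Assumptions

lemma integral_cost_sub_expectedCost (hA : Assumptions M ℓ Z Q z₀)
    (hℓ : Measurable (Function.uncurry ℓ)) {z : EuclideanSpace ℝ (Fin dz)} (hz : z ∈ Z) :
    ∫ y, (ℓ z y - expectedCost ℓ Q z) ∂Q = 0 := by
  have := hA.isProbabilityMeasure
  rw [integral_sub (hA.integrable_cost hℓ hz) (integrable_const _)]
  simp [expectedCost]

lemma integral_cost_sub_sub_expectedCost_sub (hA : Assumptions M ℓ Z Q z₀)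
    (hℓ : Measurable (Function.uncurry ℓ)) {z w : EuclideanSpace ℝ (Fin dz)} (hz : z ∈ Z)
    (hw : w ∈ Z) :
    ∫ y, (ℓ z y - ℓ w y - (expectedCost ℓ Q z - expectedCost ℓ Q w)) ∂Q = 0 := by
  have := hA.isProbabilityMeasure
  have hz' := hA.integrable_cost hℓ hz
  have hw' := hA.integrable_cost hℓ hw
  rw [integral_sub (f := fun y => ℓ z y - ℓ w y) (hz'.sub hw') (integrable_const _),
    integral_sub hz' hw']
  simp [expectedCost]

lemma ae_abs_cost_sub_sub_expectedCost_sub_le (hA : Assumptions M ℓ Z Q z₀)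
    (hℓ : Measurable (Function.uncurry ℓ)) : ∀ᵐ y ∂Q, ∀ z ∈ Z, ∀ w ∈ Z,
      |ℓ z y - ℓ w y - (expectedCost ℓ Q z - expectedCost ℓ Q w)| ≤ 2 * M * dist z w := by
  filter_upwards [hA.cost_lipschitz] with y hy z hz w hw
  refine (abs_sub _ _).trans ?_
  linarith [hy z hz w hw, hA.abs_expectedCost_sub_le hℓ hz hw]

variable [Fintype ι]

lemma ae_abs_deviation_sub_le (hA : Assumptions M ℓ Z Q z₀) (hℓ : Measurable (Function.uncurry ℓ))
    (S : Finset ι) : ∀ᵐ ω ∂(Measure.pi fun _ : ι => Q), ∀ z ∈ Z, ∀ w ∈ Z,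
      |deviation ℓ Q S ω z - deviation ℓ Q S ω w| ≤ S.card * (2 * M * dist z w) := by
  have := hA.isProbabilityMeasure
  filter_upwards [ae_pi_of_ae (hA.ae_abs_cost_sub_sub_expectedCost_sub_le hℓ)] with ω hω z hz w hw
  rw [deviation_sub_deviation, ← nsmul_eq_mul]
  exact (Finset.abs_sum_le_sum_abs _ _).trans
    (Finset.sum_le_card_nsmul _ _ _ fun i _ => hω i z hz w hw)

lemma ae_abs_totalCost_sub_le (hA : Assumptions M ℓ Z Q z₀) (S : Finset ι) :
    ∀ᵐ ω ∂(Measure.pi fun _ : ι => Q), ∀ z ∈ Z, ∀ w ∈ Z,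
      |totalCost ℓ S ω z - totalCost ℓ S ω w| ≤ S.card * (2 * M) := by
  have := hA.isProbabilityMeasure
  filter_upwards [ae_pi_of_ae (ι := ι) hA.cost_bounded] with ω hω z hz w hw
  rw [totalCost, totalCost, ← Finset.sum_sub_distrib, ← nsmul_eq_mul]
  refine (Finset.abs_sum_le_sum_abs _ _).trans (Finset.sum_le_card_nsmul _ _ _ fun i _ => ?_)
  refine (abs_sub _ _).trans ?_
  linarith [hω i z hz, hω i w hw]

lemma ae_continuousOn_deviation (hA : Assumptions M ℓ Z Q z₀)
    (hℓ : Measurable (Function.uncurry ℓ)) (S : Finset ι) :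
    ∀ᵐ ω ∂(Measure.pi fun _ : ι => Q), ContinuousOn (deviation ℓ Q S ω) Z := by
  filter_upwards [hA.ae_abs_deviation_sub_le hℓ S] with ω hω
  have lipschitz : LipschitzOnWith (Real.toNNReal (S.card * (2 * M))) (deviation ℓ Q S ω) Z :=
    LipschitzOnWith.of_dist_le_mul fun z hz w hw => by
      rw [Real.coe_toNNReal _ (by have := hA.bound_nonneg; positivity), mul_assoc]
      exact hω z hz w hw
  exact lipschitz.continuousOn

lemma integral_abs_deviation_pow_le (hA : Assumptions M ℓ Z Q z₀)
    (hℓ : Measurable (Function.uncurry ℓ)) (S : Finset ι) (p : ℕ)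
    {z : EuclideanSpace ℝ (Fin dz)} (hz : z ∈ Z) :
    Integrable (fun ω => |deviation ℓ Q S ω z| ^ p) (Measure.pi fun _ : ι => Q) ∧
    ∫ ω, |deviation ℓ Q S ω z| ^ p ∂(Measure.pi fun _ : ι => Q)
      ≤ 4 * p.factorial * (√S.card * (2 * M)) ^ p := by
  have := hA.isProbabilityMeasure
  refine integral_abs_sum_pow_le (ξ := fun y => ℓ z y - expectedCost ℓ Q z)
    (hℓ.of_uncurry_left.sub_const _).aemeasurable (hA.integral_cost_sub_expectedCost hℓ hz) ?_ S p
  filter_upwards [hA.cost_bounded] with y hy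
  refine (abs_sub _ _).trans ?_
  linarith [hy z hz, hA.abs_expectedCost_le hz]

lemma integral_abs_deviation_sub_pow_le (hA : Assumptions M ℓ Z Q z₀)
    (hℓ : Measurable (Function.uncurry ℓ)) (S : Finset ι) (p : ℕ)
    {z w : EuclideanSpace ℝ (Fin dz)} (hz : z ∈ Z) (hw : w ∈ Z) :
    Integrable (fun ω => |deviation ℓ Q S ω z - deviation ℓ Q S ω w| ^ p)
      (Measure.pi fun _ : ι => Q) ∧
    ∫ ω, |deviation ℓ Q S ω z - deviation ℓ Q S ω w| ^ p ∂(Measure.pi fun _ : ι => Q)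
      ≤ 4 * p.factorial * (√S.card * (2 * M * dist z w)) ^ p := by
  have := hA.isProbabilityMeasure
  simp only [deviation_sub_deviation]
  exact integral_abs_sum_pow_le
    (ξ := fun y => ℓ z y - ℓ w y - (expectedCost ℓ Q z - expectedCost ℓ Q w))
    ((hℓ.of_uncurry_left.sub hℓ.of_uncurry_left).sub_const _).aemeasurable
    (hA.integral_cost_sub_sub_expectedCost_sub hℓ hz hw)
    ((hA.ae_abs_cost_sub_sub_expectedCost_sub_le hℓ).mono fun _ hy => hy z hz w hw) S p

lemma lintegral_abs_deviation_sub_div_pow_le (hA : Assumptions M ℓ Z Q z₀)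
    (hℓ : Measurable (Function.uncurry ℓ)) (S : Finset ι) (p : ℕ)
    {z w : EuclideanSpace ℝ (Fin dz)} (hz : z ∈ Z) (hw : w ∈ Z) {τ r : ℝ} (hτ : 0 < τ)
    (dist_le : √S.card * dist z w ≤ τ * r) :
    ∫⁻ ω, ENNReal.ofReal (|(deviation ℓ Q S ω z - deviation ℓ Q S ω w) / τ| ^ p)
      ∂(Measure.pi fun _ : ι => Q) ≤ ENNReal.ofReal (4 * p.factorial * (2 * M * r) ^ p) := by
  have hM := hA.bound_nonneg
  obtain ⟨moment_integrable, moment_le⟩ := hA.integral_abs_deviation_sub_pow_le hℓ S p hz hw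
  simp only [abs_div, abs_of_pos hτ, div_pow]
  rw [← ofReal_integral_eq_lintegral_ofReal (moment_integrable.div_const _)
    (ae_of_all _ fun ω => by positivity), integral_div]
  refine ENNReal.ofReal_le_ofReal ((div_le_iff₀ (by positivity)).2 (moment_le.trans ?_))
  calc 4 * p.factorial * (√S.card * (2 * M * dist z w)) ^ p
      = 4 * p.factorial * (2 * M * (√S.card * dist z w)) ^ p := by ring
    _ ≤ 4 * p.factorial * (2 * M * (τ * r)) ^ p := by gcongr
    _ = 4 * p.factorial * (2 * M * r) ^ p * τ ^ p := by ring

omit [Fintype ι] in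
lemma exists_modulus_deviation_comp (hA : Assumptions M ℓ Z Q z₀)
    (hℓ : Measurable (Function.uncurry ℓ)) {L : ℝ} (hL : 0 ≤ L) :
    ∃ C : ℝ, ∀ {ι : Type*} [Fintype ι] (S : Finset ι),
      ∀ τ > 0, ∀ ζ : EuclideanSpace ℝ (Fin dz) → EuclideanSpace ℝ (Fin dz), Continuous ζ →
      (∀ x, ζ x ∈ Z) → (∀ x y, √S.card * dist (ζ x) (ζ y) ≤ τ * L * ‖x - y‖) →
      ∃ A : (ι → Y) → ℝ, (∀ ω, 0 ≤ A ω) ∧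
        Integrable (fun ω => A ω ^ 4) (Measure.pi fun _ : ι => Q) ∧
        ∫ ω, A ω ^ 4 ∂(Measure.pi fun _ : ι => Q) ≤ C ∧
        ∀ᵐ ω ∂(Measure.pi fun _ : ι => Q), ∀ x,
          (deviation ℓ Q S ω (ζ x) - deviation ℓ Q S ω (ζ 0)) ^ 2
            ≤ τ ^ 2 * A ω * (1 + ‖x‖) ^ 3 := by
  have := hA.isProbabilityMeasure
  have hM := hA.bound_nonneg
  set q := dz + 4
  obtain ⟨C, hC⟩ := exists_modulus dz (show 4 ≤ q by omega) (two_pow_mul_two_thirds_pow_lt_one dz)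
    (c := 4 * (2 * q).factorial * (2 * M * L) ^ (2 * q)) (by positivity)
  refine ⟨C, fun {ι} _ S τ hτ ζ hζc hζ hζL => ?_⟩
  set g : EuclideanSpace ℝ (Fin dz) → (ι → Y) → ℝ := fun x ω =>
    (deviation ℓ Q S ω (ζ x) - deviation ℓ Q S ω (ζ 0)) / τ with hg
  have increments_le : ∀ x y, ∫⁻ ω, ENNReal.ofReal (|g x ω - g y ω| ^ (2 * q))
      ∂(Measure.pi fun _ : ι => Q) ≤ ENNReal.ofReal
        (4 * (2 * q).factorial * (2 * M * L) ^ (2 * q) * ‖x - y‖ ^ (2 * q)) := fun x y => by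
    simp only [hg, ← sub_div, sub_sub_sub_cancel_right]
    convert hA.lintegral_abs_deviation_sub_div_pow_le hℓ S (2 * q) (hζ x) (hζ y) hτ
      ((hζL x y).trans_eq (mul_assoc _ _ _)) using 2
    ring
  have continuous : ∀ᵐ ω ∂(Measure.pi fun _ : ι => Q), Continuous (fun x => g x ω) ∧ g 0 ω = 0 := by
    filter_upwards [hA.ae_continuousOn_deviation hℓ S] with ω hω
    exact ⟨((hω.comp_continuous hζc hζ).sub continuous_const).div_const _, by simp [hg]⟩
  obtain ⟨A, -, A_nonneg, A_integrable, A_le, modulus⟩ := hC (Measure.pi fun _ : ι => Q) g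
    (fun x => ((measurable_deviation hℓ S _).sub (measurable_deviation hℓ S _)).div_const _)
    increments_le continuous
  refine ⟨A, A_nonneg, A_integrable, A_le, modulus.mono fun ω hω x => ?_⟩
  have h := hω x
  rw [div_pow, div_le_iff₀ (by positivity)] at h
  linarith

/-- At every scale `τ / √k` the deviations have a local modulus of continuity with the same
bounds: a Lipschitz retraction onto a neighbourhood of `z₀` makes the rescaled deviations a process
on the whole space. -/
lemma exists_local_modulus (hA : Assumptions M ℓ Z Q z₀) (hℓ : Measurable (Function.uncurry ℓ)) :
    ∃ C : ℝ, ∃ ε > 0, ∀ {ι : Type*} [Fintype ι] (S : Finset ι), S.Nonempty →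
      ∀ b, ‖b - z₀‖ ≤ ε → ∀ τ > 0, ∃ A : (ι → Y) → ℝ, (∀ ω, 0 ≤ A ω) ∧
        Integrable (fun ω => A ω ^ 4) (Measure.pi fun _ : ι => Q) ∧
        ∫ ω, A ω ^ 4 ∂(Measure.pi fun _ : ι => Q) ≤ C ∧
        ∀ᵐ ω ∂(Measure.pi fun _ : ι => Q), ∀ z, ‖z - z₀‖ ≤ ε →
          (deviation ℓ Q S ω z - deviation ℓ Q S ω b) ^ 2
            ≤ τ ^ 2 * A ω * (1 + √S.card * ‖z - b‖ / τ) ^ 3 := by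
  obtain ⟨r, L, r_lipschitz, r_mem, ε, hε, r_eq⟩ := exists_lipschitz_retraction hA.mem_nhds
  obtain ⟨C, hC⟩ := hA.exists_modulus_deviation_comp hℓ L.coe_nonneg
  refine ⟨C, ε, hε, fun {ι} _ S hS b hb τ hτ => ?_⟩
  have hs : 0 < √(S.card : ℝ) := Real.sqrt_pos.2 (by exact_mod_cast hS.card_pos)
  set s := √(S.card : ℝ)
  have rescaled_lipschitz : ∀ x y : EuclideanSpace ℝ (Fin dz),
      s * dist (r (b + (τ / s) • x)) (r (b + (τ / s) • y)) ≤ τ * L * ‖x - y‖ := fun x y =>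
    calc s * dist (r (b + (τ / s) • x)) (r (b + (τ / s) • y))
        ≤ s * (L * dist (b + (τ / s) • x) (b + (τ / s) • y)) := by
          gcongr; exact r_lipschitz.dist_le_mul _ _
      _ = s * (L * (τ / s * ‖x - y‖)) := by
          rw [dist_add_left, dist_eq_norm, ← smul_sub, norm_smul,
            Real.norm_of_nonneg (by positivity)]
      _ = τ * L * ‖x - y‖ := by field_simp
  obtain ⟨A, A_nonneg, A_integrable, A_le, modulus⟩ := hC S τ hτ
    (fun x => r (b + (τ / s) • x))
    (r_lipschitz.continuous.comp (continuous_const.add (continuous_const_smul _)))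
    (fun x => r_mem _) rescaled_lipschitz
  refine ⟨A, A_nonneg, A_integrable, A_le, modulus.mono fun ω hω z hz => ?_⟩
  have h := hω ((s / τ) • (z - b))
  rw [smul_smul, div_mul_div_cancel₀ hs.ne', div_self hτ.ne', one_smul, add_sub_cancel, r_eq z hz,
    smul_zero, add_zero, r_eq b hb, norm_smul, Real.norm_of_nonneg (by positivity),
    div_mul_eq_mul_div] at h
  exact h

lemma measureReal_le_abs_deviation_le (hA : Assumptions M ℓ Z Q z₀)
    (hℓ : Measurable (Function.uncurry ℓ)) {S : Finset ι} (hS : S.Nonempty)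
    {z : EuclideanSpace ℝ (Fin dz)} (hz : z ∈ Z) {η : ℝ} (hη : 0 < η) :
    (Measure.pi fun _ : ι => Q).real {ω | S.card * η ≤ |deviation ℓ Q S ω z|}
      ≤ 4 * Nat.factorial 8 * (2 * M / η) ^ 8 / (S.card : ℝ) ^ 4 := by
  obtain ⟨moment_integrable, moment_le⟩ := hA.integral_abs_deviation_pow_le hℓ S 8 hz
  generalize (Nat.factorial 8 : ℝ) = F at moment_le ⊢
  have hk : 0 < (S.card : ℝ) := by exact_mod_cast hS.card_pos
  set k := (S.card : ℝ)
  have markov := mul_meas_ge_le_integral_of_nonneg (ae_of_all _ fun ω => by positivity)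
    moment_integrable ((k * η) ^ 8)
  simp only [pow_le_pow_iff_left₀ (show 0 ≤ k * η by positivity) (abs_nonneg _)
    (by norm_num : 8 ≠ 0)] at markov
  have sqrt_pow : √k ^ 8 = k ^ 4 := by
    rw [show 8 = 2 * 4 by norm_num, pow_mul, Real.sq_sqrt hk.le]
  rw [← le_div_iff₀' (by positivity)] at markov
  refine markov.trans ((div_le_div_of_nonneg_right moment_le (by positivity)).trans_eq ?_)
  rw [mul_pow, sqrt_pow]
  field_simp

/-- A uniform law of large numbers: on a finite net by Chebyshev's inequality, and in between by
the Lipschitz condition. -/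
lemma exists_event_abs_deviation_le (hA : Assumptions M ℓ Z Q z₀)
    (hℓ : Measurable (Function.uncurry ℓ)) {η : ℝ} (hη : 0 < η) :
    ∃ C ≥ 0, ∀ {ι : Type*} [Fintype ι] (S : Finset ι), S.Nonempty → ∃ G : Set (ι → Y),
      MeasurableSet G ∧ (Measure.pi fun _ : ι => Q).real Gᶜ ≤ C / (S.card : ℝ) ^ 4 ∧
      ∀ᵐ ω ∂(Measure.pi fun _ : ι => Q), ω ∈ G → ∀ z ∈ Z, |deviation ℓ Q S ω z| ≤ S.card * η := by
  have hM := hA.bound_nonneg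
  obtain ⟨t, htZ, htfin, hcov⟩ := Metric.finite_approx_of_totallyBounded
    (hA.isBounded.isCompact_closure.totallyBounded.subset subset_closure) (η / (4 * (M + 1)))
    (by positivity)
  set T := htfin.toFinset
  have hTZ : ∀ w ∈ T, w ∈ Z := fun w hw => htZ (htfin.mem_toFinset.1 hw)
  refine ⟨T.card * (4 * Nat.factorial 8 * (2 * M / (η / 2)) ^ 8), by positivity,
    fun {ι} _ S hS => ?_⟩
  refine ⟨⋂ w ∈ T, {ω | S.card * (η / 2) ≤ |deviation ℓ Q S ω w|}ᶜ,
    Finset.measurableSet_biInter _ fun w _ =>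
      (measurableSet_le measurable_const (measurable_deviation hℓ S w).abs).compl, ?_, ?_⟩
  · simp only [Set.compl_iInter, compl_compl]
    refine (measureReal_biUnion_finset_le _ _).trans ((Finset.sum_le_sum fun w hw =>
      hA.measureReal_le_abs_deviation_le hℓ hS (hTZ w hw) (half_pos hη)).trans_eq ?_)
    rw [Finset.sum_const, nsmul_eq_mul, ← mul_div_assoc]
  · filter_upwards [hA.ae_abs_deviation_sub_le hℓ S] with ω lipschitz hG z hz
    obtain ⟨w, hw, hzw⟩ := Set.mem_iUnion₂.1 (hcov hz)
    have net_le : |deviation ℓ Q S ω w| < S.card * (η / 2) := by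
      simpa using Set.mem_iInter₂.1 hG w (htfin.mem_toFinset.2 hw)
    have cell_le : 2 * M * dist z w ≤ η / 2 := by
      have h := (Metric.mem_ball.1 hzw).le
      rw [le_div_iff₀ (by positivity)] at h
      linarith [dist_nonneg (x := z) (y := w)]
    have increment_le : (S.card : ℝ) * (2 * M * dist z w) ≤ S.card * (η / 2) := by gcongr
    linarith [abs_sub_abs_le_abs_sub (deviation ℓ Q S ω z) (deviation ℓ Q S ω w),
      lipschitz z hz w (htZ hw)]

omit [Fintype ι] in
lemma norm_sub_lt_of_totalCost_le (hA : Assumptions M ℓ Z Q z₀) {S : Finset ι} {ω : ι → Y}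
    (hS : S.Nonempty) {δ η : ℝ} (hη : 0 < η)
    (hsep : ∀ z ∈ Z, δ ≤ dist z z₀ → expectedCost ℓ Q z₀ + η ≤ expectedCost ℓ Q z)
    (hdev : ∀ z ∈ Z, |deviation ℓ Q S ω z| ≤ S.card * (η / 3)) {z : EuclideanSpace ℝ (Fin dz)}
    (hz : z ∈ Z) (hle : totalCost ℓ S ω z ≤ totalCost ℓ S ω z₀) : ‖z - z₀‖ < δ := by
  by_contra! hcon
  rw [← dist_eq_norm] at hcon
  rw [totalCost_eq_deviation_add ℓ Q, totalCost_eq_deviation_add ℓ Q] at hle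
  have hk : 0 < (S.card : ℝ) := by exact_mod_cast hS.card_pos
  have gap : S.card * (expectedCost ℓ Q z₀ + η) ≤ S.card * expectedCost ℓ Q z := by
    gcongr; exact hsep z hz hcon
  linarith [(abs_le.1 (hdev z hz)).1, (abs_le.1 (hdev z₀ hA.mem)).2, mul_pos hk hη]

lemma ae_continuousOn_totalCost (hA : Assumptions M ℓ Z Q z₀) (S : Finset ι) :
    ∀ᵐ ω ∂(Measure.pi fun _ : ι => Q), ContinuousOn (totalCost ℓ S ω) Z := by
  have := hA.isProbabilityMeasure
  filter_upwards [ae_pi_of_ae (ι := ι) hA.cost_lipschitz] with ω hω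
  refine continuousOn_finsetSum _ fun i _ => ?_
  have lipschitz : LipschitzOnWith (Real.toNNReal M) (fun z => ℓ z (ω i)) Z :=
    LipschitzOnWith.of_dist_le_mul fun z hz w hw => by
      rw [Real.dist_eq, Real.coe_toNNReal _ hA.bound_nonneg]
      exact hω i z hz w hw
  exact lipschitz.continuousOn

lemma exists_good_event (hA : Assumptions M ℓ Z Q z₀) (hℓ : Measurable (Function.uncurry ℓ))
    {ε : ℝ} (hε : 0 < ε) :
    ∃ C ≥ 0, ∀ {ι : Type*} [Fintype ι] (S : Finset ι), S.Nonempty → ∃ G : Set (ι → Y),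
      MeasurableSet G ∧ (Measure.pi fun _ : ι => Q).real Gᶜ ≤ C / (S.card : ℝ) ^ 4 ∧
      ∀ᵐ ω ∂(Measure.pi fun _ : ι => Q), ω ∈ G →
        (∃ z ∈ Z, IsMinOn (totalCost ℓ S ω) Z z) ∧
        ∀ z ∈ Z, totalCost ℓ S ω z ≤ totalCost ℓ S ω z₀ → ‖z - z₀‖ < ε := by
  obtain ⟨ε', hε', hball⟩ := Metric.nhds_basis_closedBall.mem_iff.1 hA.mem_nhds
  set δ := min ε ε'
  have hδ : 0 < δ := lt_min hε hε'
  have hballδ : Metric.closedBall z₀ δ ⊆ Z :=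
    (Metric.closedBall_subset_closedBall (min_le_right _ _)).trans hball
  obtain ⟨η, hη, hsep⟩ := hA.wellSeparated δ hδ
  obtain ⟨C, hC, event⟩ := hA.exists_event_abs_deviation_le hℓ (show 0 < η / 3 by positivity)
  refine ⟨C, hC, fun {ι} _ S hS => ?_⟩
  obtain ⟨G, hG, hGC, hdev⟩ := event S hS
  refine ⟨G, hG, hGC, ?_⟩
  filter_upwards [hdev, hA.ae_continuousOn_totalCost S] with ω hdevω hcont hωG
  have near : ∀ z ∈ Z, totalCost ℓ S ω z ≤ totalCost ℓ S ω z₀ → ‖z - z₀‖ < δ := fun z hz hle =>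
    hA.norm_sub_lt_of_totalCost_le hS hη hsep (hdevω hωG) hz hle
  refine ⟨?_, fun z hz hle => (near z hz hle).trans_le (min_le_left _ _)⟩
  obtain ⟨z₁, hz₁, hmin⟩ := (isCompact_closedBall z₀ δ).exists_isMinOn
    (Metric.nonempty_closedBall.2 hδ.le) (hcont.mono hballδ)
  refine ⟨z₁, hballδ hz₁, fun z hz => ?_⟩
  rcases le_or_gt (totalCost ℓ S ω z) (totalCost ℓ S ω z₀) with hle | hgt
  · exact hmin (mem_closedBall_iff_norm.2 (near z hz hle).le)
  · exact (hmin (Metric.mem_closedBall_self hδ.le)).trans hgt.le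

end Assumptions

end EmpiricalProcess

/-! ### Rates for minimizers of the total cost -/

section Rates

/-- `zhat` picks a minimizer over `Z` of the total cost over the outcomes with index in `S`,
whenever there is one: a learner as a function of the outcomes only. -/
structure IsEmpiricalMinimizer {dz : ℕ} {ι Y : Type*} [MeasurableSpace Y]
    (ℓ : EuclideanSpace ℝ (Fin dz) → Y → ℝ) (Z : Set (EuclideanSpace ℝ (Fin dz)))
    (S : Finset ι) (zhat : (ι → Y) → EuclideanSpace ℝ (Fin dz)) : Prop where
  measurable : Measurable zhat
  mem : ∀ ω, zhat ω ∈ Z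
  isMinOn : ∀ ω, (∃ z ∈ Z, IsMinOn (totalCost ℓ S ω) Z z) →
    IsMinOn (totalCost ℓ S ω) Z (zhat ω)

lemma pow_four_le_of_mul_sq_le {A ρ X c : ℝ} (hA : 0 ≤ A) (hρ : 0 ≤ ρ) (hc : 0 < c)
    (growth : c * ρ ^ 2 ≤ |X|) (modulus : X ^ 2 ≤ A * (1 + ρ) ^ 3) :
    ρ ^ 4 ≤ 1 + (8 / c ^ 2) ^ 4 * A ^ 4 := by
  rcases le_total ρ 1 with h | h
  · have : 0 ≤ (8 / c ^ 2) ^ 4 * A ^ 4 := by positivity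
    linarith [pow_le_one₀ (n := 4) hρ h]
  · have cubes : ρ ^ 3 * (c ^ 2 * ρ) ≤ ρ ^ 3 * (8 * A) :=
      calc ρ ^ 3 * (c ^ 2 * ρ) = (c * ρ ^ 2) ^ 2 := by ring
        _ ≤ |X| ^ 2 := by gcongr
        _ ≤ A * (1 + ρ) ^ 3 := (sq_abs X).trans_le modulus
        _ ≤ A * (2 * ρ) ^ 3 := by gcongr; linarith
        _ = ρ ^ 3 * (8 * A) := by ring
    have linear : ρ ≤ 8 / c ^ 2 * A := by
      rw [div_mul_eq_mul_div, le_div_iff₀ (by positivity)]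
      linarith [le_of_mul_le_mul_left cubes (by positivity)]
    calc ρ ^ 4 ≤ (8 / c ^ 2 * A) ^ 4 := by gcongr
      _ ≤ 1 + (8 / c ^ 2) ^ 4 * A ^ 4 := by rw [mul_pow]; linarith

lemma mul_pow_three_le {A r : ℝ} (hA : 0 ≤ A) (hr : 0 ≤ r) : A * r ^ 3 ≤ A ^ 4 + r ^ 4 := by
  rcases le_total A r with h | h
  · calc A * r ^ 3 ≤ r * r ^ 3 := by gcongr
      _ ≤ A ^ 4 + r ^ 4 := by linarith [pow_nonneg hA 4]
  · calc A * r ^ 3 ≤ A * A ^ 3 := by gcongr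
      _ ≤ A ^ 4 + r ^ 4 := by linarith [pow_nonneg hr 4]

lemma pow_four_add_abs_le {A ρ X c : ℝ} (hA : 0 ≤ A) (hρ : 0 ≤ ρ) (hc : 0 < c)
    (growth : c * ρ ^ 2 ≤ |X|) (modulus : X ^ 2 ≤ A * (1 + ρ) ^ 3) :
    ρ ^ 4 + |X| ≤ 18 + (1 + 9 * (8 / c ^ 2) ^ 4) * A ^ 4 := by
  have abs_le : |X| ≤ 1 + X ^ 2 := by
    rw [← sq_abs]
    nlinarith [sq_nonneg (|X| - 1)]
  have pow_four_le : (1 + ρ) ^ 4 ≤ 8 * (1 + ρ ^ 4) := by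
    have h := add_pow_le zero_le_one hρ 4
    norm_num at h
    exact h
  linarith [pow_four_le_of_mul_sq_le hA hρ hc growth modulus,
    mul_pow_three_le hA (show 0 ≤ 1 + ρ by positivity)]

lemma integral_le_add_measureReal_compl_mul {Ω : Type*} [MeasurableSpace Ω] {P : Measure Ω}
    [IsFiniteMeasure P] {f g : Ω → ℝ} {G : Set Ω} {b : ℝ} (hf : Integrable f P)
    (hg : Integrable g P) (hG : MeasurableSet G) (on_event : ∀ᵐ ω ∂P, ω ∈ G → f ω ≤ g ω)
    (off_event : ∀ᵐ ω ∂P, f ω ≤ g ω + b) :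
    ∫ ω, f ω ∂P ≤ ∫ ω, g ω ∂P + P.real Gᶜ * b := by
  have hb : Integrable (Gᶜ.indicator fun _ => b) P := (integrable_const b).indicator hG.compl
  have h := integral_mono_ae hf (hg.add hb) (by
    filter_upwards [on_event, off_event] with ω h_on h_off
    by_cases hω : ω ∈ G
    · simpa [hω] using h_on hω
    · simpa [hω] using h_off)
  simp only [Pi.add_apply] at h
  rwa [integral_add hg hb, integral_indicator_const _ hG.compl, smul_eq_mul] at h

namespace Assumptions

variable {dz : ℕ} {Y : Type*} [MeasurableSpace Y] {M : ℝ} {ℓ : EuclideanSpace ℝ (Fin dz) → Y → ℝ}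
  {Z : Set (EuclideanSpace ℝ (Fin dz))} {Q : Measure Y} {z₀ : EuclideanSpace ℝ (Fin dz)}

lemma exists_norm_sub_le (hA : Assumptions M ℓ Z Q z₀) : ∃ D ≥ 0, ∀ z ∈ Z, ‖z - z₀‖ ≤ D := by
  obtain ⟨D, hD⟩ := hA.isBounded.subset_closedBall z₀
  exact ⟨D, by simpa using hD hA.mem, fun z hz => mem_closedBall_iff_norm.1 (hD hz)⟩

lemma measurable_expectedCost (hA : Assumptions M ℓ Z Q z₀)
    (hℓ : Measurable (Function.uncurry ℓ)) : Measurable (expectedCost ℓ Q) := by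
  have := hA.isProbabilityMeasure
  exact hℓ.stronglyMeasurable.integral_prod_right.measurable

/-- The event that a minimizer exists and is within `ε` of `z₀` may be assumed at a cost of order
`B / k` in integral inequalities that hold up to `k ^ 2 * B` elsewhere. -/
lemma exists_integral_le_add_of_isMinOn (hA : Assumptions M ℓ Z Q z₀)
    (hℓ : Measurable (Function.uncurry ℓ)) {ε : ℝ} (hε : 0 < ε) :
    ∃ C ≥ 0, ∀ {ι : Type*} [Fintype ι] (S : Finset ι), S.Nonempty → ∀ zhat,
      IsEmpiricalMinimizer ℓ Z S zhat → ∀ f g : (ι → Y) → ℝ, ∀ B ≥ 0,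
      Integrable f (Measure.pi fun _ : ι => Q) → Integrable g (Measure.pi fun _ : ι => Q) →
      (∀ᵐ ω ∂(Measure.pi fun _ : ι => Q), IsMinOn (totalCost ℓ S ω) Z (zhat ω) →
        ‖zhat ω - z₀‖ < ε → f ω ≤ g ω) →
      (∀ᵐ ω ∂(Measure.pi fun _ : ι => Q), f ω ≤ g ω + S.card ^ 2 * B) →
      ∫ ω, f ω ∂(Measure.pi fun _ : ι => Q) ≤
        ∫ ω, g ω ∂(Measure.pi fun _ : ι => Q) + C * B / S.card := by
  have := hA.isProbabilityMeasure
  obtain ⟨C, hC, good_event⟩ := hA.exists_good_event hℓ hε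
  refine ⟨C, hC, fun {ι} _ S hS zhat hz f g B hB hf hg on_event off_event => ?_⟩
  obtain ⟨G, hG, hGC, good⟩ := good_event S hS
  have one_le_card : (1 : ℝ) ≤ S.card := by exact_mod_cast hS.card_pos
  refine (integral_le_add_measureReal_compl_mul hf hg hG ?_ off_event).trans ?_
  · filter_upwards [on_event, good] with ω h_on h_good hω
    obtain ⟨exists_min, near⟩ := h_good hω
    have hmin := hz.isMinOn ω exists_min
    exact h_on hmin (near _ (hz.mem ω) (hmin hA.mem))
  · gcongr
    calc _ ≤ C / (S.card : ℝ) ^ 4 * (S.card ^ 2 * B) := by gcongr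
      _ = C * B / (S.card : ℝ) ^ 2 := by field_simp
      _ ≤ C * B / S.card := by gcongr; exact le_self_pow₀ one_le_card two_ne_zero

section Minimizer

variable {ι : Type*} [Fintype ι] {S : Finset ι} {zhat : (ι → Y) → EuclideanSpace ℝ (Fin dz)}

lemma integrable_sqrt_card_mul_norm_sub_pow (hA : Assumptions M ℓ Z Q z₀)
    (hz : IsEmpiricalMinimizer ℓ Z S zhat) (b : EuclideanSpace ℝ (Fin dz)) (p : ℕ) :
    Integrable (fun ω => (√S.card * ‖zhat ω - b‖) ^ p) (Measure.pi fun _ : ι => Q) := by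
  have := hA.isProbabilityMeasure
  obtain ⟨D, -, hD⟩ := hA.exists_norm_sub_le
  refine Integrable.of_bound
    (((hz.measurable.sub_const b).norm.const_mul _).pow_const p).aestronglyMeasurable
    ((√S.card * (D + ‖z₀ - b‖)) ^ p) (ae_of_all _ fun ω => ?_)
  rw [Real.norm_of_nonneg (by positivity)]
  gcongr
  exact (norm_sub_le_norm_sub_add_norm_sub _ z₀ _).trans (by gcongr; exact hD _ (hz.mem ω))

lemma integrable_sqrt_card_mul_norm_sub (hA : Assumptions M ℓ Z Q z₀)
    (hz : IsEmpiricalMinimizer ℓ Z S zhat) (b : EuclideanSpace ℝ (Fin dz)) :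
    Integrable (fun ω => √S.card * ‖zhat ω - b‖) (Measure.pi fun _ : ι => Q) := by
  simpa using hA.integrable_sqrt_card_mul_norm_sub_pow hz b 1

lemma integrable_expectedCost_comp (hA : Assumptions M ℓ Z Q z₀)
    (hℓ : Measurable (Function.uncurry ℓ)) (hz : Measurable zhat) (mem : ∀ ω, zhat ω ∈ Z) :
    Integrable (fun ω => expectedCost ℓ Q (zhat ω)) (Measure.pi fun _ : ι => Q) := by
  have := hA.isProbabilityMeasure
  exact Integrable.of_bound ((hA.measurable_expectedCost hℓ).comp hz).aestronglyMeasurable M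
    (ae_of_all _ fun ω => hA.abs_expectedCost_le (mem ω))

lemma integrable_totalCost_comp (hA : Assumptions M ℓ Z Q z₀)
    (hℓ : Measurable (Function.uncurry ℓ)) (S : Finset ι) (hz : Measurable zhat)
    (mem : ∀ ω, zhat ω ∈ Z) :
    Integrable (fun ω => totalCost ℓ S ω (zhat ω)) (Measure.pi fun _ : ι => Q) := by
  have := hA.isProbabilityMeasure
  refine integrable_finsetSum _ fun i _ => Integrable.of_bound
    (hℓ.comp (hz.prodMk (measurable_pi_apply i))).aestronglyMeasurable M ?_
  filter_upwards [ae_pi_of_ae (ι := ι) hA.cost_bounded] with ω hω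
  exact hω i _ (mem ω)

lemma integrable_deviation_comp (hA : Assumptions M ℓ Z Q z₀)
    (hℓ : Measurable (Function.uncurry ℓ)) (S : Finset ι) (hz : Measurable zhat)
    (mem : ∀ ω, zhat ω ∈ Z) :
    Integrable (fun ω => deviation ℓ Q S ω (zhat ω)) (Measure.pi fun _ : ι => Q) := by
  simp only [eq_sub_of_add_eq (totalCost_eq_deviation_add ℓ Q S _ _).symm]
  exact (hA.integrable_totalCost_comp hℓ S hz mem).sub
    ((hA.integrable_expectedCost_comp hℓ hz mem).const_mul _)

lemma integrable_deviation_sub (hA : Assumptions M ℓ Z Q z₀)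
    (hℓ : Measurable (Function.uncurry ℓ)) (hz : IsEmpiricalMinimizer ℓ Z S zhat)
    {b : EuclideanSpace ℝ (Fin dz)} (hb : b ∈ Z) :
    Integrable (fun ω => deviation ℓ Q S ω b - deviation ℓ Q S ω (zhat ω))
      (Measure.pi fun _ : ι => Q) :=
  (hA.integrable_deviation_comp hℓ S measurable_const fun _ => hb).sub
    (hA.integrable_deviation_comp hℓ S hz.measurable hz.mem)

lemma integral_totalCost (hA : Assumptions M ℓ Z Q z₀) (hℓ : Measurable (Function.uncurry ℓ))
    (S : Finset ι) {z : EuclideanSpace ℝ (Fin dz)} (hz : z ∈ Z) :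
    ∫ ω, totalCost ℓ S ω z ∂(Measure.pi fun _ : ι => Q) = S.card * expectedCost ℓ Q z := by
  have := hA.isProbabilityMeasure
  have hint := hA.integrable_cost hℓ hz
  simp only [totalCost]
  rw [integral_finsetSum _ fun i _ => integrable_comp_eval (μ := fun _ : ι => Q) hint,
    Finset.sum_congr rfl fun i _ => integral_comp_eval (μ := fun _ : ι => Q) hint.1]
  simp [expectedCost]

end Minimizer

lemma le_abs_deviation_sub_of_totalCost_le {ι : Type*} {S : Finset ι} {ω : ι → Y} {c : ℝ}
    {z : EuclideanSpace ℝ (Fin dz)}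
    (growth : c * ‖z - z₀‖ ^ 2 ≤ expectedCost ℓ Q z - expectedCost ℓ Q z₀)
    (hle : totalCost ℓ S ω z ≤ totalCost ℓ S ω z₀) :
    c * (√S.card * ‖z - z₀‖) ^ 2 ≤ |deviation ℓ Q S ω z₀ - deviation ℓ Q S ω z| := by
  rw [totalCost_eq_deviation_add ℓ Q, totalCost_eq_deviation_add ℓ Q] at hle
  rw [mul_pow, Real.sq_sqrt (Nat.cast_nonneg _)]
  have scaled_growth : S.card * (c * ‖z - z₀‖ ^ 2)
      ≤ S.card * (expectedCost ℓ Q z - expectedCost ℓ Q z₀) := by gcongr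
  linarith [le_abs_self (deviation ℓ Q S ω z₀ - deviation ℓ Q S ω z)]

lemma ae_pow_four_add_abs_deviation_sub_le {ι : Type*} [Fintype ι] {S : Finset ι}
    (hA : Assumptions M ℓ Z Q z₀) (hℓ : Measurable (Function.uncurry ℓ)) (hS : S.Nonempty) {D : ℝ}
    (hD : ∀ z ∈ Z, ‖z - z₀‖ ≤ D) :
    ∀ᵐ ω ∂(Measure.pi fun _ : ι => Q), ∀ z ∈ Z, (√S.card * ‖z - z₀‖) ^ 4 +
      |deviation ℓ Q S ω z₀ - deviation ℓ Q S ω z| ≤ S.card ^ 2 * (D ^ 4 + 2 * M * D) := by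
  have hM := hA.bound_nonneg
  have one_le_card : (1 : ℝ) ≤ S.card := by exact_mod_cast hS.card_pos
  filter_upwards [hA.ae_abs_deviation_sub_le hℓ S] with ω hω z hz
  have norm_le := hD z hz
  rw [mul_add]
  refine add_le_add ?_ ((hω _ hA.mem _ hz).trans ?_)
  · rw [mul_pow, show 4 = 2 * 2 by rfl, pow_mul √(S.card : ℝ), Real.sq_sqrt (Nat.cast_nonneg _)]
    gcongr
  · rw [dist_comm, dist_eq_norm]
    gcongr
    exact le_self_pow₀ one_le_card two_ne_zero

/-- At the rate `1 / √k` the quadratic growth of the expected cost balances the modulus of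
continuity of the deviations. -/
lemma exists_localization (hA : Assumptions M ℓ Z Q z₀) (hℓ : Measurable (Function.uncurry ℓ)) :
    ∃ C, ∀ {ι : Type*} [Fintype ι] (S : Finset ι), S.Nonempty → ∀ zhat,
      IsEmpiricalMinimizer ℓ Z S zhat →
        ∫ ω, ((√S.card * ‖zhat ω - z₀‖) ^ 4 +
          |deviation ℓ Q S ω z₀ - deviation ℓ Q S ω (zhat ω)|)
          ∂(Measure.pi fun _ : ι => Q) ≤ C := by
  have := hA.isProbabilityMeasure
  have hM := hA.bound_nonneg
  obtain ⟨c, hc, ε₁, hε₁, growth⟩ := hA.exists_quadratic_growth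
  obtain ⟨C₁, ε₂, hε₂, local_modulus⟩ := hA.exists_local_modulus hℓ
  obtain ⟨C₂, hC₂, integral_le⟩ := hA.exists_integral_le_add_of_isMinOn hℓ (lt_min hε₁ hε₂)
  obtain ⟨D, hD0, hD⟩ := hA.exists_norm_sub_le
  set a := 1 + 9 * (8 / c ^ 2) ^ 4
  refine ⟨18 + a * C₁ + C₂ * (D ^ 4 + 2 * M * D), fun {ι} _ S hS zhat hz => ?_⟩
  obtain ⟨A, A_nonneg, A_integrable, A_le, modulus⟩ :=
    local_modulus S hS z₀ (by simpa using hε₂.le) 1 one_pos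
  have one_le_card : (1 : ℝ) ≤ S.card := by exact_mod_cast hS.card_pos
  refine (integral_le S hS zhat hz _ (fun ω => 18 + a * A ω ^ 4) (D ^ 4 + 2 * M * D)
    (by positivity) ((hA.integrable_sqrt_card_mul_norm_sub_pow hz z₀ 4).add
      (hA.integrable_deviation_sub hℓ hz hA.mem).abs)
    ((integrable_const _).add (A_integrable.const_mul a)) ?_ ?_).trans ?_
  · filter_upwards [modulus] with ω hω hmin hnear
    have modulus_zhat := hω _ (hnear.le.trans (min_le_right _ _))
    rw [one_pow, one_mul, div_one, ← sq_abs, abs_sub_comm, sq_abs] at modulus_zhat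
    exact pow_four_add_abs_le (A_nonneg ω) (by positivity) hc
      (le_abs_deviation_sub_of_totalCost_le (growth _ (hnear.trans_le (min_le_left _ _)))
        (hmin hA.mem)) modulus_zhat
  · filter_upwards [hA.ae_pow_four_add_abs_deviation_sub_le hℓ hS hD] with ω hω
    have : 0 ≤ a * A ω ^ 4 := by have := A_nonneg ω; positivity
    simp only [Pi.add_apply]
    linarith [hω _ (hz.mem ω)]
  · rw [integral_add (integrable_const _) (A_integrable.const_mul a), integral_const_mul,
      integral_const, probReal_univ, one_smul]
    gcongr
    exact div_le_self (by positivity) one_le_card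

end Assumptions

end Rates

section RateBounds

variable {dz : ℕ} {Y : Type*} [MeasurableSpace Y] {M : ℝ} {ℓ : EuclideanSpace ℝ (Fin dz) → Y → ℝ}
  {Z : Set (EuclideanSpace ℝ (Fin dz))} {Q : Measure Y} {z₀ : EuclideanSpace ℝ (Fin dz)}

/-- The error of the first-order expansion at `z₀` of the deviations of the costs, whose
expected costs have vanishing gradient there. -/
def linearizationError (ℓ : EuclideanSpace ℝ (Fin dz) → Y → ℝ) (Q : Measure Y)
    (z₀ : EuclideanSpace ℝ (Fin dz)) {ι : Type*} (S : Finset ι) (ω : ι → Y)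
    (h : EuclideanSpace ℝ (Fin dz)) : ℝ :=
  deviation ℓ Q S ω (z₀ + h) - deviation ℓ Q S ω z₀ -
    ∑ i ∈ S, fderiv ℝ (fun z => ℓ z (ω i)) z₀ h

lemma abs_sum_fderiv_sub_le_max_totalCost_sub {ι : Type*} (S : Finset ι) (ω : ι → Y)
    (h : EuclideanSpace ℝ (Fin dz)) {B : ℝ}
    (excess_le : expectedCost ℓ Q (z₀ + h) - expectedCost ℓ Q z₀ ≤ B)
    (excess_neg_le : expectedCost ℓ Q (z₀ + -h) - expectedCost ℓ Q z₀ ≤ B) :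
    |∑ i ∈ S, fderiv ℝ (fun z => ℓ z (ω i)) z₀ h| - |linearizationError ℓ Q z₀ S ω h| -
        |linearizationError ℓ Q z₀ S ω (-h)| - S.card * B ≤
      max (totalCost ℓ S ω z₀ - totalCost ℓ S ω (z₀ + h))
        (totalCost ℓ S ω z₀ - totalCost ℓ S ω (z₀ + -h)) := by
  set F := ∑ i ∈ S, fderiv ℝ (fun z => ℓ z (ω i)) z₀ h
  have scaled : S.card * (expectedCost ℓ Q (z₀ + h) - expectedCost ℓ Q z₀) ≤ S.card * B := by gcongr
  have scaled_neg :
      S.card * (expectedCost ℓ Q (z₀ + -h) - expectedCost ℓ Q z₀) ≤ S.card * B := by gcongr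
  have deviation_eq : deviation ℓ Q S ω (z₀ + h) - deviation ℓ Q S ω z₀ =
      F + linearizationError ℓ Q z₀ S ω h := by simp [linearizationError, F]
  have deviation_neg_eq : deviation ℓ Q S ω (z₀ + -h) - deviation ℓ Q S ω z₀ =
      -F + linearizationError ℓ Q z₀ S ω (-h) := by simp [linearizationError, F]
  have error_le := le_abs_self (linearizationError ℓ Q z₀ S ω h)
  have error_neg_le := le_abs_self (linearizationError ℓ Q z₀ S ω (-h))
  have := abs_nonneg (linearizationError ℓ Q z₀ S ω h)
  have := abs_nonneg (linearizationError ℓ Q z₀ S ω (-h))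
  simp only [totalCost_eq_deviation_add ℓ Q]
  rcases abs_choice F with hF | hF
  · exact le_max_of_le_right (by linarith)
  · exact le_max_of_le_left (by linarith)

namespace Assumptions

section UpperBounds

variable (hA : Assumptions M ℓ Z Q z₀) (hℓ : Measurable (Function.uncurry ℓ))

include hA hℓ

lemma exists_integral_pow_four_le :
    ∃ C, ∀ {ι : Type*} [Fintype ι] (S : Finset ι), S.Nonempty → ∀ zhat,
      IsEmpiricalMinimizer ℓ Z S zhat →
        ∫ ω, (√S.card * ‖zhat ω - z₀‖) ^ 4 ∂(Measure.pi fun _ : ι => Q) ≤ C := by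
  obtain ⟨C, localization⟩ := hA.exists_localization hℓ
  refine ⟨C, fun {ι} _ S hS zhat hz => ?_⟩
  have fourth_integrable := hA.integrable_sqrt_card_mul_norm_sub_pow hz z₀ 4
  exact (integral_mono fourth_integrable
    (fourth_integrable.add (hA.integrable_deviation_sub hℓ hz hA.mem).abs)
    fun ω => le_add_of_nonneg_right (abs_nonneg _)).trans (localization S hS zhat hz)

lemma exists_integral_norm_sub_le :
    ∃ C, ∀ {ι : Type*} [Fintype ι] (S : Finset ι), S.Nonempty → ∀ zhat,
      IsEmpiricalMinimizer ℓ Z S zhat →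
        ∫ ω, √S.card * ‖zhat ω - z₀‖ ∂(Measure.pi fun _ : ι => Q) ≤ C := by
  have := hA.isProbabilityMeasure
  obtain ⟨C, fourth_le⟩ := hA.exists_integral_pow_four_le hℓ
  refine ⟨1 + C, fun {ι} _ S hS zhat hz => ?_⟩
  have fourth_integrable := hA.integrable_sqrt_card_mul_norm_sub_pow hz z₀ 4
  refine (integral_mono (hA.integrable_sqrt_card_mul_norm_sub hz z₀)
    ((integrable_const 1).add fourth_integrable) fun ω => ?_).trans ?_
  · simp only [Pi.add_apply]
    set ρ := √S.card * ‖zhat ω - z₀‖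
    nlinarith [sq_nonneg (ρ ^ 2 - 1), sq_nonneg (ρ - 1)]
  · simp only [Pi.add_apply]
    rw [integral_add (integrable_const 1) fourth_integrable]
    simpa using fourth_le S hS zhat hz

lemma exists_integral_excess_le :
    ∃ C, ∀ {ι : Type*} [Fintype ι] (S : Finset ι), S.Nonempty → ∀ zhat,
      IsEmpiricalMinimizer ℓ Z S zhat →
        ∫ ω, S.card * (expectedCost ℓ Q (zhat ω) - expectedCost ℓ Q z₀)
          ∂(Measure.pi fun _ : ι => Q) ≤ C := by
  have := hA.isProbabilityMeasure
  obtain ⟨C, fourth_le⟩ := hA.exists_integral_pow_four_le hℓ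
  obtain ⟨C', hC', excess_le⟩ := hA.exists_excess_le
  refine ⟨C' * (1 + C), fun {ι} _ S hS zhat hz => ?_⟩
  have fourth_integrable := hA.integrable_sqrt_card_mul_norm_sub_pow hz z₀ 4
  have dominating_integrable := (integrable_const (1 : ℝ)).add fourth_integrable
  refine (integral_mono (((hA.integrable_expectedCost_comp hℓ hz.measurable hz.mem).sub
    (integrable_const _)).const_mul _) (dominating_integrable.const_mul C') fun ω => ?_).trans ?_
  · calc S.card * (expectedCost ℓ Q (zhat ω) - expectedCost ℓ Q z₀)
        ≤ S.card * (C' * ‖zhat ω - z₀‖ ^ 2) := by gcongr; exact excess_le _ (hz.mem ω)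
      _ = C' * (√S.card * ‖zhat ω - z₀‖) ^ 2 := by
        rw [mul_pow, Real.sq_sqrt (Nat.cast_nonneg _)]; ring
      _ ≤ C' * (1 + (√S.card * ‖zhat ω - z₀‖) ^ 4) := by
        gcongr
        nlinarith [sq_nonneg ((√S.card * ‖zhat ω - z₀‖) ^ 2 - 1)]
  · rw [integral_const_mul]
    gcongr
    simp only [Pi.add_apply]
    rw [integral_add (integrable_const 1) fourth_integrable]
    simpa using fourth_le S hS zhat hz

lemma exists_integral_totalCost_sub_le :
    ∃ C, ∀ {ι : Type*} [Fintype ι] (S : Finset ι), S.Nonempty → ∀ zhat,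
      IsEmpiricalMinimizer ℓ Z S zhat →
        ∫ ω, (totalCost ℓ S ω z₀ - totalCost ℓ S ω (zhat ω)) ∂(Measure.pi fun _ : ι => Q) ≤ C := by
  obtain ⟨C, localization⟩ := hA.exists_localization hℓ
  refine ⟨C, fun {ι} _ S hS zhat hz => (integral_mono
    ((hA.integrable_totalCost_comp hℓ S measurable_const fun _ => hA.mem).sub
      (hA.integrable_totalCost_comp hℓ S hz.measurable hz.mem))
    ((hA.integrable_sqrt_card_mul_norm_sub_pow hz z₀ 4).add
      (hA.integrable_deviation_sub hℓ hz hA.mem).abs) fun ω => ?_).trans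
    (localization S hS zhat hz)⟩
  have scaled_excess_nonneg : 0 ≤ S.card * (expectedCost ℓ Q (zhat ω) - expectedCost ℓ Q z₀) :=
    mul_nonneg (Nat.cast_nonneg _) (sub_nonneg.2 (hA.expectedCost_le (hz.mem ω)))
  have : 0 ≤ (√S.card * ‖zhat ω - z₀‖) ^ 4 := by positivity
  simp only [Pi.sub_apply, Pi.add_apply, totalCost_eq_deviation_add ℓ Q]
  linarith [le_abs_self (deviation ℓ Q S ω z₀ - deviation ℓ Q S ω (zhat ω))]

end UpperBounds

section Linearization

variable (hA : Assumptions M ℓ Z Q z₀) (hℓ : Measurable (Function.uncurry ℓ))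
  {h : EuclideanSpace ℝ (Fin dz)}

include hA hℓ

lemma memLp_cost_remainder (hmem : z₀ + h ∈ Z) (p : ℝ≥0∞) :
    MemLp (fun y => ℓ (z₀ + h) y - ℓ z₀ y - fderiv ℝ (fun z => ℓ z y) z₀ h) p Q := by
  have := hA.isProbabilityMeasure
  refine MemLp.of_bound ((hℓ.of_uncurry_left.sub hℓ.of_uncurry_left).sub
    (hA.measurable_fderiv hℓ h)).aestronglyMeasurable (M * dist (z₀ + h) z₀ + M * ‖h‖) ?_
  filter_upwards [hA.cost_lipschitz, hA.ae_abs_fderiv_le h] with y lipschitz gradient_le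
  exact (norm_sub_le _ _).trans (add_le_add (lipschitz _ hmem _ hA.mem) gradient_le)

lemma integral_cost_remainder (hmem : z₀ + h ∈ Z) :
    ∫ y, (ℓ (z₀ + h) y - ℓ z₀ y - fderiv ℝ (fun z => ℓ z y) z₀ h) ∂Q =
      expectedCost ℓ Q (z₀ + h) - expectedCost ℓ Q z₀ := by
  have := hA.isProbabilityMeasure
  have cost_integrable := fun {z} (hz : z ∈ Z) => hA.integrable_cost hℓ hz
  have gradient_integrable : Integrable (fun y => fderiv ℝ (fun z => ℓ z y) z₀ h) Q :=
    Integrable.of_bound (hA.measurable_fderiv hℓ h).aestronglyMeasurable _ (hA.ae_abs_fderiv_le h)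
  rw [integral_sub (f := fun y => ℓ (z₀ + h) y - ℓ z₀ y)
      ((cost_integrable hmem).sub (cost_integrable hA.mem)) gradient_integrable,
    integral_sub (cost_integrable hmem) (cost_integrable hA.mem), hA.integral_fderiv_eq_zero hℓ,
    sub_zero, expectedCost, expectedCost]

end Linearization

lemma exists_integral_abs_linearizationError_le (hA : Assumptions M ℓ Z Q z₀)
    (hℓ : Measurable (Function.uncurry ℓ)) {κ : ℝ} (hκ : 0 < κ) :
    ∃ ε > 0, ∀ {ι : Type*} [Fintype ι] (S : Finset ι), ∀ h, ‖h‖ < ε →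
      Integrable (fun ω => linearizationError ℓ Q z₀ S ω h) (Measure.pi fun _ : ι => Q) ∧
      ∫ ω, |linearizationError ℓ Q z₀ S ω h| ∂(Measure.pi fun _ : ι => Q) ≤
        κ * (√S.card * ‖h‖) := by
  have := hA.isProbabilityMeasure
  obtain ⟨ε₁, hε₁, ball_subset⟩ := Metric.mem_nhds_iff.1 hA.mem_nhds
  obtain ⟨ε₂, hε₂, remainder_le⟩ := hA.exists_integral_sq_remainder_le hℓ (pow_pos hκ 2)
  refine ⟨min ε₁ ε₂, lt_min hε₁ hε₂, fun {ι} _ S h hh => ?_⟩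
  have hmem : z₀ + h ∈ Z := ball_subset (by simpa using hh.trans_le (min_le_left _ _))
  set r : Y → ℝ := fun y => ℓ (z₀ + h) y - ℓ z₀ y - fderiv ℝ (fun z => ℓ z y) z₀ h
  have r_memLp : MemLp r 2 Q := hA.memLp_cost_remainder hℓ hmem 2
  have centered_memLp : MemLp (fun y => r y - ∫ y, r y ∂Q) 2 Q := r_memLp.sub (memLp_const _)
  have error_eq : ∀ ω : ι → Y,
      linearizationError ℓ Q z₀ S ω h = ∑ i ∈ S, (r (ω i) - ∫ y, r y ∂Q) := fun ω => by
    rw [linearizationError, deviation_sub_deviation, ← Finset.sum_sub_distrib,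
      hA.integral_cost_remainder hℓ hmem]
    exact Finset.sum_congr rfl fun i _ => sub_right_comm _ _ _
  have integral_centered : ∫ y, (r y - ∫ y, r y ∂Q) ∂Q = 0 := by
    rw [integral_sub (r_memLp.integrable (by norm_num)) (integrable_const _)]
    simp
  have centered_sq_le : ∫ y, (r y - ∫ y, r y ∂Q) ^ 2 ∂Q ≤ κ ^ 2 * ‖h‖ ^ 2 := by
    rw [← ProbabilityTheory.variance_eq_integral r_memLp.aestronglyMeasurable.aemeasurable]
    exact (ProbabilityTheory.variance_le_expectation_sq r_memLp.aestronglyMeasurable).trans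
      (remainder_le h (hh.trans_le (min_le_right _ _)))
  simp only [error_eq]
  refine ⟨(memLp_sum_pi centered_memLp S).integrable (by norm_num),
    (integral_abs_sum_le_sqrt centered_memLp integral_centered S).trans
      ((Real.sqrt_le_left (by positivity)).2 ?_)⟩
  rw [mul_pow, mul_pow, Real.sq_sqrt (Nat.cast_nonneg _), mul_left_comm]
  gcongr

end Assumptions

end RateBounds

section LowerBounds

variable {dz : ℕ} {Y : Type*} [MeasurableSpace Y] {M : ℝ} {ℓ : EuclideanSpace ℝ (Fin dz) → Y → ℝ}
  {Z : Set (EuclideanSpace ℝ (Fin dz))} {Q : Measure Y} {z₀ : EuclideanSpace ℝ (Fin dz)}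

lemma tendsto_inv_sqrt_natCast_smul (u : EuclideanSpace ℝ (Fin dz)) :
    Tendsto (fun k : ℕ => (√(k : ℝ))⁻¹ • u) atTop (𝓝 0) := by
  have tendsto_inv := tendsto_inv_atTop_zero.comp
    (Real.tendsto_sqrt_atTop.comp tendsto_natCast_atTop_atTop)
  simpa using tendsto_inv.smul_const u

namespace Assumptions

variable (hA : Assumptions M ℓ Z Q z₀) (hℓ : Measurable (Function.uncurry ℓ))

include hA

lemma integrable_abs_sum_fderiv (hℓ : Measurable (Function.uncurry ℓ)) {ι : Type*} [Fintype ι]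
    (S : Finset ι) (h : EuclideanSpace ℝ (Fin dz)) :
    Integrable (fun ω : ι → Y => |∑ i ∈ S, fderiv ℝ (fun z => ℓ z (ω i)) z₀ h|)
      (Measure.pi fun _ : ι => Q) := by
  have := hA.isProbabilityMeasure
  have gradient_integrable : Integrable (fun y => fderiv ℝ (fun z => ℓ z y) z₀ h) Q :=
    Integrable.of_bound (hA.measurable_fderiv hℓ h).aestronglyMeasurable _ (hA.ae_abs_fderiv_le h)
  exact (integrable_finsetSum _ fun i _ =>
    integrable_comp_eval (μ := fun _ : ι => Q) gradient_integrable).abs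

include hℓ

lemma integral_abs_sum_fderiv_sub_le_integral_max {ι : Type*} [Fintype ι] {S : Finset ι}
    {h : EuclideanSpace ℝ (Fin dz)} {C e : ℝ}
    (excess_le : ∀ z ∈ Z, expectedCost ℓ Q z - expectedCost ℓ Q z₀ ≤ C * ‖z - z₀‖ ^ 2)
    (error_le : ∀ h', ‖h'‖ = ‖h‖ → z₀ + h' ∈ Z ∧
      Integrable (fun ω => linearizationError ℓ Q z₀ S ω h') (Measure.pi fun _ : ι => Q) ∧
      ∫ ω, |linearizationError ℓ Q z₀ S ω h'| ∂(Measure.pi fun _ : ι => Q) ≤ e) :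
    ∫ ω, |∑ i ∈ S, fderiv ℝ (fun z => ℓ z (ω i)) z₀ h| ∂(Measure.pi fun _ : ι => Q) - 2 * e -
        C * (√S.card * ‖h‖) ^ 2 ≤
      ∫ ω, max (totalCost ℓ S ω z₀ - totalCost ℓ S ω (z₀ + h))
        (totalCost ℓ S ω z₀ - totalCost ℓ S ω (z₀ + -h)) ∂(Measure.pi fun _ : ι => Q) := by
  have := hA.isProbabilityMeasure
  obtain ⟨hmem, error_integrable, integral_error_le⟩ := error_le h rfl
  obtain ⟨hmem_neg, error_neg_integrable, integral_error_neg_le⟩ := error_le (-h) (norm_neg h)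
  have linear_integrable := hA.integrable_abs_sum_fderiv hℓ S h
  have cost_integrable := fun {z} (hz : z ∈ Z) =>
    hA.integrable_totalCost_comp hℓ S measurable_const (fun _ : ι → Y => hz)
  have diff_integrable := (linear_integrable.sub error_integrable.abs).sub error_neg_integrable.abs
  have pointwise := integral_mono (diff_integrable.sub (integrable_const (C * (√S.card * ‖h‖) ^ 2)))
    (((cost_integrable hA.mem).sub (cost_integrable hmem)).sup
      ((cost_integrable hA.mem).sub (cost_integrable hmem_neg))) fun ω => by
    have h_le := abs_sum_fderiv_sub_le_max_totalCost_sub S ω h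
      (by simpa using excess_le _ hmem) (by simpa using excess_le _ hmem_neg)
    rwa [mul_left_comm, ← Real.sq_sqrt (Nat.cast_nonneg S.card), ← mul_pow] at h_le
  refine le_trans ?_ pointwise
  rw [integral_sub' diff_integrable (integrable_const _),
    integral_sub' (linear_integrable.sub error_integrable.abs) error_neg_integrable.abs,
    integral_sub' linear_integrable error_integrable.abs, integral_const, probReal_univ, one_smul]
  linarith

lemma exists_le_integral_abs_sum_fderiv
    (hnondeg : ¬ ∀ᵐ y ∂Q, fderiv ℝ (fun z => ℓ z y) z₀ = 0) :
    ∃ u, ∃ c > 0, ∀ {ι : Type*} [Fintype ι] (S : Finset ι), S.Nonempty → ∀ τ > 0,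
      τ * c ≤ ∫ ω, |∑ i ∈ S, fderiv ℝ (fun z => ℓ z (ω i)) z₀ ((√S.card)⁻¹ • τ • u)|
        ∂(Measure.pi fun _ : ι => Q) := by
  have := hA.isProbabilityMeasure
  obtain ⟨u, hu⟩ := hA.exists_integral_fderiv_sq_pos hℓ hnondeg
  obtain ⟨c, hc, le_integral⟩ := exists_le_integral_abs_sum
    (hA.measurable_fderiv hℓ u).aemeasurable (hA.integral_fderiv_eq_zero hℓ u)
    (hA.ae_abs_fderiv_le u) hu
  refine ⟨u, c, hc, fun {ι} _ S hS τ hτ => ?_⟩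
  have : 0 < √(S.card : ℝ) := Real.sqrt_pos.2 (by exact_mod_cast hS.card_pos)
  simp only [map_smul, smul_eq_mul, ← mul_assoc, ← Finset.mul_sum, abs_mul]
  rw [integral_const_mul, abs_of_pos (by positivity), abs_of_pos hτ]
  calc τ * c = (√S.card)⁻¹ * τ * (c * √S.card) := by field_simp
    _ ≤ _ := by gcongr; exact le_integral S

/-- Along opposite steps of length of order `1 / √k`, the linear part of the total cost decreases
by its absolute value for one of the two signs; for short steps it dominates the curvature. -/
lemma exists_le_integral_max_totalCost_sub
    (hnondeg : ¬ ∀ᵐ y ∂Q, fderiv ℝ (fun z => ℓ z y) z₀ = 0) :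
    ∃ c > 0, ∀ᶠ k : ℕ in atTop, ∃ h, z₀ + h ∈ Z ∧ z₀ + -h ∈ Z ∧
      ∀ {ι : Type*} [Fintype ι] (S : Finset ι), S.card = k →
        c ≤ ∫ ω, max (totalCost ℓ S ω z₀ - totalCost ℓ S ω (z₀ + h))
          (totalCost ℓ S ω z₀ - totalCost ℓ S ω (z₀ + -h)) ∂(Measure.pi fun _ : ι => Q) := by
  obtain ⟨u, c, hc, linear_ge⟩ := hA.exists_le_integral_abs_sum_fderiv hℓ hnondeg
  obtain ⟨C, hC, excess_le⟩ := hA.exists_excess_le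
  set τ := c / (4 * (C * ‖u‖ ^ 2 + 1)) with hτ_def
  set κ := c / (8 * (‖u‖ + 1)) with hκ_def
  have hτ : 0 < τ := by positivity
  have hκ : 0 < κ := by positivity
  have curvature_le : C * (τ * ‖u‖) ^ 2 ≤ τ * (c / 4) := by
    have : τ * (C * ‖u‖ ^ 2 + 1) = c / 4 := by rw [hτ_def]; field_simp
    nlinarith
  have error_const_le : κ * (τ * ‖u‖) ≤ τ * (c / 8) := by
    have : κ * (‖u‖ + 1) = c / 8 := by rw [hκ_def]; field_simp
    nlinarith
  obtain ⟨ε, hε, error_le⟩ := hA.exists_integral_abs_linearizationError_le hℓ hκ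
  obtain ⟨ε', hε', ball_subset⟩ := Metric.mem_nhds_iff.1 hA.mem_nhds
  refine ⟨τ * (c / 2), by positivity, ?_⟩
  filter_upwards [(tendsto_inv_sqrt_natCast_smul (τ • u)).eventually
    (Metric.ball_mem_nhds 0 (lt_min hε hε')), eventually_gt_atTop 0] with k hk hk0
  have short := lt_min_iff.1 (mem_ball_zero_iff.1 hk)
  set h := (√(k : ℝ))⁻¹ • τ • u with hh
  have scaled_norm : √(k : ℝ) * ‖h‖ = τ * ‖u‖ := by
    rw [hh, norm_smul, norm_smul, Real.norm_of_nonneg (by positivity), Real.norm_of_nonneg hτ.le,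
      mul_inv_cancel_left₀ (by positivity)]
  have hmem : ∀ h', ‖h'‖ = ‖h‖ → z₀ + h' ∈ Z := fun h' hh' =>
    ball_subset (by simpa [hh'] using short.2)
  refine ⟨h, hmem h rfl, hmem (-h) (norm_neg h), fun {ι} _ S hS => ?_⟩
  subst hS
  have le_max := hA.integral_abs_sum_fderiv_sub_le_integral_max hℓ (S := S) excess_le
    fun h' hh' => ⟨hmem h' hh', hh' ▸ error_le S h' (hh' ▸ short.1)⟩
  have linear_part := linear_ge S (Finset.card_pos.1 hk0) τ hτ
  rw [scaled_norm] at le_max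
  linarith

lemma exists_le_integral_totalCost_sub
    (hnondeg : ¬ ∀ᵐ y ∂Q, fderiv ℝ (fun z => ℓ z y) z₀ = 0) :
    ∃ c > 0, ∀ᶠ k : ℕ in atTop, ∀ {ι : Type*} [Fintype ι] (S : Finset ι), S.card = k → ∀ zhat,
      IsEmpiricalMinimizer ℓ Z S zhat →
        c ≤ ∫ ω, (totalCost ℓ S ω z₀ - totalCost ℓ S ω (zhat ω))
          ∂(Measure.pi fun _ : ι => Q) := by
  have hM := hA.bound_nonneg
  obtain ⟨c, hc, le_integral_max⟩ := hA.exists_le_integral_max_totalCost_sub hℓ hnondeg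
  obtain ⟨C, -, integral_le⟩ := hA.exists_integral_le_add_of_isMinOn hℓ one_pos
  refine ⟨c / 2, by positivity, ?_⟩
  filter_upwards [le_integral_max, eventually_gt_atTop 0,
    (tendsto_const_div_atTop_nhds_zero_nat (C * (4 * M))).eventually_le_const (half_pos hc)]
    with k ⟨h, hmem, hmem_neg, le_integral⟩ hk0 small
  rintro ι _ S rfl zhat hz
  have cost_integrable := fun {z} (hz : z ∈ Z) =>
    hA.integrable_totalCost_comp hℓ S measurable_const (fun _ : ι → Y => hz)
  have one_le_card : (1 : ℝ) ≤ S.card := by exact_mod_cast hk0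
  have integral_max_le := integral_le S (Finset.card_pos.1 hk0) zhat hz _
    (fun ω => totalCost ℓ S ω z₀ - totalCost ℓ S ω (zhat ω)) (4 * M) (by positivity)
    (((cost_integrable hA.mem).sub (cost_integrable hmem)).sup
      ((cost_integrable hA.mem).sub (cost_integrable hmem_neg)))
    ((cost_integrable hA.mem).sub (hA.integrable_totalCost_comp hℓ S hz.measurable hz.mem))
    (ae_of_all _ fun ω hmin _ => max_le (sub_le_sub_left (hmin hmem) _)
      (sub_le_sub_left (hmin hmem_neg) _)) (by
    filter_upwards [hA.ae_abs_totalCost_sub_le S] with ω hω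
    have lower := (abs_le.1 (hω _ hA.mem _ (hz.mem ω))).1
    have card_le : (S.card : ℝ) * (2 * M) ≤ S.card ^ 2 * (2 * M) := by
      gcongr
      exact le_self_pow₀ one_le_card two_ne_zero
    simp only [Pi.sup_apply, Pi.sub_apply]
    exact max_le (by linarith [(abs_le.1 (hω _ hA.mem _ hmem)).2])
      (by linarith [(abs_le.1 (hω _ hA.mem _ hmem_neg)).2]))
  have := (le_integral S rfl).trans integral_max_le
  linarith

end Assumptions

end LowerBounds

section VariabilityLowerBound

lemma abs_le_of_sq_le_mul_pow_three {A ρ X θ : ℝ} (hA : 0 ≤ A) (hρ : 0 ≤ ρ) (hθ : 0 < θ)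
    (modulus : X ^ 2 ≤ θ ^ 2 * A * (1 + ρ / θ) ^ 3) :
    |X| ≤ θ * (4 + 2 * A ^ 4 + ρ ^ 4) + 2 / θ ^ 2 * ρ := by
  have : A ^ 2 ≤ 1 + A ^ 4 := by nlinarith [sq_nonneg (A ^ 2 - 1)]
  rcases le_total ρ θ with near | far
  · have ratio_le : 1 + ρ / θ ≤ 2 := by linarith [(div_le_one hθ).2 near]
    have abs_le : |X| ≤ θ * (2 + A) := by
      refine abs_le_of_sq_le_sq ?_ (by positivity)
      calc X ^ 2 ≤ θ ^ 2 * A * (1 + ρ / θ) ^ 3 := modulus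
        _ ≤ θ ^ 2 * A * 2 ^ 3 := by gcongr
        _ ≤ (θ * (2 + A)) ^ 2 := by nlinarith [mul_nonneg (sq_nonneg θ) (sq_nonneg (A - 2))]
    calc |X| ≤ θ * (2 + A) := abs_le
      _ ≤ θ * (4 + 2 * A ^ 4 + ρ ^ 4) := by
        refine mul_le_mul_of_nonneg_left ?_ hθ.le
        nlinarith [pow_nonneg hρ 4, pow_nonneg hA 4]
      _ ≤ _ := le_add_of_nonneg_right (by positivity)
  · have ratio_le : 1 + ρ / θ ≤ 2 * (ρ / θ) := by linarith [(one_le_div hθ).2 far]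
    have abs_le : |X| ≤ θ * (A * ρ ^ 2) + 2 / θ ^ 2 * ρ := by
      refine abs_le_of_sq_le_sq ?_ (by positivity)
      calc X ^ 2 ≤ θ ^ 2 * A * (1 + ρ / θ) ^ 3 := modulus
        _ ≤ θ ^ 2 * A * (2 * (ρ / θ)) ^ 3 := by gcongr
        _ = 4 * (θ * (A * ρ ^ 2)) * (2 / θ ^ 2 * ρ) := by field
        _ ≤ _ := four_mul_le_sq_add _ _
    have product_le : A * ρ ^ 2 ≤ 4 + 2 * A ^ 4 + ρ ^ 4 := by
      nlinarith [sq_nonneg (A - ρ ^ 2), pow_nonneg hρ 4, pow_nonneg hA 4]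
    calc |X| ≤ θ * (A * ρ ^ 2) + 2 / θ ^ 2 * ρ := abs_le
      _ ≤ _ := by gcongr

variable {dz : ℕ} {Y : Type*} [MeasurableSpace Y] {M : ℝ} {ℓ : EuclideanSpace ℝ (Fin dz) → Y → ℝ}
  {Z : Set (EuclideanSpace ℝ (Fin dz))} {Q : Measure Y} {z₀ : EuclideanSpace ℝ (Fin dz)}

namespace Assumptions

variable (hA : Assumptions M ℓ Z Q z₀) (hℓ : Measurable (Function.uncurry ℓ))

include hA hℓ

lemma exists_integral_pow_four_sub_le (K : ℝ) :
    ∃ C, ∀ {ι : Type*} [Fintype ι] (S : Finset ι), S.Nonempty → ∀ zhat,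
      IsEmpiricalMinimizer ℓ Z S zhat → ∀ b, √S.card * ‖b - z₀‖ ≤ K →
        ∫ ω, (√S.card * ‖zhat ω - b‖) ^ 4 ∂(Measure.pi fun _ : ι => Q) ≤ C := by
  have := hA.isProbabilityMeasure
  obtain ⟨C, integral_le⟩ := hA.exists_integral_pow_four_le hℓ
  refine ⟨2 ^ 3 * (C + K ^ 4), fun {ι} _ S hS zhat hz b hb => ?_⟩
  have pow_integrable := hA.integrable_sqrt_card_mul_norm_sub_pow hz z₀ 4
  calc ∫ ω, (√S.card * ‖zhat ω - b‖) ^ 4 ∂(Measure.pi fun _ : ι => Q)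
      ≤ ∫ ω, 2 ^ 3 * ((√S.card * ‖zhat ω - z₀‖) ^ 4 + K ^ 4) ∂(Measure.pi fun _ : ι => Q) := by
        refine integral_mono (hA.integrable_sqrt_card_mul_norm_sub_pow hz b 4)
          ((pow_integrable.add (integrable_const _)).const_mul _) fun ω => ?_
        have hK : 0 ≤ K := le_trans (by positivity) hb
        refine le_trans ?_ (add_pow_le (by positivity) hK 4)
        gcongr
        calc √S.card * ‖zhat ω - b‖ ≤ √S.card * (‖zhat ω - z₀‖ + ‖b - z₀‖) := by
              gcongr
              simpa using norm_sub_le (zhat ω - z₀) (b - z₀)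
          _ ≤ _ := by rw [mul_add]; gcongr
    _ = 2 ^ 3 * (∫ ω, (√S.card * ‖zhat ω - z₀‖) ^ 4 ∂(Measure.pi fun _ : ι => Q) + K ^ 4) := by
        rw [integral_const_mul, integral_add pow_integrable (integrable_const _), integral_const,
          probReal_univ, one_smul]
    _ ≤ _ := by gcongr; exact integral_le S hS zhat hz

lemma exists_le_integral_deviation_sub
    (hnondeg : ¬ ∀ᵐ y ∂Q, fderiv ℝ (fun z => ℓ z y) z₀ = 0) :
    ∃ c > 0, ∀ᶠ k : ℕ in atTop, ∀ {ι : Type*} [Fintype ι] (S : Finset ι), S.card = k → ∀ zhat,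
      IsEmpiricalMinimizer ℓ Z S zhat → ∀ b ∈ Z,
        c ≤ ∫ ω, (deviation ℓ Q S ω b - deviation ℓ Q S ω (zhat ω))
          ∂(Measure.pi fun _ : ι => Q) := by
  have := hA.isProbabilityMeasure
  obtain ⟨c, hc, le_integral⟩ := hA.exists_le_integral_totalCost_sub hℓ hnondeg
  refine ⟨c, hc, ?_⟩
  filter_upwards [le_integral] with k le_integral
  rintro ι _ S hS zhat hz b hb
  have cost_integrable := fun {z} (hz : z ∈ Z) =>
    hA.integrable_totalCost_comp hℓ S measurable_const (fun _ : ι → Y => hz)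
  have zhat_integrable := hA.integrable_totalCost_comp hℓ S hz.measurable hz.mem
  have expected_integrable := hA.integrable_expectedCost_comp hℓ hz.measurable hz.mem
  have expected_le : expectedCost ℓ Q z₀ ≤
      ∫ ω, expectedCost ℓ Q (zhat ω) ∂(Measure.pi fun _ : ι => Q) := by
    simpa using integral_mono (integrable_const (expectedCost ℓ Q z₀)) expected_integrable
      fun ω => hA.expectedCost_le (hz.mem ω)
  have le_improvement := le_integral S hS zhat hz
  rw [integral_sub (cost_integrable hA.mem) zhat_integrable, hA.integral_totalCost hℓ S hA.mem]
    at le_improvement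
  calc c ≤ S.card * expectedCost ℓ Q z₀ -
        ∫ ω, totalCost ℓ S ω (zhat ω) ∂(Measure.pi fun _ : ι => Q) := le_improvement
    _ ≤ S.card * ∫ ω, expectedCost ℓ Q (zhat ω) ∂(Measure.pi fun _ : ι => Q) -
        ∫ ω, totalCost ℓ S ω (zhat ω) ∂(Measure.pi fun _ : ι => Q) := by gcongr
    _ = ∫ ω, ((totalCost ℓ S ω b - S.card * expectedCost ℓ Q b) -
          (totalCost ℓ S ω (zhat ω) - S.card * expectedCost ℓ Q (zhat ω)))
          ∂(Measure.pi fun _ : ι => Q) := by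
        rw [integral_sub (by exact (cost_integrable hb).sub (integrable_const _))
          (by exact zhat_integrable.sub (expected_integrable.const_mul _)),
          integral_sub (cost_integrable hb) (integrable_const _),
          integral_sub zhat_integrable (expected_integrable.const_mul _),
          integral_const, integral_const_mul, hA.integral_totalCost hℓ S hb, probReal_univ,
          one_smul]
        ring
    _ = _ := by simp only [totalCost_eq_deviation_add ℓ Q, add_sub_cancel_right]

lemma ae_deviation_sub_le_sq_card_mul {ι : Type*} [Fintype ι] {S : Finset ι} (hS : S.Nonempty)
    {D : ℝ} (norm_sub_le_D : ∀ z ∈ Z, ‖z - z₀‖ ≤ D) :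
    ∀ᵐ ω ∂(Measure.pi fun _ : ι => Q), ∀ b ∈ Z, ∀ z ∈ Z,
      deviation ℓ Q S ω b - deviation ℓ Q S ω z ≤ S.card ^ 2 * (2 * M * (2 * D)) := by
  have hM := hA.bound_nonneg
  have one_le_card : (1 : ℝ) ≤ S.card := by exact_mod_cast hS.card_pos
  filter_upwards [hA.ae_abs_deviation_sub_le hℓ S] with ω hω b hb z hz
  have dist_le : dist b z ≤ 2 * D := by
    rw [dist_eq_norm, ← sub_sub_sub_cancel_right b z z₀]
    linarith [norm_sub_le (b - z₀) (z - z₀), norm_sub_le_D b hb, norm_sub_le_D z hz]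
  calc deviation ℓ Q S ω b - deviation ℓ Q S ω z
      ≤ S.card * (2 * M * dist b z) := (abs_le.1 (hω b hb z hz)).2
    _ ≤ S.card ^ 2 * (2 * M * (2 * D)) := by
      gcongr
      exact le_self_pow₀ one_le_card two_ne_zero

lemma exists_integral_deviation_sub_le (K : ℝ) :
    ∃ C ≥ 0, ∃ ε > 0, ∀ {ι : Type*} [Fintype ι] (S : Finset ι), S.Nonempty → ∀ zhat,
      IsEmpiricalMinimizer ℓ Z S zhat → ∀ b ∈ Z, ‖b - z₀‖ ≤ ε → √S.card * ‖b - z₀‖ ≤ K →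
      ∀ θ > 0, ∫ ω, (deviation ℓ Q S ω b - deviation ℓ Q S ω (zhat ω))
          ∂(Measure.pi fun _ : ι => Q) ≤
        θ * C + 2 / θ ^ 2 * ∫ ω, √S.card * ‖zhat ω - b‖ ∂(Measure.pi fun _ : ι => Q) +
          C / S.card := by
  have := hA.isProbabilityMeasure
  have hM := hA.bound_nonneg
  obtain ⟨D, hD, norm_sub_le_D⟩ := hA.exists_norm_sub_le
  obtain ⟨Cmod, ε, hε, local_modulus⟩ := hA.exists_local_modulus hℓ
  obtain ⟨Cpow, integral_pow_le⟩ := hA.exists_integral_pow_four_sub_le hℓ K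
  obtain ⟨Cbad, hCbad, integral_le⟩ := hA.exists_integral_le_add_of_isMinOn hℓ hε
  set B := 2 * M * (2 * D)
  refine ⟨max (4 + 2 * Cmod + Cpow) (Cbad * B), le_max_of_le_right (by positivity), ε, hε,
    fun {ι} _ S hS zhat hz b hb hbε hbK θ hθ => ?_⟩
  obtain ⟨A, hA0, pow_A_integrable, integral_A_le, modulus⟩ := local_modulus S hS b hbε θ hθ
  have norm_integrable := hA.integrable_sqrt_card_mul_norm_sub hz b
  have norm_pow_integrable := hA.integrable_sqrt_card_mul_norm_sub_pow hz b 4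
  have const_add_integrable : Integrable (fun ω => 4 + 2 * A ω ^ 4) (Measure.pi fun _ : ι => Q) :=
    (integrable_const _).add (pow_A_integrable.const_mul 2)
  have sum_integrable : Integrable (fun ω => 4 + 2 * A ω ^ 4 + (√S.card * ‖zhat ω - b‖) ^ 4)
      (Measure.pi fun _ : ι => Q) := const_add_integrable.add norm_pow_integrable
  have deviation_le := integral_le S hS zhat hz _
    (fun ω => θ * (4 + 2 * A ω ^ 4 + (√S.card * ‖zhat ω - b‖) ^ 4) +
      2 / θ ^ 2 * (√S.card * ‖zhat ω - b‖)) B (by positivity)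
    (hA.integrable_deviation_sub hℓ hz hb)
    ((sum_integrable.const_mul θ).add (norm_integrable.const_mul _)) (by
    filter_upwards [modulus] with ω hω _ near
    refine le_trans (neg_sub (deviation ℓ Q S ω (zhat ω)) _ ▸ neg_le_abs _) ?_
    exact abs_le_of_sq_le_mul_pow_three (hA0 ω) (by positivity) hθ (hω _ near.le)) (by
    filter_upwards [hA.ae_deviation_sub_le_sq_card_mul hℓ hS norm_sub_le_D] with ω hω
    have := hA0 ω
    exact (hω b hb _ (hz.mem ω)).trans (le_add_of_nonneg_left (by positivity)))
  refine deviation_le.trans ?_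
  rw [integral_add (sum_integrable.const_mul θ) (norm_integrable.const_mul _), integral_const_mul,
    integral_const_mul, integral_add const_add_integrable norm_pow_integrable,
    integral_add (integrable_const _) (pow_A_integrable.const_mul 2), integral_const_mul,
    integral_const, probReal_univ, one_smul]
  gcongr
  · refine le_max_of_le_left ?_
    gcongr
    exact integral_pow_le S hS zhat hz b hbK
  · exact le_max_right _ _

/-- If the minimizer concentrated around a point faster than at rate `1 / √k`, then so would the
deviation around its value there, but the latter has mean bounded away from zero. -/
lemma exists_le_integral_norm_sub (hnondeg : ¬ ∀ᵐ y ∂Q, fderiv ℝ (fun z => ℓ z y) z₀ = 0)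
    (K : ℝ) :
    ∃ c > 0, ∀ᶠ k : ℕ in atTop, ∀ {ι : Type*} [Fintype ι] (S : Finset ι), S.card = k → ∀ zhat,
      IsEmpiricalMinimizer ℓ Z S zhat → ∀ b, √S.card * ‖b - z₀‖ ≤ K →
        c ≤ ∫ ω, √S.card * ‖zhat ω - b‖ ∂(Measure.pi fun _ : ι => Q) := by
  obtain ⟨c, hc, le_integral⟩ := hA.exists_le_integral_deviation_sub hℓ hnondeg
  obtain ⟨C, hC, ε, hε, integral_le⟩ := hA.exists_integral_deviation_sub_le hℓ K
  obtain ⟨ε', hε', ball_subset⟩ := Metric.mem_nhds_iff.1 hA.mem_nhds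
  set θ := c / (4 * (C + 1)) with hθ_def
  have hθ : 0 < θ := by positivity
  have θ_mul_le : θ * C ≤ c / 4 := by
    have : θ * (C + 1) = c / 4 := by rw [hθ_def]; field_simp
    linarith
  have tendsto_radius : Tendsto (fun k : ℕ => K / √(k : ℝ)) atTop (𝓝 0) :=
    (Real.tendsto_sqrt_atTop.comp tendsto_natCast_atTop_atTop).const_div_atTop K
  refine ⟨θ ^ 2 * c / 4, by positivity, ?_⟩
  filter_upwards [le_integral, eventually_gt_atTop 0,
    tendsto_radius.eventually_lt_const (lt_min hε hε'),
    (tendsto_const_div_atTop_nhds_zero_nat C).eventually_le_const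
      (show (0 : ℝ) < c / 4 by positivity)] with k le_integral hk0 radius_lt error_le
  rintro ι _ S rfl zhat hz b hb
  have : 0 < √(S.card : ℝ) := Real.sqrt_pos.2 (by exact_mod_cast hk0)
  have near : ‖b - z₀‖ < min ε ε' := ((le_div_iff₀' this).2 hb).trans_lt radius_lt
  have hbZ : b ∈ Z := ball_subset (mem_ball_iff_norm.2 (near.trans_le (min_le_right _ _)))
  have lower := le_integral S rfl zhat hz b hbZ
  have upper := integral_le S (Finset.card_pos.1 hk0) zhat hz b hbZ
    (near.le.trans (min_le_left _ _)) hb θ hθ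
  have scaled : c / 2 ≤
      2 / θ ^ 2 * ∫ ω, √S.card * ‖zhat ω - b‖ ∂(Measure.pi fun _ : ι => Q) := by linarith
  rw [div_mul_eq_mul_div, le_div_iff₀ (by positivity)] at scaled
  linarith

end Assumptions

end VariabilityLowerBound

/-! ### Distance ties -/

section Ties

lemma pi_null_of_forall_update_null {ι E : Type*} [Fintype ι] [DecidableEq ι] [MeasurableSpace E]
    {μ : Measure E} [IsProbabilityMeasure μ] {N : Set (ι → E)} (hN : MeasurableSet N) (i : ι)
    (section_null : ∀ X, μ {t | Function.update X i t ∈ N} = 0) :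
    Measure.pi (fun _ => μ) N = 0 := by
  obtain ⟨X⟩ : Nonempty (ι → E) := ⟨fun _ => μ.nonempty_of_neZero.some⟩
  have inner_zero :
      (fun X => ∫⁻ t, (N.indicator 1 : (ι → E) → ℝ≥0∞) (Function.update X i t) ∂μ) = 0 := by
    funext X
    exact (lintegral_indicator_one (measurable_update X hN)).trans (section_null X)
  rw [← lintegral_indicator_one hN, lintegral_eq_lmarginal_univ X,
    lmarginal_erase' (μ := fun _ => μ) _ (measurable_one.indicator hN) (Finset.mem_univ i),
    inner_zero]
  simp [lmarginal]

variable {ι E : Type*} [Fintype ι] [PseudoMetricSpace E] [SecondCountableTopology E]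
  [MeasurableSpace E] [OpensMeasurableSpace E] {μ : Measure E} [IsProbabilityMeasure μ]

lemma ae_dist_ne_of_update_eq [DecidableEq ι] (hμ : ∀ x r, μ (Metric.sphere x r) = 0) {i j : ι}
    (hij : i ≠ j) {x : (ι → E) → E} (hx : Measurable x)
    (update_eq : ∀ X t, x (Function.update X i t) = x X) :
    ∀ᵐ X ∂(Measure.pi fun _ : ι => μ), dist (X i) (x X) ≠ dist (X j) (x X) := by
  refine measure_eq_zero_iff_ae_notMem.1 (pi_null_of_forall_update_null (measurableSet_eq_fun
    ((measurable_pi_apply i).dist hx) ((measurable_pi_apply j).dist hx)) i fun X => ?_)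
  refine measure_mono_null (fun t ht => ?_) (hμ (x X) (dist (X j) (x X)))
  change dist (Function.update X i t i) (x _) = dist (Function.update X i t j) (x _) at ht
  rwa [update_eq, Function.update_self, Function.update_of_ne hij.symm] at ht

lemma ae_forall_dist_ne (hμ : ∀ x r, μ (Metric.sphere x r) = 0) (x : E) :
    ∀ᵐ X ∂(Measure.pi fun _ : ι => μ), ∀ i j, i ≠ j → dist (X i) x ≠ dist (X j) x := by
  classical
  simp only [ae_all_iff, eventually_imp_distrib_left]
  exact fun i j hij => ae_dist_ne_of_update_eq hμ hij measurable_const fun _ _ => rfl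

lemma ae_forall_dist_apply_ne (hμ : ∀ x r, μ (Metric.sphere x r) = 0) (l : ι) :
    ∀ᵐ X ∂(Measure.pi fun _ : ι => μ), ∀ i j, i ≠ j → dist (X i) (X l) ≠ dist (X j) (X l) := by
  classical
  simp only [ae_all_iff, eventually_imp_distrib_left]
  have of_ne : ∀ i j, i ≠ j → l ≠ i →
      ∀ᵐ X ∂(Measure.pi fun _ : ι => μ), dist (X i) (X l) ≠ dist (X j) (X l) := fun i j hij hli =>
    ae_dist_ne_of_update_eq hμ hij (measurable_pi_apply l) fun X t => Function.update_of_ne hli t X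
  intro i j hij
  rcases eq_or_ne l i with rfl | hli
  · exact (of_ne j l hij.symm hij).mono fun X h => h.symm
  · exact of_ne i j hij hli

end Ties

namespace IsNearestNeighborSet

variable {dx n k : ℕ} {X : Fin n → EuclideanSpace ℝ (Fin dx)}

lemma eq_of_dist_ne {x : EuclideanSpace ℝ (Fin dx)}
    (hne : ∀ i j, i ≠ j → dist (X i) x ≠ dist (X j) x) {S T : Finset (Fin n)}
    (hS : IsNearestNeighborSet k X x S) (hT : IsNearestNeighborSet k X x T) : S = T := by
  refine Finset.eq_of_subset_of_card_le ?_ (hT.1.trans hS.1.symm).le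
  by_contra not_subset
  obtain ⟨i, hiS, hiT⟩ := Finset.not_subset.1 not_subset
  obtain ⟨j, hjT, hjS⟩ := Finset.not_subset.1 fun h : T ⊆ S =>
    not_subset (Finset.eq_of_subset_of_card_le h (hS.1.trans hT.1.symm).le).ge
  exact hne i j (fun h => hiT (h ▸ hjT)) (le_antisymm (hS.2 i hiS j hjS) (hT.2 j hjT i hiT))

lemma self_mem (hk : 0 < k) {l : Fin n}
    (hne : ∀ i j, i ≠ j → dist (X i) (X l) ≠ dist (X j) (X l)) {S : Finset (Fin n)}
    (hS : IsNearestNeighborSet k X (X l) S) : l ∈ S := by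
  by_contra hl
  obtain ⟨i, hi⟩ := Finset.card_pos.1 (hS.1 ▸ hk)
  refine hne i l (ne_of_mem_of_not_mem hi hl) ((hS.2 i hi l hl).antisymm ?_)
  rw [dist_self]
  exact dist_nonneg

end IsNearestNeighborSet

/-! ### Conditioning on the covariates -/

section Conditioning

variable {dx n : ℕ} {Y : Type*} [MeasurableSpace Y]

instance isProbabilityMeasure_datasetLaw {P : Measure (EuclideanSpace ℝ (Fin dx) × Y)}
    [IsProbabilityMeasure P] : IsProbabilityMeasure (datasetLaw P n) := by
  unfold datasetLaw; infer_instance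

variable {μ : Measure (EuclideanSpace ℝ (Fin dx))} [IsProbabilityMeasure μ] {Q : Measure Y}
  [IsProbabilityMeasure Q]

lemma integral_datasetLaw_mem {s : Set ℝ} (convex : Convex ℝ s) (closed : IsClosed s)
    {g : (Fin n → EuclideanSpace ℝ (Fin dx) × Y) → ℝ} (hg : Integrable g (datasetLaw (μ.prod Q) n))
    (conditional_mem : ∀ᵐ X ∂(Measure.pi fun _ : Fin n => μ),
      ∫ ω, g (fun i => (X i, ω i)) ∂(Measure.pi fun _ : Fin n => Q) ∈ s) :
    ∫ D, g D ∂(datasetLaw (μ.prod Q) n) ∈ s := by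
  have pairing := (measurePreserving_arrowProdEquivProdArrow (EuclideanSpace ℝ (Fin dx)) Y (Fin n)
    (fun _ => μ) (fun _ => Q)).symm
  have paired_integrable := pairing.integrable_comp_of_integrable hg
  have disintegration : ∫ D, g D ∂(datasetLaw (μ.prod Q) n) = ∫ X, ∫ ω, g (fun i => (X i, ω i))
      ∂(Measure.pi fun _ : Fin n => Q) ∂(Measure.pi fun _ : Fin n => μ) :=
    (pairing.integral_comp' g).symm.trans (integral_prod _ paired_integrable)
  rw [disintegration]
  exact convex.integral_mem closed conditional_mem paired_integrable.integral_prod_left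

end Conditioning

/-! ### Decisions of a kNN learner -/

/-- Exchangeability: a decision that depends on the total cost only is invariant under permutations
of the neighbours. -/
lemma integral_cost_eq_of_factorsThrough {dz : ℕ} {ι Y : Type*} [Fintype ι] [MeasurableSpace Y]
    {ℓ : EuclideanSpace ℝ (Fin dz) → Y → ℝ} {Q : Measure Y} [IsProbabilityMeasure Q]
    {S : Finset ι} {z : (ι → Y) → EuclideanSpace ℝ (Fin dz)}
    (hz : Function.FactorsThrough z (totalCost ℓ S)) {i j : ι} (hi : i ∈ S) (hj : j ∈ S) :
    ∫ ω, ℓ (z ω) (ω i) ∂(Measure.pi fun _ : ι => Q) =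
      ∫ ω, ℓ (z ω) (ω j) ∂(Measure.pi fun _ : ι => Q) := by
  classical
  have permute := measurePreserving_piCongrLeft (α := fun _ : ι => Y) (fun _ => Q) (Equiv.swap i j)
  rw [← permute.integral_comp' fun ω => ℓ (z ω) (ω i)]
  refine integral_congr_ae (ae_of_all _ fun ω => ?_)
  have permute_apply : ∀ l, MeasurableEquiv.piCongrLeft (fun _ : ι => Y) (Equiv.swap i j) ω l =
      ω (Equiv.swap i j l) := fun l => by
    simpa [MeasurableEquiv.coe_piCongrLeft] using
      Equiv.piCongrLeft_apply_apply (fun _ : ι => Y) (Equiv.swap i j) ω (Equiv.swap i j l)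
  have totalCost_eq : totalCost ℓ S (MeasurableEquiv.piCongrLeft _ (Equiv.swap i j) ω) =
      totalCost ℓ S ω := by
    funext w
    refine Finset.sum_equiv (Equiv.swap i j) (fun l => ?_) fun l _ => by rw [permute_apply]
    rw [Equiv.swap_apply_def]
    split_ifs <;> simp_all
  simp only [hz totalCost_eq, permute_apply, Equiv.swap_apply_left]

lemma Assumptions.integral_cost_apply_eq {dz : ℕ} {ι Y : Type*} [Fintype ι] [MeasurableSpace Y]
    {ℓ : EuclideanSpace ℝ (Fin dz) → Y → ℝ} {Z : Set (EuclideanSpace ℝ (Fin dz))} {Q : Measure Y}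
    {z₀ : EuclideanSpace ℝ (Fin dz)} {M : ℝ} (hA : Assumptions M ℓ Z Q z₀)
    (hℓ : Measurable (Function.uncurry ℓ)) {S : Finset ι}
    {z : (ι → Y) → EuclideanSpace ℝ (Fin dz)} (hz : IsEmpiricalMinimizer ℓ Z S z)
    (factors : Function.FactorsThrough z (totalCost ℓ S)) {i : ι} (hi : i ∈ S) :
    ∫ ω, ℓ (z ω) (ω i) ∂(Measure.pi fun _ : ι => Q) =
      (∫ ω, totalCost ℓ S ω (z ω) ∂(Measure.pi fun _ : ι => Q)) / S.card := by
  have := hA.isProbabilityMeasure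
  have card_ne_zero : (S.card : ℝ) ≠ 0 := by exact_mod_cast Finset.card_ne_zero_of_mem hi
  rw [eq_div_iff card_ne_zero]
  simp only [totalCost]
  rw [integral_finsetSum, Finset.sum_congr rfl fun j hj =>
    integral_cost_eq_of_factorsThrough factors hj hi, Finset.sum_const, nsmul_eq_mul, mul_comm]
  intro j _
  exact Integrable.of_bound (hℓ.comp (hz.measurable.prodMk
    (measurable_pi_apply j))).aestronglyMeasurable M
    ((ae_pi_of_ae (ι := ι) hA.cost_bounded).mono fun ω hω => hω j _ (hz.mem ω))

section Learner

variable {dx dz n k : ℕ} {Y : Type*} [MeasurableSpace Y] {ℓ : EuclideanSpace ℝ (Fin dz) → Y → ℝ}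
  {Z : Set (EuclideanSpace ℝ (Fin dz))}
  {zhat : (Fin n → EuclideanSpace ℝ (Fin dx) × Y) → EuclideanSpace ℝ (Fin dx) →
    EuclideanSpace ℝ (Fin dz)}

namespace IsKNNLearner

lemma mem (h : IsKNNLearner ℓ Z n k zhat) (D : Fin n → EuclideanSpace ℝ (Fin dx) × Y)
    (x : EuclideanSpace ℝ (Fin dx)) : zhat D x ∈ Z := by
  obtain ⟨-, argmin, rule, decides⟩ := h
  obtain ⟨S, -, decision⟩ := decides D x
  exact decision ▸ (rule _).1

lemma measurable_decision (h : IsKNNLearner ℓ Z n k zhat) (x : EuclideanSpace ℝ (Fin dx)) :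
    Measurable fun D => zhat D x := h.1.comp (measurable_id.prodMk measurable_const)

lemma exists_neighbors [Nonempty Y] (h : IsKNNLearner ℓ Z n k zhat)
    {X : Fin n → EuclideanSpace ℝ (Fin dx)} {x : EuclideanSpace ℝ (Fin dx)}
    (hne : ∀ i j, i ≠ j → dist (X i) x ≠ dist (X j) x) :
    ∃ S, IsNearestNeighborSet k X x S ∧
      IsEmpiricalMinimizer ℓ Z S (fun ω => zhat (fun i => (X i, ω i)) x) ∧
      Function.FactorsThrough (fun ω => zhat (fun i => (X i, ω i)) x) (totalCost ℓ S) := by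
  have measurable_data : Measurable fun ω : Fin n → Y => fun i => (X i, ω i) :=
    measurable_pi_lambda _ fun i => measurable_const.prodMk (measurable_pi_apply i)
  have measurable_zhat := (h.measurable_decision x).comp measurable_data
  obtain ⟨-, argmin, rule, decides⟩ := h
  obtain ⟨S, hS, -⟩ := decides (fun i => (X i, Classical.arbitrary Y)) x
  have decision : ∀ ω : Fin n → Y, zhat (fun i => (X i, ω i)) x = argmin (totalCost ℓ S ω) := by
    intro ω
    obtain ⟨T, hT, decision⟩ := decides (fun i => (X i, ω i)) x
    rwa [hS.eq_of_dist_ne hne hT]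
  refine ⟨S, hS, ⟨measurable_zhat, fun ω => ?_, fun ω exists_min => ?_⟩, fun ω ω' hω => ?_⟩
  · exact decision ω ▸ (rule _).1
  · exact decision ω ▸ (rule _).2 exists_min
  · simp only [decision, hω]

end IsKNNLearner

namespace Assumptions

variable {Q : Measure Y} {z₀ : EuclideanSpace ℝ (Fin dz)} {M : ℝ}
  {μ : Measure (EuclideanSpace ℝ (Fin dx))}

lemma ae_prod_cost_bounded (hA : Assumptions M ℓ Z Q z₀) :
    ∀ᵐ p ∂(μ.prod Q), ∀ z ∈ Z, |ℓ z p.2| ≤ M := by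
  have := hA.isProbabilityMeasure
  exact Measure.quasiMeasurePreserving_snd.ae hA.cost_bounded

variable [IsProbabilityMeasure μ] (hA : Assumptions M ℓ Z Q z₀)
  (hℓ : Measurable (Function.uncurry ℓ)) (h : IsKNNLearner ℓ Z n k zhat)

include hA hℓ h

omit hℓ in
lemma integrable_decision (x : EuclideanSpace ℝ (Fin dx)) :
    Integrable (fun D => zhat D x) (datasetLaw (μ.prod Q) n) := by
  have := hA.isProbabilityMeasure
  obtain ⟨C, hC⟩ := hA.isBounded.exists_norm_le
  exact Integrable.of_bound (h.measurable_decision x).aestronglyMeasurable C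
    (ae_of_all _ fun D => hC _ (h.mem D x))

lemma integrable_cost_apply (i : Fin n) :
    Integrable (fun D => ℓ (zhat D (D i).1) (D i).2) (datasetLaw (μ.prod Q) n) := by
  have := hA.isProbabilityMeasure
  have apply_measurable : Measurable fun D : Fin n → EuclideanSpace ℝ (Fin dx) × Y => D i :=
    measurable_pi_apply i
  have bounded : ∀ᵐ D ∂(datasetLaw (μ.prod Q) n), ∀ i, ∀ z ∈ Z, |ℓ z (D i).2| ≤ M :=
    ae_pi_of_ae (ι := Fin n) hA.ae_prod_cost_bounded
  exact Integrable.of_bound (hℓ.comp ((h.1.comp (measurable_id.prodMk apply_measurable.fst)).prodMk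
    apply_measurable.snd)).aestronglyMeasurable M (bounded.mono fun D hD => hD i _ (h.mem D _))

lemma integrable_plugInCost :
    Integrable (fun D => plugInCost ℓ D (zhat D)) (datasetLaw (μ.prod Q) n) :=
  (integrable_finsetSum _ fun i _ => hA.integrable_cost_apply hℓ h i).div_const _

lemma trueCost_eq (D : Fin n → EuclideanSpace ℝ (Fin dx) × Y) :
    trueCost ℓ (μ.prod Q) (zhat D) = ∫ x, expectedCost ℓ Q (zhat D x) ∂μ := by
  have := hA.isProbabilityMeasure
  have measurable_zhat : Measurable (zhat D) := h.1.of_uncurry_left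
  exact integral_prod _ (Integrable.of_bound
    (hℓ.comp ((measurable_zhat.comp measurable_fst).prodMk measurable_snd)).aestronglyMeasurable M
    (hA.ae_prod_cost_bounded.mono fun p hp => hp _ (h.mem D _)))

lemma integrable_expectedCost_uncurry :
    Integrable (fun p => expectedCost ℓ Q (zhat p.1 p.2))
      ((datasetLaw (μ.prod Q) n).prod μ) := by
  have := hA.isProbabilityMeasure
  exact Integrable.of_bound ((hA.measurable_expectedCost hℓ).comp h.1).aestronglyMeasurable M
    (ae_of_all _ fun p => hA.abs_expectedCost_le (h.mem p.1 p.2))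

lemma integrable_trueCost :
    Integrable (fun D => trueCost ℓ (μ.prod Q) (zhat D)) (datasetLaw (μ.prod Q) n) := by
  have := hA.isProbabilityMeasure
  simp_rw [hA.trueCost_eq hℓ h]
  exact (hA.integrable_expectedCost_uncurry hℓ h).integral_prod_left

lemma integrable_expectedCost_decision (x : EuclideanSpace ℝ (Fin dx)) :
    Integrable (fun D => expectedCost ℓ Q (zhat D x)) (datasetLaw (μ.prod Q) n) := by
  have := hA.isProbabilityMeasure
  exact Integrable.of_bound ((hA.measurable_expectedCost hℓ).comp
    (h.measurable_decision x)).aestronglyMeasurable M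
    (ae_of_all _ fun D => hA.abs_expectedCost_le (h.mem D x))

end Assumptions

end Learner

section Expectations

variable {dx dz n k : ℕ} {Y : Type*} [MeasurableSpace Y] {ℓ : EuclideanSpace ℝ (Fin dz) → Y → ℝ}
  {Z : Set (EuclideanSpace ℝ (Fin dz))} {Q : Measure Y} {z₀ : EuclideanSpace ℝ (Fin dz)} {M : ℝ}
  {zhat : (Fin n → EuclideanSpace ℝ (Fin dx) × Y) → EuclideanSpace ℝ (Fin dx) →
    EuclideanSpace ℝ (Fin dz)}
  {μ : Measure (EuclideanSpace ℝ (Fin dx))} [IsProbabilityMeasure μ] {s : Set ℝ}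

lemma IsKNNLearner.integral_decision_mem [IsProbabilityMeasure Q] (h : IsKNNLearner ℓ Z n k zhat)
    (hμ : ∀ x r, μ (Metric.sphere x r) = 0) (convex : Convex ℝ s) (closed : IsClosed s)
    {x : EuclideanSpace ℝ (Fin dx)} {g : EuclideanSpace ℝ (Fin dz) → ℝ}
    (hg : Integrable (fun D => g (zhat D x)) (datasetLaw (μ.prod Q) n))
    (minimizer_mem : ∀ S : Finset (Fin n), S.card = k → ∀ z, IsEmpiricalMinimizer ℓ Z S z →
      ∫ ω, g (z ω) ∂(Measure.pi fun _ : Fin n => Q) ∈ s) :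
    ∫ D, g (zhat D x) ∂(datasetLaw (μ.prod Q) n) ∈ s := by
  have : Nonempty Y := Q.nonempty_of_neZero
  refine integral_datasetLaw_mem convex closed hg ?_
  filter_upwards [ae_forall_dist_ne hμ x] with X hX
  obtain ⟨S, hS, hz, -⟩ := h.exists_neighbors hX
  exact minimizer_mem S hS.1 _ hz

namespace Assumptions

variable (hA : Assumptions M ℓ Z Q z₀) (hℓ : Measurable (Function.uncurry ℓ))
  (h : IsKNNLearner ℓ Z n k zhat)

include hA hℓ h

/-- Every data point is its own nearest neighbour, so the expected in-sample cost is that of an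
outcome entering the empirical minimization. -/
lemma integral_plugInCost_mem (hμ : ∀ x r, μ (Metric.sphere x r) = 0) (convex : Convex ℝ s)
    (closed : IsClosed s) (hn : 0 < n) (hk : 0 < k)
    (minimizer_mem : ∀ S : Finset (Fin n), S.card = k → ∀ z, IsEmpiricalMinimizer ℓ Z S z →
      (∫ ω, totalCost ℓ S ω (z ω) ∂(Measure.pi fun _ : Fin n => Q)) / k ∈ s) :
    ∫ D, plugInCost ℓ D (zhat D) ∂(datasetLaw (μ.prod Q) n) ∈ s := by
  have := hA.isProbabilityMeasure
  have : Nonempty Y := Q.nonempty_of_neZero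
  have hn' : (n : ℝ) ≠ 0 := by exact_mod_cast hn.ne'
  have apply_mem : ∀ i, ∫ D, ℓ (zhat D (D i).1) (D i).2 ∂(datasetLaw (μ.prod Q) n) ∈ s := by
    refine fun i => integral_datasetLaw_mem convex closed (hA.integrable_cost_apply hℓ h i) ?_
    filter_upwards [ae_forall_dist_apply_ne hμ i] with X hX
    obtain ⟨S, hS, hz, factors⟩ := h.exists_neighbors hX
    rw [hA.integral_cost_apply_eq hℓ hz factors (hS.self_mem hk hX), hS.1]
    exact minimizer_mem S hS.1 _ hz
  simp only [plugInCost]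
  rw [integral_div, integral_finsetSum _ fun i _ => hA.integrable_cost_apply hℓ h i,
    Finset.sum_div]
  simp only [div_eq_inv_mul]
  exact convex.sum_mem (fun _ _ => by positivity) (by simp [hn']) fun i _ => apply_mem i

lemma integral_trueCost_mem (convex : Convex ℝ s) (closed : IsClosed s)
    (decision_mem : ∀ x, ∫ D, expectedCost ℓ Q (zhat D x) ∂(datasetLaw (μ.prod Q) n) ∈ s) :
    ∫ D, trueCost ℓ (μ.prod Q) (zhat D) ∂(datasetLaw (μ.prod Q) n) ∈ s := by
  have := hA.isProbabilityMeasure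
  have integrable := hA.integrable_expectedCost_uncurry (μ := μ) hℓ h
  simp_rw [hA.trueCost_eq hℓ h]
  rw [integral_integral_swap integrable]
  exact convex.integral_mem closed (ae_of_all _ decision_mem) integrable.integral_prod_right

end Assumptions

end Expectations

/-! ### Rates of a kNN learner -/

section MeanDeviation

variable {Ω E : Type*} [MeasurableSpace Ω] {P : Measure Ω} [IsProbabilityMeasure P]
  [NormedAddCommGroup E] [NormedSpace ℝ E] [CompleteSpace E] {f : Ω → E}

lemma norm_integral_sub_le (hf : Integrable f P) (a : E) :
    ‖∫ ω, f ω ∂P - a‖ ≤ ∫ ω, ‖f ω - a‖ ∂P := by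
  calc ‖∫ ω, f ω ∂P - a‖ = ‖∫ ω, (f ω - a) ∂P‖ := by
        simp [integral_sub hf (integrable_const a)]
    _ ≤ ∫ ω, ‖f ω - a‖ ∂P := norm_integral_le_integral_norm _

lemma integral_norm_sub_integral_le (hf : Integrable f P) (a : E) :
    ∫ ω, ‖f ω - ∫ ω', f ω' ∂P‖ ∂P ≤ 2 * ∫ ω, ‖f ω - a‖ ∂P := by
  have norm_integrable (b : E) : Integrable (fun ω => ‖f ω - b‖) P :=
    (hf.sub (integrable_const b)).norm
  calc ∫ ω, ‖f ω - ∫ ω', f ω' ∂P‖ ∂P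
      ≤ ∫ ω, (‖f ω - a‖ + ‖∫ ω', f ω' ∂P - a‖) ∂P :=
        integral_mono (norm_integrable _) ((norm_integrable a).add (integrable_const _)) fun ω => by
          simpa using norm_sub_le (f ω - a) (∫ ω', f ω' ∂P - a)
    _ = ∫ ω, ‖f ω - a‖ ∂P + ‖∫ ω', f ω' ∂P - a‖ := by
        simp [integral_add (norm_integrable a) (integrable_const _)]
    _ ≤ 2 * ∫ ω, ‖f ω - a‖ ∂P := by linarith [norm_integral_sub_le hf a]

end MeanDeviation

namespace Assumptions

variable {dx dz : ℕ} {Y : Type*} [MeasurableSpace Y] {ℓ : EuclideanSpace ℝ (Fin dz) → Y → ℝ}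
  {Z : Set (EuclideanSpace ℝ (Fin dz))} {Q : Measure Y} {z₀ : EuclideanSpace ℝ (Fin dz)} {M : ℝ}

variable (hA : Assumptions M ℓ Z Q z₀) (hℓ : Measurable (Function.uncurry ℓ))

include hA hℓ

lemma exists_integral_norm_decision_sub_le :
    ∃ C, ∀ {n k : ℕ} {μ : Measure (EuclideanSpace ℝ (Fin dx))} [IsProbabilityMeasure μ] {zhat},
      (∀ x r, μ (Metric.sphere x r) = 0) → 0 < k → IsKNNLearner ℓ Z n k zhat → ∀ x,
        ∫ D, ‖zhat D x - z₀‖ ∂(datasetLaw (μ.prod Q) n) ≤ C / √k := by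
  have := hA.isProbabilityMeasure
  obtain ⟨C, integral_le⟩ := hA.exists_integral_norm_sub_le hℓ
  refine ⟨C, fun hμ hk h x => h.integral_decision_mem (g := fun z => ‖z - z₀‖) hμ (convex_Iic _)
    isClosed_Iic ((hA.integrable_decision h x).sub (integrable_const z₀)).norm fun S hS z hz => ?_⟩
  have sqrt_mul_le := integral_le S (Finset.card_pos.1 (hS ▸ hk)) z hz
  rwa [integral_const_mul, hS,
    ← le_div_iff₀' (Real.sqrt_pos.2 (by exact_mod_cast hk))] at sqrt_mul_le

lemma exists_variability_le :
    ∃ C, ∀ {n k : ℕ} {μ : Measure (EuclideanSpace ℝ (Fin dx))} [IsProbabilityMeasure μ] {zhat},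
      (∀ x r, μ (Metric.sphere x r) = 0) → 0 < k → IsKNNLearner ℓ Z n k zhat → ∀ x,
        variability (μ.prod Q) n zhat x ≤ C / √k := by
  have := hA.isProbabilityMeasure
  obtain ⟨C, integral_le⟩ := hA.exists_integral_norm_decision_sub_le hℓ (dx := dx)
  refine ⟨2 * C, fun hμ hk h x =>
    (integral_norm_sub_integral_le (hA.integrable_decision h x) z₀).trans ?_⟩
  rw [mul_div_assoc]
  gcongr
  exact integral_le hμ hk h x

lemma exists_le_variability (hnondeg : ¬ ∀ᵐ y ∂Q, fderiv ℝ (fun z => ℓ z y) z₀ = 0) :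
    ∃ c > 0, ∀ᶠ k : ℕ in atTop, ∀ {n : ℕ} {μ : Measure (EuclideanSpace ℝ (Fin dx))}
      [IsProbabilityMeasure μ] {zhat}, (∀ x r, μ (Metric.sphere x r) = 0) →
        IsKNNLearner ℓ Z n k zhat → ∀ x, c / √k ≤ variability (μ.prod Q) n zhat x := by
  have := hA.isProbabilityMeasure
  obtain ⟨K, integral_le⟩ := hA.exists_integral_norm_decision_sub_le hℓ (dx := dx)
  obtain ⟨c, hc, le_integral⟩ := hA.exists_le_integral_norm_sub hℓ hnondeg K
  refine ⟨c, hc, ?_⟩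
  filter_upwards [le_integral, eventually_gt_atTop 0] with k le_integral hk n μ _ zhat hμ h x
  have sqrt_pos : 0 < √(k : ℝ) := Real.sqrt_pos.2 (by exact_mod_cast hk)
  have decision_integrable := hA.integrable_decision (μ := μ) h x
  set b := ∫ D, zhat D x ∂(datasetLaw (μ.prod Q) n)
  have near : √k * ‖b - z₀‖ ≤ K := (le_div_iff₀' sqrt_pos).1
    ((norm_integral_sub_le decision_integrable z₀).trans (integral_le hμ hk h x))
  refine h.integral_decision_mem (g := fun z => ‖z - b‖) hμ (convex_Ici _)
    isClosed_Ici (decision_integrable.sub (integrable_const b)).norm fun S hS z hz => ?_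
  have lower := le_integral S hS z hz b (hS ▸ near)
  rwa [integral_const_mul, hS, ← div_le_iff₀' sqrt_pos] at lower

lemma exists_integral_plugInCost_mem (hnondeg : ¬ ∀ᵐ y ∂Q, fderiv ℝ (fun z => ℓ z y) z₀ = 0) :
    ∃ c > 0, ∃ C : ℝ, ∀ᶠ k : ℕ in atTop, ∀ {n : ℕ} {μ : Measure (EuclideanSpace ℝ (Fin dx))}
      [IsProbabilityMeasure μ] {zhat}, (∀ x r, μ (Metric.sphere x r) = 0) → 0 < n →
        IsKNNLearner ℓ Z n k zhat → ∫ D, plugInCost ℓ D (zhat D) ∂(datasetLaw (μ.prod Q) n) ∈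
          Set.Icc (expectedCost ℓ Q z₀ - C / k) (expectedCost ℓ Q z₀ - c / k) := by
  obtain ⟨c, hc, le_decrease⟩ := hA.exists_le_integral_totalCost_sub hℓ hnondeg
  obtain ⟨C, decrease_le⟩ := hA.exists_integral_totalCost_sub_le hℓ
  refine ⟨c, hc, C, ?_⟩
  filter_upwards [le_decrease, eventually_gt_atTop 0] with k le_decrease hk n μ _ zhat hμ hn h
  have hk' : (0 : ℝ) < k := by exact_mod_cast hk
  refine hA.integral_plugInCost_mem hℓ h hμ (convex_Icc _ _) isClosed_Icc hn hk fun S hS z hz => ?_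
  have lower := le_decrease S hS z hz
  have upper := decrease_le S (Finset.card_pos.1 (hS ▸ hk)) z hz
  rw [integral_sub (hA.integrable_totalCost_comp hℓ S measurable_const fun _ => hA.mem)
    (hA.integrable_totalCost_comp hℓ S hz.measurable hz.mem),
    hA.integral_totalCost hℓ S hA.mem, hS] at lower upper
  rw [Set.mem_Icc, le_div_iff₀ hk', div_le_iff₀ hk', sub_mul, sub_mul,
    div_mul_cancel₀ _ hk'.ne', div_mul_cancel₀ _ hk'.ne']
  constructor <;> linarith

lemma exists_integral_trueCost_mem :
    ∃ C, ∀ {n k : ℕ} {μ : Measure (EuclideanSpace ℝ (Fin dx))} [IsProbabilityMeasure μ] {zhat},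
      (∀ x r, μ (Metric.sphere x r) = 0) → 0 < k → IsKNNLearner ℓ Z n k zhat →
        ∫ D, trueCost ℓ (μ.prod Q) (zhat D) ∂(datasetLaw (μ.prod Q) n) ∈
          Set.Icc (expectedCost ℓ Q z₀) (expectedCost ℓ Q z₀ + C / k) := by
  have := hA.isProbabilityMeasure
  obtain ⟨C, excess_le⟩ := hA.exists_integral_excess_le hℓ
  refine ⟨C, fun hμ hk h => hA.integral_trueCost_mem hℓ h (convex_Icc _ _) isClosed_Icc fun x =>
    h.integral_decision_mem hμ (convex_Icc _ _) isClosed_Icc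
      (hA.integrable_expectedCost_decision hℓ h x) fun S hS z hz => ?_⟩
  have integrable := hA.integrable_expectedCost_comp hℓ hz.measurable hz.mem
  constructor
  · simpa using integral_mono (integrable_const (expectedCost ℓ Q z₀)) integrable
      fun ω => hA.expectedCost_le (hz.mem ω)
  · have excess := excess_le S (Finset.card_pos.1 (hS ▸ hk)) z hz
    rw [integral_const_mul, integral_sub integrable (integrable_const _), hS,
      ← le_div_iff₀' (by exact_mod_cast hk), sub_le_iff_le_add'] at excess
    simpa using excess

lemma exists_plugInBias_mem (hnondeg : ¬ ∀ᵐ y ∂Q, fderiv ℝ (fun z => ℓ z y) z₀ = 0) :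
    ∃ c > (0 : ℝ), ∃ C : ℝ, ∀ᶠ k : ℕ in atTop, ∀ {n : ℕ}
      {μ : Measure (EuclideanSpace ℝ (Fin dx))} [IsProbabilityMeasure μ] {zhat},
        (∀ x r, μ (Metric.sphere x r) = 0) → 0 < n → IsKNNLearner ℓ Z n k zhat →
          plugInBias ℓ (μ.prod Q) n zhat ∈ Set.Icc (-(C / k)) (-(c / k)) := by
  obtain ⟨c, hc, C, plugIn_mem⟩ := hA.exists_integral_plugInCost_mem hℓ hnondeg (dx := dx)
  obtain ⟨C', true_mem⟩ := hA.exists_integral_trueCost_mem hℓ (dx := dx)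
  refine ⟨c, hc, C + C', ?_⟩
  filter_upwards [plugIn_mem, eventually_gt_atTop 0] with k plugIn_mem hk n μ _ zhat hμ hn h
  obtain ⟨le_plugIn, plugIn_le⟩ := plugIn_mem hμ hn h
  obtain ⟨le_true, true_le⟩ := true_mem hμ hk h
  have bias_eq : plugInBias ℓ (μ.prod Q) n zhat =
      ∫ D, plugInCost ℓ D (zhat D) ∂(datasetLaw (μ.prod Q) n) -
        ∫ D, trueCost ℓ (μ.prod Q) (zhat D) ∂(datasetLaw (μ.prod Q) n) :=
    integral_sub (hA.integrable_plugInCost hℓ h) (hA.integrable_trueCost hℓ h)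
  rw [bias_eq, add_div]
  constructor <;> linarith

end Assumptions

/-! ### The law of the covariates -/

/-- The `m` regions of the construction: unit balls with centers on a coordinate axis, spaced so
widely that their distances exceed their diameters. -/
def ballRegion {dx : ℕ} (hdx : 0 < dx) (m : ℕ) (j : Fin m) : Set (EuclideanSpace ℝ (Fin dx)) :=
  Metric.ball (EuclideanSpace.single ⟨0, hdx⟩ (5 * (j : ℝ))) 1

lemma separatedRegions_ballRegion {dx : ℕ} (hdx : 0 < dx) (m : ℕ) :
    SeparatedRegions (ballRegion hdx m) where
  measurableSet _ := Metric.isOpen_ball.measurableSet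
  isBounded _ := Metric.isBounded_ball
  volume_pos _ := Metric.measure_ball_pos _ _ one_pos
  volume_eq i j := by
    rw [ballRegion, ballRegion, Measure.addHaar_ball_center, ← Measure.addHaar_ball_center]
  separated i j hij := by
    refine ⟨3, (Metric.diam_ball zero_le_one).trans_lt (by norm_num), fun x hx y hy => ?_⟩
    set center : Fin m → EuclideanSpace ℝ (Fin dx) :=
      fun l => EuclideanSpace.single ⟨0, hdx⟩ (5 * (l : ℝ))
    have one_le_index_dist : (1 : ℝ) ≤ |(i : ℝ) - j| := by
      have : (i : ℤ) - j ≠ 0 := by omega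
      exact_mod_cast Int.one_le_abs this
    have le_center_dist : 5 ≤ dist (center i) (center j) := by
      rw [PiLp.dist_single_same 2 (fun _ => ℝ), Real.dist_eq, ← mul_sub, abs_mul,
        abs_of_pos (by norm_num : (0 : ℝ) < 5)]
      linarith
    have near_center_i : dist x (center i) < 1 := hx
    have near_center_j : dist y (center j) < 1 := hy
    linarith [dist_triangle4 (center i) x y (center j), dist_comm x (center i)]

/-- The mixture, with equal weights, of the uniform laws on the regions `R i`: the law of the
covariate under `clusterMixture R Q`. -/
def covariateLaw {dx m : ℕ} (R : Fin m → Set (EuclideanSpace ℝ (Fin dx))) :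
    Measure (EuclideanSpace ℝ (Fin dx)) :=
  (m : ℝ≥0∞)⁻¹ • ∑ i, ProbabilityTheory.cond volume (R i)

lemma isProbabilityMeasure_covariateLaw {dx m : ℕ} (hm : m ≠ 0)
    {R : Fin m → Set (EuclideanSpace ℝ (Fin dx))} (hR : SeparatedRegions R) :
    IsProbabilityMeasure (covariateLaw R) := by
  have cond_univ (i : Fin m) : ProbabilityTheory.cond volume (R i) Set.univ = 1 :=
    (ProbabilityTheory.cond_isProbabilityMeasure_of_finite (hR.volume_pos i).ne'
      (hR.isBounded i).measure_lt_top.ne).measure_univ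
  refine ⟨?_⟩
  simp only [covariateLaw, Measure.smul_apply, Measure.finsetSum_apply, cond_univ,
    Finset.sum_const, Finset.card_univ, Fintype.card_fin, nsmul_eq_mul, mul_one, smul_eq_mul]
  exact ENNReal.inv_mul_cancel (by exact_mod_cast hm) (ENNReal.natCast_ne_top m)

lemma covariateLaw_sphere {dx m : ℕ} (hdx : 0 < dx) (R : Fin m → Set (EuclideanSpace ℝ (Fin dx)))
    (x : EuclideanSpace ℝ (Fin dx)) (r : ℝ) : covariateLaw R (Metric.sphere x r) = 0 := by
  have : Nonempty (Fin dx) := ⟨⟨0, hdx⟩⟩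
  have cond_sphere (i : Fin m) : ProbabilityTheory.cond volume (R i) (Metric.sphere x r) = 0 :=
    ProbabilityTheory.cond_absolutelyContinuous (Measure.addHaar_sphere volume x r)
  simp [covariateLaw, cond_sphere]

lemma clusterMixture_const {dx m : ℕ} {Y : Type*} [MeasurableSpace Y]
    (R : Fin m → Set (EuclideanSpace ℝ (Fin dx))) (Q : Measure Y) [SFinite Q] :
    clusterMixture R (fun _ => Q) = (covariateLaw R).prod Q := by
  rw [clusterMixture, covariateLaw, Measure.prod_smul_left, ← Measure.sum_fintype,
    ← Measure.sum_fintype, Measure.prod_sum_left]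

/-! ### Orders of magnitude -/

section Orders

lemma isTheta_of_mem_Icc_neg {α : Type*} {l : Filter α} {f g : α → ℝ} {c C : ℝ} (hc : 0 < c)
    (hg : 0 ≤ᶠ[l] g) (hf : ∀ᶠ a in l, f a ∈ Set.Icc (-(C * g a)) (-(c * g a))) : f =Θ[l] g := by
  refine ⟨IsBigO.of_bound C ?_, IsBigO.of_bound c⁻¹ ?_⟩
  all_goals
    filter_upwards [hg, hf] with a hga ⟨le_f, f_le⟩
    have f_nonpos : f a ≤ 0 := f_le.trans (neg_nonpos.2 (mul_nonneg hc.le hga))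
    rw [Real.norm_of_nonneg hga, Real.norm_of_nonpos f_nonpos]
  · linarith
  · rw [le_inv_mul_iff₀ hc]
    linarith

variable {k : ℕ → ℕ} {γ : ℝ}

lemma tendsto_atTop_of_isTheta_rpow (hγ : 0 < γ)
    (hk : (fun n => (k n : ℝ)) =Θ[atTop] fun n : ℕ => (n : ℝ) ^ γ) : Tendsto k atTop atTop := by
  have tendsto_rpow : Tendsto (fun n : ℕ => (n : ℝ) ^ γ) atTop atTop :=
    (tendsto_rpow_atTop hγ).comp tendsto_natCast_atTop_atTop
  have tendsto_norm := hk.tendsto_norm_atTop_iff.2 (tendsto_norm_atTop_atTop.comp tendsto_rpow)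
  simpa [Function.comp_def, tendsto_natCast_atTop_iff] using tendsto_norm

lemma isTheta_inv_sqrt_of_isTheta_rpow
    (hk : (fun n => (k n : ℝ)) =Θ[atTop] fun n : ℕ => (n : ℝ) ^ (2 * γ)) :
    (fun n => (√(k n : ℝ))⁻¹) =Θ[atTop] fun n : ℕ => (n : ℝ) ^ (-γ) := by
  have sqrt_isTheta := hk.sqrt (.of_forall fun n => Nat.cast_nonneg _)
    (.of_forall fun n => by positivity)
  have sqrt_rpow (n : ℕ) : √((n : ℝ) ^ (2 * γ)) = (n : ℝ) ^ γ := by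
    rw [mul_comm, Real.rpow_mul (Nat.cast_nonneg n), Real.rpow_two, Real.sqrt_sq (by positivity)]
  simpa only [sqrt_rpow, Real.rpow_neg (Nat.cast_nonneg _)] using sqrt_isTheta.inv

end Orders

namespace Assumptions

variable {dx dz : ℕ} {Y : Type*} [MeasurableSpace Y] {ℓ : EuclideanSpace ℝ (Fin dz) → Y → ℝ}
  {Z : Set (EuclideanSpace ℝ (Fin dz))} {Q : Measure Y} {z₀ : EuclideanSpace ℝ (Fin dz)} {M : ℝ}
  {μ : ℕ → Measure (EuclideanSpace ℝ (Fin dx))} [∀ n, IsProbabilityMeasure (μ n)] {k : ℕ → ℕ}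
  {zhat : ∀ n, (Fin n → EuclideanSpace ℝ (Fin dx) × Y) → EuclideanSpace ℝ (Fin dx) →
    EuclideanSpace ℝ (Fin dz)}
  (hA : Assumptions M ℓ Z Q z₀) (hℓ : Measurable (Function.uncurry ℓ))
  (hnondeg : ¬ ∀ᵐ y ∂Q, fderiv ℝ (fun z => ℓ z y) z₀ = 0)
  (hμ : ∀ n x r, μ n (Metric.sphere x r) = 0) (h : ∀ n, IsKNNLearner ℓ Z n (k n) (zhat n))

include hA hℓ hnondeg hμ h

theorem hasVariabilityRate {γ : ℝ} (hγ : 0 < γ)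
    (hk : (fun n => (k n : ℝ)) =Θ[atTop] fun n : ℕ => (n : ℝ) ^ (2 * γ)) :
    HasVariabilityRate (fun n => (μ n).prod Q) zhat γ := by
  obtain ⟨C, variability_le⟩ := hA.exists_variability_le hℓ (dx := dx)
  obtain ⟨c, hc, le_variability⟩ := hA.exists_le_variability hℓ hnondeg (dx := dx)
  have k_atTop := tendsto_atTop_of_isTheta_rpow (by positivity) hk
  have rate := isTheta_inv_sqrt_of_isTheta_rpow hk
  obtain ⟨a, ha, rate_le⟩ := (rate.1.const_mul_left C).exists_pos
  obtain ⟨b, hb, le_rate⟩ := rate.2.exists_pos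
  refine ⟨c / b, by positivity, a, ha, ?_⟩
  filter_upwards [rate_le.bound, le_rate.bound, k_atTop.eventually le_variability,
    k_atTop.eventually_gt_atTop 0] with n rate_le le_rate le_variability hk0
  refine ae_of_all _ fun x => ⟨?_, ?_⟩
  · rw [Real.norm_of_nonneg (by positivity), Real.norm_of_nonneg (by positivity)] at le_rate
    calc c / b * (n : ℝ) ^ (-γ) ≤ c / b * (b * (√(k n : ℝ))⁻¹) := by gcongr
      _ = c / √(k n) := by field_simp
      _ ≤ variability ((μ n).prod Q) n (zhat n) x := le_variability (hμ n) (h n) x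
  · rw [Real.norm_of_nonneg (by positivity : 0 ≤ (n : ℝ) ^ (-γ))] at rate_le
    calc variability ((μ n).prod Q) n (zhat n) x ≤ C / √(k n) := variability_le (hμ n) hk0 (h n) x
      _ = C * (√(k n : ℝ))⁻¹ := div_eq_mul_inv _ _
      _ ≤ a * (n : ℝ) ^ (-γ) := (le_abs_self _).trans rate_le

variable (k_atTop : Tendsto k atTop atTop)

include k_atTop

lemma exists_eventually_plugInBias_mem :
    ∃ c > (0 : ℝ), ∃ C : ℝ, ∀ᶠ n in atTop, plugInBias ℓ ((μ n).prod Q) n (zhat n) ∈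
      Set.Icc (-(C / k n)) (-(c / k n)) := by
  obtain ⟨c, hc, C, bias_mem⟩ := hA.exists_plugInBias_mem hℓ hnondeg (dx := dx)
  refine ⟨c, hc, C, ?_⟩
  filter_upwards [k_atTop.eventually bias_mem, eventually_gt_atTop 0] with n bias_mem hn
  exact bias_mem (hμ n) hn (h n)

theorem eventually_plugInBias_neg :
    ∀ᶠ n in atTop, plugInBias ℓ ((μ n).prod Q) n (zhat n) < 0 := by
  obtain ⟨c, hc, C, bias_mem⟩ := hA.exists_eventually_plugInBias_mem hℓ hnondeg hμ h k_atTop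
  filter_upwards [bias_mem, k_atTop.eventually_gt_atTop 0] with n bias_mem hk
  exact bias_mem.2.trans_lt (neg_neg_of_pos (div_pos hc (by exact_mod_cast hk)))

theorem isTheta_plugInBias :
    (fun n => plugInBias ℓ ((μ n).prod Q) n (zhat n)) =Θ[atTop] fun n => 1 / (k n : ℝ) := by
  obtain ⟨c, hc, C, bias_mem⟩ := hA.exists_eventually_plugInBias_mem hℓ hnondeg hμ h k_atTop
  exact isTheta_of_mem_Icc_neg hc (.of_forall fun n => by positivity)
    (by simpa only [mul_one_div] using bias_mem)

end Assumptions

end KNNBias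

end

theorem mainTheorem8 {dx dz : ℕ} (hdx : 0 < dx) {Y : Type*} [MeasurableSpace Y]
    (ℓ : EuclideanSpace ℝ (Fin dz) → Y → ℝ) (hℓ : Measurable (Function.uncurry ℓ))
    (Z : Set (EuclideanSpace ℝ (Fin dz))) (M : ℝ)
    -- some law of the outcome satisfies the assumptions, and is not degenerate
    (Q₀ : Measure Y) (z₀ : EuclideanSpace ℝ (Fin dz))
    (hQ₀ : KNNBias.Assumptions M ℓ Z Q₀ z₀)
    (hnondeg : ¬ ∀ᵐ y ∂Q₀, fderiv ℝ (fun z => ℓ z y) z₀ = 0)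
    -- the number of neighbours
    (k : ℕ → ℕ) (hk_le : ∀ n, k n ≤ n) (γv : ℝ) (hγv : 0 < γv) (hγv' : γv ≤ 1 / 2)
    (hk : (fun n : ℕ => (k n : ℝ)) =Θ[atTop] fun n : ℕ => (n : ℝ) ^ (2 * γv)) :
    ∃ (Q : ℕ → Measure Y) (zo : ℕ → EuclideanSpace ℝ (Fin dz))
      (R : ∀ n, Fin (max 1 (n / (2 * k n))) → Set (EuclideanSpace ℝ (Fin dx)))
      (P : ℕ → Measure (EuclideanSpace ℝ (Fin dx) × Y)),
      (∀ j, KNNBias.Assumptions M ℓ Z (Q j) (zo j)) ∧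
      (∀ n, KNNBias.SeparatedRegions (R n)) ∧
      (∀ n, P n = KNNBias.clusterMixture (R n) fun j => Q j) ∧
      (∀ n, IsProbabilityMeasure (P n)) ∧
      ∀ zhat : ∀ n, (Fin n → EuclideanSpace ℝ (Fin dx) × Y) → EuclideanSpace ℝ (Fin dx) →
          EuclideanSpace ℝ (Fin dz),
        (∀ n, KNNBias.IsKNNLearner ℓ Z n (k n) (zhat n)) →
        (∀ n, Integrable (fun D => KNNBias.plugInCost ℓ D (zhat n D))
            (KNNBias.datasetLaw (P n) n) ∧
          Integrable (fun D => KNNBias.trueCost ℓ (P n) (zhat n D))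
            (KNNBias.datasetLaw (P n) n)) ∧
        KNNBias.HasVariabilityRate P zhat γv ∧
        (∀ᶠ n in atTop, KNNBias.plugInBias ℓ (P n) n (zhat n) < 0) ∧
        (fun n => KNNBias.plugInBias ℓ (P n) n (zhat n)) =Θ[atTop] (fun n => 1 / (k n : ℝ)) ∧
        (fun n => KNNBias.plugInBias ℓ (P n) n (zhat n)) =Θ[atTop]
          (fun n => (n : ℝ) ^ (-(2 * γv))) := by
  have := hQ₀.isProbabilityMeasure
  set R : ∀ n, Fin (max 1 (n / (2 * k n))) → Set (EuclideanSpace ℝ (Fin dx)) :=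
    fun n => KNNBias.ballRegion hdx _
  have hR (n : ℕ) : KNNBias.SeparatedRegions (R n) := KNNBias.separatedRegions_ballRegion hdx _
  have (n : ℕ) : IsProbabilityMeasure (KNNBias.covariateLaw (R n)) :=
    KNNBias.isProbabilityMeasure_covariateLaw (Nat.one_le_iff_ne_zero.1 (le_max_left _ _)) (hR n)
  have null_sphere (n : ℕ) := KNNBias.covariateLaw_sphere hdx (R n)
  have k_atTop := KNNBias.tendsto_atTop_of_isTheta_rpow (by positivity) hk
  refine ⟨fun _ => Q₀, fun _ => z₀, R, fun n => (KNNBias.covariateLaw (R n)).prod Q₀,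
    fun _ => hQ₀, hR, fun n => (KNNBias.clusterMixture_const (R n) Q₀).symm,
    fun n => inferInstance, fun zhat h => ?_⟩
  have bias_isTheta := hQ₀.isTheta_plugInBias hℓ hnondeg null_sphere h k_atTop
  exact ⟨fun n => ⟨hQ₀.integrable_plugInCost hℓ (h n), hQ₀.integrable_trueCost hℓ (h n)⟩,
    hQ₀.hasVariabilityRate hℓ hnondeg null_sphere h hγv hk,
    hQ₀.eventually_plugInBias_neg hℓ hnondeg null_sphere h k_atTop,
    bias_isTheta, bias_isTheta.trans <| by
      simpa only [one_div, ← Real.rpow_neg (Nat.cast_nonneg _)] using hk.inv⟩
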